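/- \textbf{Setting.} $F$ is a field (no involution), $V$ an $F$-vector space with basis $\bar v=(v_1,\dots,v_d)$, and $L(V)$ the lattice of all subspaces of $V$ with join $+$, meet $\cap$, $0$ and $1=V$. $\Lambda'_L$ is the first order language of bounded lattices, $\Lambda'_F$ that of rings. $\Sigma_k$ ($\Pi_k$) denotes prenex formulas with at most $k$ quantifier blocks, the first one existential (universal). For a $d\times d$-matrix $A$ let $\mathrm{Sp}_{\bar v}(A)$ be the span of the vectors $\sum_i a_{ij}v_i$; for $M\subseteq L(V)^n$ let $\theta_{L\bar vF}(M)=\{\bar A\mid(\mathrm{Sp}_{\bar v}(A_1),\dots,\mathrm{Sp}_{\bar v}(A_n))\in M\}$. For $0<k\le d$ and $\mathrm{rk}A=k$ let $P_k(A)\subseteq F^{\binom dk}$ be the set of nonzero vectors in the span of the vectors of $k\times k$-minors of $A$ with fixed choice of $k$ columns; $P_0(0)=\{0\}$. $\Gamma_k(F)=\bigcup_{\mathrm{rk}A=k}P_k(A)$; for $\underline d=(d_1,\dots,d_n)$ with $d_i\le d$ let $\Gamma_{\underline d}(F)=\prod_i\Gamma_{d_i}(F)$ and $L(V)^{\underline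 d}=\{\bar u\mid\dim u_i=d_i\}$. For $M\subseteq L(V)^n$ let $\theta_{\underline d}(M)$ (w.r.t. $\bar v$) be the union of the $\prod_iP_{d_i}(A_i)$ over all $\bar A\in\theta_{L\bar vF}(M)$ with $\mathrm{rk}A_i=d_i$; conversely, for $\Delta\subseteq\Gamma_{\underline d}(F)$ let $\theta^{-}_{\underline d}(\Delta)$ be the set of all $(\mathrm{Sp}_{\bar v}(A_i))_i$ with $\mathrm{rk}A_i=d_i$ such that some $\underline r\in\Delta$ has $\underline r_i\in P_{d_i}(A_i)$ for all $i$. $M$ is \emph{invariant} if it is invariant under $\mathrm{GL}(V)$; $\Delta$ is \emph{scalar invariant} if it is invariant under independent nonzero scalings of the components, and \emph{bi-invariant} if, in addition, it is invariant under the action $P_{d_i}(A_i)\mapsto P_{d_i}(TA_i)$ of $T\in\mathrm{GL}_d(F)$. The multi-sorted structure $\Gamma(F)$ has sorts $\Gamma_k(F)$, $k\le d$; its formulas are built from equations $p=0$, $p$ a polynomial with integer coefficients in the coordinates of the (sorted) variables, quantifiers ranging over the sorts. A formula is \emph{homogeneous} if each of these $p$ is homogeneous in the coordinates of each variable separately.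 A \emph{frame} of $L(V)$, $d\ge3$, is a family $\bar a=(a_{ij})_{i,j\le d}$ with, for pairwise distinct $i,j,k$ and $a_i=a_{ii}$: $V=\bigoplus_\ell a_\ell$, $a_{ij}=a_{ji}$, $a_i+a_j=a_i\oplus a_{ij}$, $a_{ik}=(a_i+a_k)\cap(a_{ij}+a_{jk})$; it has a corresponding basis $\bar w$, $a_i=w_iF$, $a_{ij}=(w_j-w_i)F$. For a relation on $F$ defined by $\phi(x_1,\dots,x_n)$ let $M_\phi\subseteq L(V)^{d^2+n}$ be the set of all $(\bar a,\bar b)$ such that $\bar a$ is a frame with corresponding basis $\bar w$ and $b_k=(w_1-r_kw_2)F$ with $F\models\phi(\bar r)$. \textbf{Statement.} \begin{itemize} \item[(A)] For each $d$ there is a map $\tau$ from $\Lambda'_L$ to $\Lambda'_F$, mapping quantifier free formulas to such, so that for every $F$, every $d$-dimensional $V$ and every basis $\bar v$: if $\phi$ defines $M\subseteq L(V)^n$ then $\tau(\phi)$ defines $\theta_{L\bar vF}(M)$. \item[(B)] Let $d\ge3$ and let $\underline d$ be a dimension vector. For every $F,V,\bar v$, the map $\theta_{\underline d}$ is a bijection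 from the invariant subsets of $L(V)^{\underline d}$ onto the bi-invariant subsets of $\Gamma_{\underline d}(F)$. (i) There is a map $\tau:\Lambda'_L\to\Lambda'_F$, preserving quantifier freeness and $\Sigma_1$, such that for every $F,V,\bar v$: if $M$ is defined by $\phi$ within $L(V)^{\underline d}$, then $\theta_{\underline d}(M)$ is bi-invariant and defined within $\Gamma_{\underline d}(F)$ by the scalar invariant formula $\tau(\phi)$. (ii) There is a map $\tau':\Lambda'_F\to\Lambda'_L$, preserving $\Sigma_1$, such that for every $F,V,\bar v$: if a bi-invariant $\Delta$ is defined by $\chi$ within $\Gamma_{\underline d}(F)$, then $\theta^-_{\underline d}(\Delta)$ is defined by $\tau'(\chi)$ within $L(V)^{\underline d}$. \item[(C)] Let $k\ge1$ and let $\phi(x_1,\dots,x_n)\in\Lambda'_L$ be in $\Sigma_k$ ($\Pi_k$). For each $\underline d$ there is a homogeneous formula in $\Sigma_k$ ($\Pi_k$) which, for every $F$, defines $\theta_{\underline d}(M)$ within $\Gamma_{\underline d}(F)$ if $\phi$ defines $M$ within $L(F^d)^{\underline d}$. Likewise, if $\phi$ defines $M$ within $L(F^d)^n$ then $\bigcup_{\underline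 d}\theta_{\underline d}(M)$ is defined within $\Gamma(F)$ by a homogeneous $\Sigma_k$- ($\Pi_k$-) description, having one disjunct, in variables of the respective sorts, for each dimension vector $\underline d$. (Canonical basis of $F^d$.) \item[(D)] Let $d\ge3$ and $\underline d=(1,\dots,1)$. A subset $S$ of $\Gamma_{\underline d}(F)$ is bi-invariant and definable within it by a homogeneous $\Sigma_1$-formula if and only if $S=\theta_{\underline d}(M)$ for some $M$ definable within $L(F^d)^{\underline d}$ by a formula $\exists\bar y\,\bigl(\bigwedge_it_i(\bar x,\bar y)=0\wedge\bigwedge_js_j(\bar x,\bar y)=1\bigr)$ with $\Lambda'_L$-terms $t_i,s_j$. \item[(E)] Let $d\ge3$. For each quantifier free formula $\phi(\bar x)$ in the language of rings with inversion ($0^{-1}=0$) there are finitely many $\Lambda'_L$-terms $t_i,s_j$ such that for all $F$ and $V$ with $\dim V=d$: $M_\phi=\{(\bar a,\bar b)\mid\bigwedge_it_i(\bar a,\bar b)=0\wedge\bigwedge_js_j(\bar a,\bar b)=1\}$. \item[(F)] Let $d\ge3$, $F$ a subfield of $\mathbb C$, $V=F^d$. (i) For $\phi$ the formula $x\ne0$,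 $\theta_{(1,\dots,1)}(M_\phi)$ cannot be defined within $\Gamma(F)$ by a quantifier free positive (negation free) formula. (ii) For $\phi$ the formula $x_1=0\vee x_2\neq0$, $\theta_{(1,\dots,1)}(M_\phi)$ cannot be defined within $\Gamma(F)$ by a conjunction of equations and negated equations. (In both cases homogeneity is not required.) In both cases $M_\phi$ can be defined within $L(F^d)$ by a conjunction of equations $t_i=0$, $s_j=1$. \end{itemize} -/

import Mathlib

open FirstOrder FirstOrder.Language

universe u v

/-! ### First order languages -/

/-- Operation symbols of bounded lattices: join, meet, `0`, `1`. -/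
inductive LatFunc : ℕ → Type
  | sup : LatFunc 2
  | inf : LatFunc 2
  | bot : LatFunc 0
  | top : LatFunc 0

/-- The language of bounded lattices (no relation symbols besides equality). -/
def latLang : FirstOrder.Language.{0, 0} where
  Functions := LatFunc
  Relations := fun _ => Empty

/-- A bounded lattice as a structure for `latLang`. -/
@[reducible]
def latStructure (L : Type*) [Lattice L] [BoundedOrder L] : latLang.Structure L where
  funMap := fun {_} f =>
    match f with
    | LatFunc.sup => fun x => x 0 ⊔ x 1
    | LatFunc.inf => fun x => x 0 ⊓ x 1
    | LatFunc.bot => fun _ => ⊥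
    | LatFunc.top => fun _ => ⊤
  RelMap := fun {_} r => r.elim

/-- The value of a lattice term. -/
def latEval {L : Type*} [Lattice L] [BoundedOrder L] {α : Type*}
    (t : latLang.Term α) (w : α → L) : L :=
  letI := latStructure L
  t.realize w

/-- Validity of a lattice formula in a bounded lattice. -/
def LatHolds {L : Type*} [Lattice L] [BoundedOrder L] {α : Type*}
    (φ : latLang.Formula α) (w : α → L) : Prop :=
  letI := latStructure L
  φ.Realize w

/-- Validity of a formula of the language of rings in a field. -/
def RingHolds {F : Type*} [Field F] {α : Type*}
    (φ : Language.ring.Formula α) (r : α → F) : Prop :=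
  letI := Ring.compatibleRingOfRing F
  φ.Realize r

/-- Operation symbols of rings together with a unary symbol for `r ↦ r⁻¹`, where `0⁻¹ = 0`. -/
inductive RingInvFunc : ℕ → Type
  | add : RingInvFunc 2
  | mul : RingInvFunc 2
  | neg : RingInvFunc 1
  | inv : RingInvFunc 1
  | zero : RingInvFunc 0
  | one : RingInvFunc 0

/-- The language of rings with inversion. -/
def ringInvLang : FirstOrder.Language.{0, 0} where
  Functions := RingInvFunc
  Relations := fun _ => Empty

/-- A field as a structure for `ringInvLang`. -/
@[reducible]
def ringInvStructure (F : Type*) [Field F] : ringInvLang.Structure F where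
  funMap := fun {_} f =>
    match f with
    | RingInvFunc.add => fun x => x 0 + x 1
    | RingInvFunc.mul => fun x => x 0 * x 1
    | RingInvFunc.neg => fun x => -x 0
    | RingInvFunc.inv => fun x => (x 0)⁻¹
    | RingInvFunc.zero => fun _ => 0
    | RingInvFunc.one => fun _ => 1
  RelMap := fun {_} r => r.elim

/-- Validity of a formula of the language of rings with inversion in a field. -/
def RingInvHolds {F : Type*} [Field F] {α : Type*}
    (φ : ringInvLang.Formula α) (r : α → F) : Prop :=
  letI := ringInvStructure F
  φ.Realize r

/-- `PrenexClass true k` is the class `Σ_k` and `PrenexClass false k` the class `Π_k`: prenex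
formulas with at most `k` blocks of like quantifiers, the first one existential (resp. universal);
leading blocks may be empty. -/
inductive PrenexClass {L : FirstOrder.Language.{0, 0}} {α : Type} :
    Bool → ℕ → ∀ {n : ℕ}, L.BoundedFormula α n → Prop
  | qf {b : Bool} {k n : ℕ} {φ : L.BoundedFormula α n} (h : φ.IsQF) : PrenexClass b k φ
  | ex {k n : ℕ} {φ : L.BoundedFormula α (n + 1)} (h : PrenexClass true (k + 1) φ) :
      PrenexClass true (k + 1) φ.ex
  | all {k n : ℕ} {φ : L.BoundedFormula α (n + 1)} (h : PrenexClass false (k + 1) φ) :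
      PrenexClass false (k + 1) φ.all
  | switch {b : Bool} {k n : ℕ} {φ : L.BoundedFormula α n} (h : PrenexClass (!b) k φ) :
      PrenexClass b (k + 1) φ

/-! ### Subspaces, matrices and Grassmann-Plücker coordinates -/

section Coordinates

variable {F : Type*} [Field F] {V : Type*} [AddCommGroup V] [Module F V] {d : ℕ} {ι : Type*}

/-- The span of the columns of `A`, read as vectors of `V` via the basis `b`. -/
def colSpan (b : Module.Basis (Fin d) F V) (A : Matrix (Fin d) (Fin d) F) : Submodule F V :=
  Submodule.span F (Set.range fun j => ∑ i, A i j • b i)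

/-- The set of all tuples of matrices whose column spans (via `b`) form a tuple in `M`. -/
def thetaLF (b : Module.Basis (Fin d) F V) (M : Set (ι → Submodule F V)) :
    Set (ι → Matrix (Fin d) (Fin d) F) :=
  {A | ∃ u ∈ M, ∀ k, u k = colSpan b (A k)}

/-- The set of all tuples of subspaces which are the column spans (via `b`) of a tuple in `K`. -/
def thetaFL (b : Module.Basis (Fin d) F V) (K : Set (ι → Matrix (Fin d) (Fin d) F)) :
    Set (ι → Submodule F V) :=
  {u | ∃ A ∈ K, ∀ k, u k = colSpan b (A k)}

/-- Tuples of subspaces with prescribed dimensions. -/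
def dimSet (F V : Type*) [Field F] [AddCommGroup V] [Module F V] (dv : ι → ℕ) :
    Set (ι → Submodule F V) :=
  {u | ∀ k, Module.finrank F (u k) = dv k}

/-- Invariance of a set of tuples of subspaces under all linear automorphisms. -/
def LatInvariant (M : Set (ι → Submodule F V)) : Prop :=
  ∀ (g : V ≃ₗ[F] V), ∀ u ∈ M, (fun k => (u k).map (g : V →ₗ[F] V)) ∈ M

/-- Strictly increasing `k`-tuples of indices; they index the Plücker coordinates. -/
abbrev PlIdx (d k : ℕ) : Type := Fin k ↪o Fin d

/-- The set of projective Grassmann-Plücker coordinates of a matrix of rank `k`: all nonzero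
vectors in the span of the vectors of `k × k` minors for fixed choices of `k` columns.
By convention it is `{0}` for `k = 0`. -/
def plucker (k : ℕ) (A : Matrix (Fin d) (Fin d) F) : Set (PlIdx d k → F) :=
  if k = 0 then {0}
  else
    (Submodule.span F (Set.range fun (j : PlIdx d k) =>
      (fun i : PlIdx d k => (A.submatrix i j).det)) : Set (PlIdx d k → F)) \ {0}

/-- The (affine cone, without origin, over the) Grassmannian of `k`-dimensional subspaces. -/
def Gr (F : Type*) [Field F] (d k : ℕ) : Set (PlIdx d k → F) :=
  {r | ∃ A : Matrix (Fin d) (Fin d) F, A.rank = k ∧ r ∈ plucker k A}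

/-- The product of the Grassmannians given by a dimension vector. -/
def GrProd (F : Type*) [Field F] (d : ℕ) (dv : ι → ℕ) : Set (∀ k, PlIdx d (dv k) → F) :=
  {r | ∀ k, r k ∈ Gr F d (dv k)}

/-- Passage from tuples of matrices of ranks `dv k` to Plücker coordinates. -/
def thetaFG (dv : ι → ℕ) (K : Set (ι → Matrix (Fin d) (Fin d) F)) :
    Set (∀ k, PlIdx d (dv k) → F) :=
  {r | ∃ A ∈ K, (∀ k, (A k).rank = dv k) ∧ ∀ k, r k ∈ plucker (dv k) (A k)}

/-- Passage from Plücker coordinates to tuples of matrices of ranks `dv k`. -/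
def thetaGF (dv : ι → ℕ) (Δ : Set (∀ k, PlIdx d (dv k) → F)) :
    Set (ι → Matrix (Fin d) (Fin d) F) :=
  {A | (∀ k, (A k).rank = dv k) ∧ ∃ r ∈ Δ, ∀ k, r k ∈ plucker (dv k) (A k)}

/-- Passage from tuples of subspaces to Plücker coordinates w.r.t. the basis `b`: all tuples of
Plücker coordinates of tuples in `M` having dimension vector `dv`. -/
def thetaLG (b : Module.Basis (Fin d) F V) (dv : ι → ℕ) (M : Set (ι → Submodule F V)) :
    Set (∀ k, PlIdx d (dv k) → F) :=
  thetaFG dv (thetaLF b M)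

/-- Passage from Plücker coordinates w.r.t. the basis `b` to tuples of subspaces. -/
def thetaGL (b : Module.Basis (Fin d) F V) (dv : ι → ℕ) (Δ : Set (∀ k, PlIdx d (dv k) → F)) :
    Set (ι → Submodule F V) :=
  thetaFL b (thetaGF dv Δ)

/-- Invariance under independent nonzero scalings of the members of a tuple. -/
def ScalarInvariant {dv : ι → ℕ} (Δ : Set (∀ k, PlIdx d (dv k) → F)) : Prop :=
  ∀ c : ι → F, (∀ k, c k ≠ 0) → ∀ r ∈ Δ, (fun k => c k • r k) ∈ Δ

/-- Scalar invariance together with invariance under the action of the general linear group. -/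
def BiInvariant {dv : ι → ℕ} (Δ : Set (∀ k, PlIdx d (dv k) → F)) : Prop :=
  ScalarInvariant Δ ∧
    ∀ T : Matrix (Fin d) (Fin d) F, IsUnit T →
      ∀ A : ι → Matrix (Fin d) (Fin d) F, (∀ k, (A k).rank = dv k) →
        ∀ r s : ∀ k, PlIdx d (dv k) → F,
          (∀ k, r k ∈ plucker (dv k) (A k)) → (∀ k, s k ∈ plucker (dv k) (T * A k)) →
            r ∈ Δ → s ∈ Δ

end Coordinates

/-- The set defined within the product of Grassmannians by a ring formula whose variables are
the coordinates. -/
def ringDefined (F : Type*) [Field F] {d : ℕ} {ι : Type} (dv : ι → ℕ)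
    (χ : Language.ring.Formula (Σ k : ι, PlIdx d (dv k))) : Set (∀ k, PlIdx d (dv k) → F) :=
  {r | r ∈ GrProd F d dv ∧ RingHolds χ (fun x => r x.1 x.2)}

/-- A ring formula in coordinates is scalar invariant (w.r.t. `F`) if on the product of
Grassmannians its validity is not affected by nonzero scalings. -/
def ScalarInvariantFormula (F : Type*) [Field F] {d : ℕ} {ι : Type} (dv : ι → ℕ)
    (χ : Language.ring.Formula (Σ k : ι, PlIdx d (dv k))) : Prop :=
  ∀ r ∈ GrProd F d dv, ∀ c : ι → F, (∀ k, c k ≠ 0) →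
    (RingHolds χ (fun x => r x.1 x.2) ↔ RingHolds χ (fun x => c x.1 * r x.1 x.2))

/-! ### Formulas over the multi-sorted structure of Grassmannians -/

/-- Sorts of variables after adding one variable of sort `k`. -/
def extSort {α : Type} (s : α → ℕ) (k : ℕ) : Option α → ℕ
  | none => k
  | some a => s a

/-- Values of variables after adding a value for the new variable. -/
def extVal {F : Type*} {d : ℕ} {α : Type} {s : α → ℕ} {k : ℕ}
    (r : ∀ a, PlIdx d (s a) → F) (x : PlIdx d k → F) : ∀ a, PlIdx d (extSort s k a) → F
  | none => x
  | some a => r a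

/-- Multi-sorted formulas, the sorts being the dimensions `k ≤ d`. A variable `a : α` of sort `s a`
stands for a string of scalar variables, one for each Plücker coordinate in dimension `s a`; atomic
formulas are equations `p = 0` for polynomials with integer coefficients in these scalar variables;
quantification is over the members of the Grassmannian of the indicated sort. -/
inductive GrForm (d : ℕ) : (α : Type) → (α → ℕ) → Type 1
  | bot {α : Type} {s : α → ℕ} : GrForm d α s
  | top {α : Type} {s : α → ℕ} : GrForm d α s
  | eqn {α : Type} {s : α → ℕ} (p : MvPolynomial (Σ a : α, PlIdx d (s a)) ℤ) : GrForm d α s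
  | not {α : Type} {s : α → ℕ} (φ : GrForm d α s) : GrForm d α s
  | and {α : Type} {s : α → ℕ} (φ ψ : GrForm d α s) : GrForm d α s
  | or {α : Type} {s : α → ℕ} (φ ψ : GrForm d α s) : GrForm d α s
  | ex {α : Type} {s : α → ℕ} (k : ℕ) (hk : k ≤ d) (φ : GrForm d (Option α) (extSort s k)) :
      GrForm d α s
  | all {α : Type} {s : α → ℕ} (k : ℕ) (hk : k ≤ d) (φ : GrForm d (Option α) (extSort s k)) :
      GrForm d α s

namespace GrForm

/-- Validity of a formula over the Grassmannians of `F`. -/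
def Holds (F : Type*) [Field F] {d : ℕ} : {α : Type} → {s : α → ℕ} → GrForm d α s →
    (∀ a, PlIdx d (s a) → F) → Prop
  | _, _, bot, _ => False
  | _, _, top, _ => True
  | _, _, eqn p, r => MvPolynomial.aeval (fun x => r x.1 x.2) p = 0
  | _, _, not φ, r => ¬ Holds F φ r
  | _, _, and φ ψ, r => Holds F φ r ∧ Holds F ψ r
  | _, _, or φ ψ, r => Holds F φ r ∨ Holds F ψ r
  | _, _, ex k _ φ, r => ∃ x ∈ Gr F d k, Holds F φ (extVal r x)
  | _, _, all k _ φ, r => ∀ x ∈ Gr F d k, Holds F φ (extVal r x)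

open Classical in
/-- A polynomial is multihomogeneous if, for every variable `a`, it is homogeneous in the
coordinates of `a`, the other coordinates being considered as constants. -/
def MultiHomogeneous {d : ℕ} {α : Type} {s : α → ℕ}
    (p : MvPolynomial (Σ a : α, PlIdx d (s a)) ℤ) : Prop :=
  ∀ a : α, ∃ m : ℕ,
    MvPolynomial.IsWeightedHomogeneous (fun x : Σ a : α, PlIdx d (s a) => if x.1 = a then 1 else 0)
      p m

/-- A formula is homogeneous if so are its atomic subformulas. -/
def IsHomogeneous {d : ℕ} : {α : Type} → {s : α → ℕ} → GrForm d α s → Prop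
  | _, _, bot => True
  | _, _, top => True
  | _, _, eqn p => MultiHomogeneous p
  | _, _, not φ => IsHomogeneous φ
  | _, _, and φ ψ => IsHomogeneous φ ∧ IsHomogeneous ψ
  | _, _, or φ ψ => IsHomogeneous φ ∧ IsHomogeneous ψ
  | _, _, ex _ _ φ => IsHomogeneous φ
  | _, _, all _ _ φ => IsHomogeneous φ

/-- Quantifier free formulas. -/
def IsQF {d : ℕ} : {α : Type} → {s : α → ℕ} → GrForm d α s → Prop
  | _, _, bot => True
  | _, _, top => True
  | _, _, eqn _ => True
  | _, _, not φ => IsQF φ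
  | _, _, and φ ψ => IsQF φ ∧ IsQF ψ
  | _, _, or φ ψ => IsQF φ ∧ IsQF ψ
  | _, _, ex _ _ _ => False
  | _, _, all _ _ _ => False

/-- Formulas without negation. -/
def IsPositive {d : ℕ} : {α : Type} → {s : α → ℕ} → GrForm d α s → Prop
  | _, _, bot => True
  | _, _, top => True
  | _, _, eqn _ => True
  | _, _, not _ => False
  | _, _, and φ ψ => IsPositive φ ∧ IsPositive ψ
  | _, _, or φ ψ => IsPositive φ ∧ IsPositive ψ
  | _, _, ex _ _ φ => IsPositive φ
  | _, _, all _ _ φ => IsPositive φ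

/-- Equations and negated equations (including truth and falsity). -/
def IsLiteral {d : ℕ} {α : Type} {s : α → ℕ} : GrForm d α s → Prop
  | bot => True
  | top => True
  | eqn _ => True
  | not (eqn _) => True
  | _ => False

/-- Conjunctions of equations and negated equations. -/
inductive IsConjLiterals {d : ℕ} {α : Type} {s : α → ℕ} : GrForm d α s → Prop
  | lit {φ : GrForm d α s} (h : φ.IsLiteral) : IsConjLiterals φ
  | and {φ ψ : GrForm d α s} (h : IsConjLiterals φ) (h' : IsConjLiterals ψ) :
      IsConjLiterals (φ.and ψ)

/-- The classes `Σ_k` (for `true`) and `Π_k` (for `false`) of prenex formulas. -/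
inductive PrenexClass {d : ℕ} : Bool → ℕ → ∀ {α : Type} {s : α → ℕ}, GrForm d α s → Prop
  | qf {b : Bool} {k : ℕ} {α : Type} {s : α → ℕ} {φ : GrForm d α s} (h : φ.IsQF) :
      PrenexClass b k φ
  | ex {k : ℕ} {α : Type} {s : α → ℕ} {m : ℕ} {hm : m ≤ d}
      {φ : GrForm d (Option α) (extSort s m)} (h : PrenexClass true (k + 1) φ) :
      PrenexClass true (k + 1) (GrForm.ex m hm φ)
  | all {k : ℕ} {α : Type} {s : α → ℕ} {m : ℕ} {hm : m ≤ d}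
      {φ : GrForm d (Option α) (extSort s m)} (h : PrenexClass false (k + 1) φ) :
      PrenexClass false (k + 1) (GrForm.all m hm φ)
  | switch {b : Bool} {k : ℕ} {α : Type} {s : α → ℕ} {φ : GrForm d α s}
      (h : PrenexClass (!b) k φ) : PrenexClass b (k + 1) φ

/-- The set defined by a formula within the product of Grassmannians given by the sorts of its free
variables. -/
def defined (F : Type*) [Field F] {d : ℕ} {α : Type} {s : α → ℕ} (φ : GrForm d α s) :
    Set (∀ a, PlIdx d (s a) → F) :=
  {r | r ∈ GrProd F d s ∧ φ.Holds F r}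

end GrForm

/-! ### Frames -/

section Frames

variable {F : Type*} [Field F] {V : Type*} [AddCommGroup V] [Module F V] {d : ℕ}

/-- Frames of the lattice of subspaces; the diagonal element `a i i` is written `a_i`. -/
structure IsFrame (a : Fin d → Fin d → Submodule F V) : Prop where
  indep : iSupIndep fun i => a i i
  sup_eq_top : ⨆ i, a i i = ⊤
  symm : ∀ i j, i ≠ j → a i j = a j i
  sup_eq : ∀ i j, i ≠ j → a i i ⊔ a j j = a i i ⊔ a i j
  disjoint : ∀ i j, i ≠ j → Disjoint (a i i) (a i j)
  comp : ∀ i j k, i ≠ j → j ≠ k → i ≠ k → a i k = (a i i ⊔ a k k) ⊓ (a i j ⊔ a j k)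

/-- The basis `b` corresponds to the frame `a`: `a_i = b_i F` and `a_ij = (b_j - b_i) F`. -/
def FrameBasis (a : Fin d → Fin d → Submodule F V) (b : Module.Basis (Fin d) F V) : Prop :=
  (∀ i, a i i = Submodule.span F {b i}) ∧
    ∀ i j, i ≠ j → a i j = Submodule.span F {b j - b i}

/-- The coordinate map `r ↦ (b_j - r b_i) F` of the field onto the set `R_ij` of all complements
of `a_i` in `[0, a_i + a_j]`. It carries the field structure of `R_ij`; it does not depend on the
choice of the basis `b` corresponding to a given frame. -/
def frameCoord (b : Module.Basis (Fin d) F V) (i j : Fin d) (r : F) : Submodule F V :=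
  Submodule.span F {b j - r • b i}

/-- For a relation `R` on `F`, the set of all pairs consisting of a frame `a` and a tuple of
elements of the field `R_21` of this frame which satisfies `R`
(the indices `1, 2` being `0, 1` here). -/
def frameRel (V : Type*) [AddCommGroup V] [Module F V] (hd : 3 ≤ d) {ν : Type*}
    (R : Set (ν → F)) : Set ((Fin d × Fin d) ⊕ ν → Submodule F V) :=
  {w | IsFrame (fun i j => w (Sum.inl (i, j))) ∧
    ∃ b : Module.Basis (Fin d) F V, FrameBasis (fun i j => w (Sum.inl (i, j))) b ∧
      ∃ r ∈ R, ∀ k, w (Sum.inr k) = frameCoord b ⟨1, by omega⟩ ⟨0, by omega⟩ (r k)}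

end Frames

/-- The relation defined in a bounded lattice by the conjunction of the equations
`t = 0`, `t ∈ T`, and `s = 1`, `s ∈ S`. -/
def eqSet (L : Type*) [Lattice L] [BoundedOrder L] {α : Type*} (T S : List (latLang.Term α)) :
    Set (α → L) :=
  {w | (∀ t ∈ T, latEval t w = ⊥) ∧ ∀ s ∈ S, latEval s w = ⊤}

/-! Subspaces are handled through polynomial generators. For columns of rank `k`, the orthogonal of
their span is generated by contractions of `k`-minors (`perp_span_eq`): pairing a column with such a
contraction gives a `(k+1)`-minor. Meets are expressed by joins and orthogonals (`inf_eq_perp`).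
Hence the value of a lattice term at polynomially generated subspaces is again polynomially
generated, up to a finite case distinction on ranks, and equality of two such values is a Boolean
combination of polynomial equations. This calculus (`HomSub`, `HomQF`) is uniform in the field and
respects any grading of the variables. With zero weights it gives (A) and (B)(i); with multidegrees
it gives the homogeneous formulas of (C).

A nonzero decomposable vector `p` determines the subspace of all `x` with `x ∧ p = 0`, and the
coordinate vectors of a fixed subspace of positive dimension form a line without origin
(`plucker_eq`). So coordinate sets and sets of subspaces determine each other, which is the
bijection in (B). For the quantifiers in (C), a variable ranging over all subspaces must be replaced
by variables of fixed sorts without adding alternations or disjunctions. For `d ≥ 2` every subspace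
is a join of `d` meets of a line with a hyperplane (`mem_lineJoins`); for `d ≤ 1` the subspace
lattice does not depend on the field.

Conversely, for `d ≥ 3` von Staudt's constructions express the field operations by lattice terms
over a frame, including the total inverse. A quantifier free condition becomes a term whose value is
`⊤` or `⊥` (`IsRatQF.isLatTerm_top`). Frames are themselves defined by equations `t = 0`, `s = 1`,
because an equality with a complemented element splits into two such equations (`isEqDef_frame`);
this gives (E). A bi-invariant set is described by the existence of some basis and of generating
columns, normalized to have an entry `1`, whose minors satisfy the given formula. Invariance makes
the choice of basis immaterial (`mem_thetaGL_iff`), whence (B)(ii) and (D).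

For (F), formulas are restricted to curves of points with polynomial coordinates, along which an
equation holds everywhere or only finitely often. -/

/-! ### Orthogonals in `F ^ d`, contractions and minors -/

section Perp

variable {F : Type*} [Field F] {d : ℕ}

/-- The orthogonal of a subspace of `F ^ d` with respect to the standard bilinear form. -/
def perp (U : Submodule F (Fin d → F)) : Submodule F (Fin d → F) :=
  LinearMap.BilinForm.orthogonal (dotProductBilin F F) U

theorem mem_perp {U : Submodule F (Fin d → F)} {x : Fin d → F} :
    x ∈ perp U ↔ ∀ y ∈ U, y ⬝ᵥ x = 0 := Iff.rfl

theorem dotProductBilin_isRefl :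
    LinearMap.BilinForm.IsRefl (dotProductBilin F F : LinearMap.BilinForm F (Fin d → F)) := by
  intro x y h
  rw [dotProductBilin_apply_apply] at h ⊢
  rwa [dotProduct_comm]

theorem dotProductBilin_nondegenerate :
    LinearMap.BilinForm.Nondegenerate
      (dotProductBilin F F : LinearMap.BilinForm F (Fin d → F)) := by
  refine ⟨fun x hx => ?_, fun x hx => ?_⟩
  · ext i
    simpa using hx (Pi.single i 1)
  · ext i
    simpa using hx (Pi.single i 1)

theorem perp_perp (U : Submodule F (Fin d → F)) : perp (perp U) = U :=
  LinearMap.BilinForm.orthogonal_orthogonal dotProductBilin_nondegenerate dotProductBilin_isRefl U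

theorem perp_anti {U W : Submodule F (Fin d → F)} (h : U ≤ W) : perp W ≤ perp U :=
  LinearMap.BilinForm.orthogonal_le h

theorem le_perp_comm {U W : Submodule F (Fin d → F)} : U ≤ perp W ↔ W ≤ perp U :=
  ⟨fun h => by simpa [perp_perp] using perp_anti h, fun h => by simpa [perp_perp] using perp_anti h⟩

theorem inf_eq_perp (U W : Submodule F (Fin d → F)) : U ⊓ W = perp (perp U ⊔ perp W) := by
  apply le_antisymm
  · rw [le_perp_comm, sup_le_iff]
    exact ⟨perp_anti inf_le_left, perp_anti inf_le_right⟩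
  · refine le_inf ?_ ?_
    · rw [← perp_perp U]
      exact perp_anti (by rw [perp_perp]; exact le_sup_left)
    · rw [← perp_perp W]
      exact perp_anti (by rw [perp_perp]; exact le_sup_right)

theorem span_le_perp_span {κ μ : Type*} {x : κ → Fin d → F} {y : μ → Fin d → F} :
    Submodule.span F (Set.range x) ≤ perp (Submodule.span F (Set.range y)) ↔
      ∀ i j, y j ⬝ᵥ x i = 0 := by
  rw [Submodule.span_le]
  constructor
  · intro h i j
    exact h ⟨i, rfl⟩ _ (Submodule.subset_span ⟨j, rfl⟩)
  · rintro h _ ⟨i, rfl⟩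
    rw [SetLike.mem_coe, mem_perp]
    intro z hz
    induction hz using Submodule.span_induction with
    | mem z hz => obtain ⟨j, rfl⟩ := hz; exact h i j
    | zero => simp
    | add a b _ _ ha hb => rw [add_dotProduct, ha, hb, add_zero]
    | smul c a _ ha => rw [smul_dotProduct, ha, smul_zero]

/-- Contraction of a vector of Plücker coordinates along a set of `k + 1` indices. -/
def contraction {R : Type*} [CommRing R] {k : ℕ} (p : PlIdx d k → R) (I : PlIdx d (k + 1)) :
    Fin d → R :=
  fun i => ∑ l : Fin (k + 1), if I l = i then (-1) ^ (l : ℕ) * p (l.succAboveOrderEmb.trans I) else 0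

/-- The right side is the `I`-th coordinate of the exterior product `x ∧ p`. Orthogonality to all
contractions of `p` therefore means `x ∧ p = 0`. -/
theorem dotProduct_contraction {k : ℕ} (p : PlIdx d k → F) (I : PlIdx d (k + 1)) (x : Fin d → F) :
    x ⬝ᵥ contraction p I =
      ∑ l : Fin (k + 1), (-1) ^ (l : ℕ) * x (I l) * p (l.succAboveOrderEmb.trans I) := by
  simp only [dotProduct, contraction, Finset.mul_sum]
  rw [Finset.sum_comm]
  refine Finset.sum_congr rfl fun l _ => ?_
  simp only [mul_ite, mul_zero, Finset.sum_ite_eq, Finset.mem_univ, if_true]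
  ring

/-- The vector of `k × k` minors of a family of columns. -/
def minors {R : Type*} [CommRing R] {κ : Type*} {k : ℕ} (c : κ → Fin d → R) (J : Fin k → κ) :
    PlIdx d k → R :=
  fun I => (Matrix.of fun i j => c (J j) (I i)).det

/-- Laplace expansion along the new first column `c j`. -/
theorem dotProduct_contraction_minors {κ : Type*} {k : ℕ} (c : κ → Fin d → F) (J : Fin k → κ)
    (I : PlIdx d (k + 1)) (j : κ) :
    c j ⬝ᵥ contraction (minors c J) I = minors c (Fin.cons j J) I := by
  rw [dotProduct_contraction, minors, Matrix.det_succ_column_zero]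
  refine Finset.sum_congr rfl fun l _ => ?_
  congr 1

theorem exists_plIdx_insert {k : ℕ} (I : PlIdx d k) (i : Fin d) (hi : i ∉ Set.range I) :
    ∃ (I' : PlIdx d (k + 1)) (l : Fin (k + 1)), I' l = i ∧ l.succAboveOrderEmb.trans I' = I := by
  classical
  have hi' : i ∉ Finset.univ.map I.toEmbedding := by simpa using hi
  have hc : (insert i (Finset.univ.map I.toEmbedding)).card = k + 1 := by
    rw [Finset.card_insert_of_notMem hi']; simp
  set I' := (insert i (Finset.univ.map I.toEmbedding)).orderEmbOfFin hc
  have hr : Set.range I' = insert i (Set.range I) := by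
    rw [Finset.range_orderEmbOfFin]; simp
  obtain ⟨l, hl⟩ : i ∈ Set.range I' := by rw [hr]; simp
  refine ⟨I', l, hl, ?_⟩
  have hc2 : (Finset.univ.map I.toEmbedding).card = k := by simp
  have h1 : I = (Finset.univ.map I.toEmbedding).orderEmbOfFin hc2 :=
    Finset.orderEmbOfFin_unique' hc2 (by simp)
  rw [h1]
  refine Finset.orderEmbOfFin_unique' hc2 fun x => ?_
  have : I' (l.succAbove x) ∈ Set.range I' := ⟨_, rfl⟩
  rw [hr] at this
  rcases this with h | h
  · rw [← hl] at h
    exact absurd (I'.injective h) (Fin.succAbove_ne l x)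
  · simpa using h

/-- Dually, a subspace is cut out by the contractions of its Plücker coordinates. -/
theorem eq_perp_span_contraction {k : ℕ} {U : Submodule F (Fin d → F)} (hU : k ≤ Module.finrank F U)
    {p : PlIdx d k → F} (hp : p ≠ 0) (h : ∀ I, contraction p I ∈ perp U) :
    U = perp (Submodule.span F (Set.range (contraction p))) ∧ Module.finrank F U = k := by
  obtain ⟨I, hI⟩ : ∃ I, p I ≠ 0 := by
    by_contra! hc
    exact hp (funext hc)
  set W := perp (Submodule.span F (Set.range (contraction p)))
  have hUW : U ≤ W := by
    rw [le_perp_comm, Submodule.span_le]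
    rintro _ ⟨I, rfl⟩
    exact h I
  -- Projection to the coordinates in `I`, where `p I ≠ 0`. Its injectivity bounds the dimension of
  -- `W` by `k`.
  let f : W →ₗ[F] (Fin k → F) := (LinearMap.funLeft F F I).comp W.subtype
  have hf : Function.Injective f := by
    rw [← LinearMap.ker_eq_bot, LinearMap.ker_eq_bot']
    rintro ⟨x, hx⟩ hx0
    have hxI : ∀ j, x (I j) = 0 := fun j => congrFun hx0 j
    ext i
    change x i = 0
    by_cases hi : i ∈ Set.range I
    · obtain ⟨j, rfl⟩ := hi
      exact hxI j
    -- For `x` vanishing on `I`, the equation belonging to `I ∪ {i}` reduces to `± p I * x i = 0`.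
    · obtain ⟨I', l, hl, hI'⟩ := exists_plIdx_insert I i hi
      have h0 := mem_perp.1 hx _ (Submodule.subset_span ⟨I', rfl⟩)
      rw [dotProduct_comm, dotProduct_contraction, Finset.sum_eq_single l] at h0
      · rw [hl, hI'] at h0
        simpa [hI] using h0
      · intro l' _ hl'
        obtain ⟨m, hm⟩ := Fin.exists_succAbove_eq hl'
        have : I' l' = I m := by rw [← hI', ← hm]; rfl
        rw [this, hxI]; ring
      · simp
  have hW : Module.finrank F W ≤ k := by
    simpa using LinearMap.finrank_le_finrank_of_injective hf
  have h1 := Submodule.finrank_mono hUW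
  exact ⟨Submodule.eq_of_le_of_finrank_le hUW (hW.trans hU), by omega⟩

theorem linearIndependent_of_minors_ne_zero {κ : Type*} {k : ℕ} (c : κ → Fin d → F) (J : Fin k → κ)
    (h : minors c J ≠ 0) : LinearIndependent F (fun j => c (J j)) := by
  obtain ⟨I, hI⟩ : ∃ I, minors c J I ≠ 0 := by
    by_contra! hc
    exact h (funext hc)
  have h2 : LinearIndependent F (Matrix.of fun i j => c (J j) (I i)).col :=
    Matrix.linearIndependent_cols_of_isUnit ((Matrix.isUnit_iff_isUnit_det _).2 (Ne.isUnit hI))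
  exact LinearIndependent.of_comp (LinearMap.funLeft F F I) h2

theorem le_finrank_of_minors_ne_zero {κ : Type*} {k : ℕ} (c : κ → Fin d → F) (J : Fin k → κ)
    (h : minors c J ≠ 0) : k ≤ Module.finrank F (Submodule.span F (Set.range c)) := by
  have h1 := linearIndependent_of_minors_ne_zero c J h
  have h2 : Submodule.span F (Set.range fun j => c (J j)) ≤ Submodule.span F (Set.range c) := by
    apply Submodule.span_mono
    rintro _ ⟨j, rfl⟩
    exact ⟨_, rfl⟩
  have := Submodule.finrank_mono h2
  rwa [finrank_span_eq_card h1, Fintype.card_fin] at this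

/-- The orthogonal of a span of columns of rank `k` is spanned by contracted minors. -/
theorem perp_span_eq {κ : Type*} {k : ℕ} (c : κ → Fin d → F) (h : ∃ J : Fin k → κ, minors c J ≠ 0)
    (h' : ∀ J : Fin (k + 1) → κ, minors c J = 0) :
    perp (Submodule.span F (Set.range c)) = Submodule.span F
      (Set.range fun x : (Fin k → κ) × PlIdx d (k + 1) => contraction (minors c x.1) x.2) ∧
    Module.finrank F (Submodule.span F (Set.range c)) = k := by
  obtain ⟨J, hJ⟩ := h
  have h1 : Submodule.span F
      (Set.range fun x : (Fin k → κ) × PlIdx d (k + 1) => contraction (minors c x.1) x.2) ≤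
      perp (Submodule.span F (Set.range c)) := by
    rw [span_le_perp_span]
    rintro ⟨J, I⟩ j
    -- The pairing is a `(k+1)`-minor, which vanishes by the rank condition.
    rw [dotProduct_contraction_minors, h' (Fin.cons j J)]
    rfl
  have h2 := eq_perp_span_contraction (le_finrank_of_minors_ne_zero c J hJ) hJ
    fun I => h1 (Submodule.subset_span ⟨(J, I), rfl⟩)
  refine ⟨le_antisymm ?_ h1, h2.2⟩
  -- The contractions for the single tuple `J` already span. The whole family is used because it
  -- does not depend on which minor is nonzero, so that only the rank has to be distinguished later.
  conv_lhs => rw [h2.1]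
  rw [perp_perp]
  apply Submodule.span_mono
  rintro _ ⟨I, rfl⟩
  exact ⟨(J, I), rfl⟩

/-- Every family of columns has a rank, in terms of minors. -/
theorem exists_rank_minors {κ : Type*} (c : κ → Fin d → F) :
    ∃ k : Fin (d + 1), (∃ J : Fin k → κ, minors c J ≠ 0) ∧
      ∀ J : Fin (k + 1) → κ, minors c J = 0 := by
  classical
  have hd : ∀ k, (∃ J : Fin k → κ, minors c J ≠ 0) → k ≤ d := by
    rintro k ⟨J, hJ⟩
    by_contra hk
    apply hJ
    funext I
    have := Fintype.card_le_of_injective I I.injective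
    simp at this
    omega
  have h0 : ∃ J : Fin 0 → κ, minors c J ≠ 0 := by
    refine ⟨Fin.elim0, fun h => ?_⟩
    have := congrFun h (OrderEmbedding.ofIsEmpty : Fin 0 ↪o Fin d)
    simp [minors] at this
  set k := Nat.findGreatest (fun k => ∃ J : Fin k → κ, minors c J ≠ 0) d
  have hk : ∃ J : Fin k → κ, minors c J ≠ 0 :=
    Nat.findGreatest_spec (P := fun k => ∃ J : Fin k → κ, minors c J ≠ 0) (Nat.zero_le d) h0
  refine ⟨⟨k, Nat.lt_succ_of_le (hd k hk)⟩, hk, ?_⟩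
  by_contra! hc
  have := Nat.le_findGreatest (P := fun k => ∃ J : Fin k → κ, minors c J ≠ 0) (hd _ hc) hc
  simp only at this
  omega

theorem rank_minors {κ : Type*} (c : κ → Fin d → F) {k : ℕ}
    (hk : Module.finrank F (Submodule.span F (Set.range c)) = k) :
    (∃ J : Fin k → κ, minors c J ≠ 0) ∧ ∀ J : Fin (k + 1) → κ, minors c J = 0 := by
  obtain ⟨k', h1, h2⟩ := exists_rank_minors c
  have := (perp_span_eq c h1 h2).2
  rw [hk] at this
  subst this
  exact ⟨h1, h2⟩

end Perp

/-! ### Plücker coordinates determine the subspace -/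

section Plucker

variable {F : Type*} [Field F] {d : ℕ}

/-- Repeated columns give zero minors, and sorting distinct ones changes minors only by a sign. This
links arbitrary column tuples to the increasing ones used in `plucker`. -/
theorem exists_plIdx_minors_ne_zero {k : ℕ} (c : Fin d → Fin d → F) (J : Fin k → Fin d)
    (h : minors c J ≠ 0) : ∃ J' : PlIdx d k, minors c J' ≠ 0 := by
  have hJ : Function.Injective J := fun i j hij =>
    (linearIndependent_of_minors_ne_zero c J h).injective (congrArg c hij)
  have hm : StrictMono (J ∘ Tuple.sort J) :=
    (Tuple.monotone_sort J).strictMono_of_injective (hJ.comp (Equiv.injective _))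
  refine ⟨OrderEmbedding.ofStrictMono _ hm, fun h0 => h ?_⟩
  funext I
  have h1 := congrFun h0 I
  have h2 : (Matrix.of fun i j => c ((OrderEmbedding.ofStrictMono _ hm) j) (I i)) =
      (Matrix.of fun i j => c (J j) (I i)).submatrix id (Tuple.sort J) := rfl
  rw [minors, h2, Matrix.det_permute'] at h1
  rcases mul_eq_zero.1 h1 with h3 | h3
  · rcases Int.units_eq_one_or (Equiv.Perm.sign (Tuple.sort J)) with h4 | h4 <;> simp [h4] at h3
  · exact h3

/-- The `k` chosen columns are the matrix of `B` times a square matrix of coefficients, and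
determinants are multiplicative. -/
theorem minors_eq_smul {κ : Type*} {k : ℕ} {c : κ → Fin d → F} {B : Fin k → Fin d → F}
    {X : Fin k → κ → F} (h : ∀ j, c j = ∑ l, X l j • B l) (J : Fin k → κ) :
    minors c J = (Matrix.of fun l j => X l (J j)).det • minors B id := by
  funext I
  have : (Matrix.of fun i j => c (J j) (I i)) =
      (Matrix.of fun i j => B (id j) (I i)) * Matrix.of fun l j => X l (J j) := by
    ext i j
    simp [Matrix.mul_apply, h, mul_comm]
  rw [minors, this, Matrix.det_mul, mul_comm]
  rfl

theorem exists_span_range_eq {k : ℕ} {U : Submodule F (Fin d → F)} (hU : Module.finrank F U = k) :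
    ∃ B : Fin k → Fin d → F, Submodule.span F (Set.range B) = U := by
  let b := (Module.finBasisOfFinrankEq F U hU)
  refine ⟨fun i => b i, ?_⟩
  have := congrArg (Submodule.map U.subtype) b.span_eq
  rw [Submodule.map_span, ← Set.range_comp, Submodule.map_top, Submodule.range_subtype] at this
  exact this

/-- By `minors_eq_smul` all vectors of minors of `A` are multiples of one vector, and rank `k`
provides a nonzero multiplier. So their span is a line that depends only on the column span. -/
theorem plucker_eq {k : ℕ} (hk : k ≠ 0) {A : Matrix (Fin d) (Fin d) F} (hA : A.rank = k)
    {B : Fin k → Fin d → F} (hB : Submodule.span F (Set.range B) = Submodule.span F (Set.range A.col)) :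
    plucker k A = {r | ∃ c : F, c ≠ 0 ∧ r = c • minors B id} := by
  have hX : ∀ j, ∃ X : Fin k → F, ∑ l, X l • B l = A.col j := fun j => by
    rw [← Submodule.mem_span_range_iff_exists_fun, hB]
    exact Submodule.subset_span ⟨j, rfl⟩
  choose X hX using hX
  have hm := minors_eq_smul (c := A.col) (B := B) (X := fun l j => X j l) fun j => (hX j).symm
  rw [plucker, if_neg hk]
  ext r
  constructor
  · rintro ⟨h1, h2⟩
    have : ∃ c : F, c • minors B id = r := by
      rw [← Submodule.mem_span_singleton]
      refine Submodule.span_le.2 ?_ h1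
      rintro _ ⟨J, rfl⟩
      exact Submodule.mem_span_singleton.2 ⟨_, (hm J).symm⟩
    obtain ⟨c, rfl⟩ := this
    refine ⟨c, fun hc => h2 (by simp [hc]), rfl⟩
  · rintro ⟨c, hc, rfl⟩
    rw [Matrix.rank_eq_finrank_span_cols] at hA
    obtain ⟨J, hJ⟩ := (rank_minors A.col hA).1
    obtain ⟨J, hJ⟩ := exists_plIdx_minors_ne_zero _ J hJ
    have hJ' := hm J
    set a := (Matrix.of fun l j => X (J j) l).det
    have ha : a ≠ 0 := fun h => hJ (by rw [hJ', h, zero_smul])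
    have hB0 : minors B id ≠ 0 := fun h => hJ (by rw [hJ', h, smul_zero])
    refine ⟨?_, by simp [hc, hB0]⟩
    have : c • minors B id = (c / a) • minors A.col J := by
      rw [hJ', smul_smul, div_mul_cancel₀ _ ha]
    rw [this]
    exact Submodule.smul_mem _ _ (Submodule.subset_span ⟨J, rfl⟩)

theorem plucker_congr {k : ℕ} {A A' : Matrix (Fin d) (Fin d) F} (hA : A.rank = k)
    (h : Submodule.span F (Set.range A.col) = Submodule.span F (Set.range A'.col)) :
    plucker k A = plucker k A' := by
  rcases eq_or_ne k 0 with rfl | hk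
  · simp [plucker]
  · have hA' : A'.rank = k := by
      rw [← hA, Matrix.rank_eq_finrank_span_cols, Matrix.rank_eq_finrank_span_cols, h]
    obtain ⟨B, hB⟩ := exists_span_range_eq ((Matrix.rank_eq_finrank_span_cols A).symm.trans hA)
    rw [plucker_eq hk hA hB, plucker_eq hk hA' (hB.trans h)]

theorem plucker_nonempty {k : ℕ} {A : Matrix (Fin d) (Fin d) F} (hA : A.rank = k) :
    (plucker k A).Nonempty := by
  rcases eq_or_ne k 0 with rfl | hk
  · simp [plucker]
  · obtain ⟨B, hB⟩ := exists_span_range_eq ((Matrix.rank_eq_finrank_span_cols A).symm.trans hA)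
    rw [plucker_eq hk hA hB]
    exact ⟨_, 1, one_ne_zero, rfl⟩

/-- The subspace with given Plücker coordinates. -/
def subGr (k : ℕ) (p : PlIdx d k → F) : Submodule F (Fin d → F) :=
  -- For `k = 0` the coordinate vector is `0` by convention; its contractions vanish and would cut
  -- out all of `F ^ d` instead of `⊥`.
  if k = 0 then ⊥ else perp (Submodule.span F (Set.range (contraction p)))

theorem contraction_smul {k : ℕ} (c : F) (p : PlIdx d k → F) (I : PlIdx d (k + 1)) :
    contraction (c • p) I = c • contraction p I := by
  funext i
  simp only [contraction, Pi.smul_apply, smul_eq_mul, Finset.mul_sum]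
  refine Finset.sum_congr rfl fun l _ => ?_
  split_ifs <;> ring

theorem subGr_smul {k : ℕ} {c : F} (hc : c ≠ 0) (p : PlIdx d k → F) :
    subGr k (c • p) = subGr k p := by
  unfold subGr
  split_ifs
  · rfl
  · congr 1
    have h : (contraction (c • p)) = fun I => c • contraction p I :=
      funext fun I => contraction_smul c p I
    rw [h]
    apply le_antisymm <;> rw [Submodule.span_le] <;> rintro _ ⟨I, rfl⟩
    · exact Submodule.smul_mem _ _ (Submodule.subset_span ⟨I, rfl⟩)
    · have := Submodule.smul_mem (Submodule.span F (Set.range fun I => c • contraction p I)) c⁻¹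
        (Submodule.subset_span ⟨I, rfl⟩)
      rwa [smul_smul, inv_mul_cancel₀ hc, one_smul] at this

theorem minors_id_ne_zero {k : ℕ} {B : Fin k → Fin d → F} (hB : LinearIndependent F B) :
    minors B id ≠ 0 := by
  obtain ⟨J, hJ⟩ := (rank_minors B (by simpa using finrank_span_eq_card hB)).1
  rw [minors_eq_smul (c := B) (B := B) (X := fun l j => if l = j then 1 else 0) (by simp) J] at hJ
  exact fun h => hJ (by rw [h, smul_zero])

theorem subGr_minors {k : ℕ} {B : Fin k → Fin d → F} (hB : LinearIndependent F B) :
    subGr k (minors B id) = Submodule.span F (Set.range B) := by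
  unfold subGr
  split_ifs with hk
  · subst hk
    rw [Set.range_eq_empty, Submodule.span_empty]
  · have hr : Module.finrank F (Submodule.span F (Set.range B)) = k := by
      simpa using finrank_span_eq_card hB
    refine (eq_perp_span_contraction hr.ge (minors_id_ne_zero hB) fun I => ?_).1.symm
    rw [← Submodule.span_singleton_le_iff_mem, ← Set.range_const (ι := Unit), span_le_perp_span]
    intro _ j
    rw [dotProduct_contraction_minors, (rank_minors B hr).2]
    rfl

theorem subGr_eq_of_mem_plucker {k : ℕ} {A : Matrix (Fin d) (Fin d) F} (hA : A.rank = k)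
    {r : PlIdx d k → F} (hr : r ∈ plucker k A) :
    subGr k r = Submodule.span F (Set.range A.col) := by
  have hA' := (Matrix.rank_eq_finrank_span_cols A).symm.trans hA
  rcases eq_or_ne k 0 with rfl | hk
  · rw [subGr, if_pos rfl]
    exact (Submodule.finrank_eq_zero.1 hA').symm
  · obtain ⟨B, hB⟩ := exists_span_range_eq hA'
    rw [plucker_eq hk hA hB] at hr
    obtain ⟨c, hc, rfl⟩ := hr
    rw [subGr_smul hc, subGr_minors, hB]
    rw [linearIndependent_iff_card_eq_finrank_span]
    rw [Set.finrank, hB, hA', Fintype.card_fin]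

/-- A vector of the Grassmannian comes from some matrix, whose column span it determines; by
`plucker_congr` any other matrix with this column span serves as well. -/
theorem mem_plucker_iff {k : ℕ} {A : Matrix (Fin d) (Fin d) F} (hA : A.rank = k)
    {r : PlIdx d k → F} :
    r ∈ plucker k A ↔ r ∈ Gr F d k ∧ subGr k r = Submodule.span F (Set.range A.col) := by
  constructor
  · exact fun h => ⟨⟨A, hA, h⟩, subGr_eq_of_mem_plucker hA h⟩
  · rintro ⟨⟨A', hA', hr⟩, h⟩
    rw [subGr_eq_of_mem_plucker hA' hr] at h
    rwa [plucker_congr hA h.symm]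

/-- The matrix of a linear projection of `F ^ d` onto `U` has `U` as its column space. -/
theorem exists_matrix_col (U : Submodule F (Fin d → F)) :
    ∃ A : Matrix (Fin d) (Fin d) F, Submodule.span F (Set.range A.col) = U := by
  obtain ⟨f, hf⟩ := U.subtype.exists_leftInverse_of_injective U.ker_subtype
  refine ⟨LinearMap.toMatrix' (U.subtype ∘ₗ f), ?_⟩
  rw [← Matrix.range_mulVecLin, ← Matrix.toLin'_apply', Matrix.toLin'_toMatrix',
    LinearMap.range_comp, LinearMap.range_eq_top.2, Submodule.map_top, Submodule.range_subtype]
  exact fun x => ⟨x, LinearMap.congr_fun hf x⟩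

theorem finrank_subGr {k : ℕ} {r : PlIdx d k → F} (hr : r ∈ Gr F d k) :
    Module.finrank F (subGr k r) = k := by
  obtain ⟨A, hA, hr⟩ := hr
  rw [subGr_eq_of_mem_plucker hA hr, ← Matrix.rank_eq_finrank_span_cols, hA]

theorem exists_mem_Gr {k : ℕ} {U : Submodule F (Fin d → F)} (hU : Module.finrank F U = k) :
    ∃ r ∈ Gr F d k, subGr k r = U := by
  obtain ⟨A, hA⟩ := exists_matrix_col U
  have hr : A.rank = k := by rw [Matrix.rank_eq_finrank_span_cols, hA, hU]
  obtain ⟨r, hr'⟩ := plucker_nonempty hr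
  exact ⟨r, ⟨A, hr, hr'⟩, by rw [subGr_eq_of_mem_plucker hr hr', hA]⟩

/-- Parametrizes the Grassmannian by a scalar and `k` vectors subject only to a nonvanishing
condition, so that quantifiers over it become quantifiers over the field. The case `k = 0` is
excluded since its only member is the zero vector. -/
theorem mem_Gr_iff {k : ℕ} (hk : k ≠ 0) {r : PlIdx d k → F} :
    r ∈ Gr F d k ↔
      r ≠ 0 ∧ ∃ (c : F) (B : Fin k → Fin d → F), r = c • minors B id := by
  constructor
  · rintro ⟨A, hA, hr⟩
    obtain ⟨B, hB⟩ := exists_span_range_eq ((Matrix.rank_eq_finrank_span_cols A).symm.trans hA)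
    rw [plucker, if_neg hk] at hr
    refine ⟨hr.2, ?_⟩
    have hr' : r ∈ plucker k A := by rwa [plucker, if_neg hk]
    rw [plucker_eq hk hA hB] at hr'
    obtain ⟨c, _, h⟩ := hr'
    exact ⟨c, B, h⟩
  · rintro ⟨h0, c, B, rfl⟩
    have hc : c ≠ 0 := fun h => h0 (by simp [h])
    have hB : minors B id ≠ 0 := fun h => h0 (by simp [h])
    obtain ⟨A, hA⟩ := exists_matrix_col (Submodule.span F (Set.range B))
    have hr : A.rank = k := by
      rw [Matrix.rank_eq_finrank_span_cols, hA]
      simpa using finrank_span_eq_card (linearIndependent_of_minors_ne_zero B id hB)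
    refine ⟨A, hr, ?_⟩
    rw [plucker_eq hk hr hA.symm]
    exact ⟨c, hc, rfl⟩

theorem minors_mem_Gr {k : ℕ} (hk : k ≠ 0) {B : Fin k → Fin d → F} (hB : LinearIndependent F B) :
    minors B id ∈ Gr F d k :=
  (mem_Gr_iff hk).2 ⟨minors_id_ne_zero hB, 1, B, (one_smul _ _).symm⟩

theorem mem_Gr_zero_iff {r : PlIdx d 0 → F} : r ∈ Gr F d 0 ↔ r = 0 := by
  constructor
  · rintro ⟨A, -, hr⟩
    simpa [plucker] using hr
  · rintro rfl
    exact ⟨0, by simp, by simp [plucker]⟩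

theorem smul_mem_Gr {k : ℕ} {c : F} (hc : c ≠ 0) {r : PlIdx d k → F} (hr : r ∈ Gr F d k) :
    c • r ∈ Gr F d k := by
  rcases eq_or_ne k 0 with rfl | hk
  · rw [mem_Gr_zero_iff] at hr ⊢
    rw [hr, smul_zero]
  · rw [mem_Gr_iff hk] at hr ⊢
    obtain ⟨h, a, B, rfl⟩ := hr
    exact ⟨smul_ne_zero hc h, c * a, B, by rw [smul_smul]⟩

end Plucker

/-! ### Transport along a basis of `V` and the bijection of (B) -/

section Transport

variable {F : Type*} [Field F] {V : Type*} [AddCommGroup V] [Module F V] {d : ℕ} {ι : Type*}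

/-- Subspaces of `F ^ d` as subspaces of `V`, via a basis of `V`. -/
noncomputable def ofCoord (b : Module.Basis (Fin d) F V) : Submodule F (Fin d → F) ≃o Submodule F V :=
  Submodule.orderIsoMapComap b.equivFun.symm

theorem ofCoord_apply (b : Module.Basis (Fin d) F V) (U : Submodule F (Fin d → F)) :
    ofCoord b U = U.map (b.equivFun.symm : (Fin d → F) →ₗ[F] V) := rfl

theorem finrank_ofCoord (b : Module.Basis (Fin d) F V) (U : Submodule F (Fin d → F)) :
    Module.finrank F (ofCoord b U) = Module.finrank F U :=
  LinearEquiv.finrank_map_eq b.equivFun.symm U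

theorem colSpan_eq (b : Module.Basis (Fin d) F V) (A : Matrix (Fin d) (Fin d) F) :
    colSpan b A = ofCoord b (Submodule.span F (Set.range A.col)) := by
  rw [ofCoord_apply, Submodule.map_span, ← Set.range_comp, colSpan]
  congr 2
  funext j
  exact (b.equivFun_symm_apply _).symm

/-- Coordinates determine the column span by `subGr_eq_of_mem_plucker`, so the intermediate matrices
can be dropped. -/
theorem thetaLG_eq (b : Module.Basis (Fin d) F V) (dv : ι → ℕ) (M : Set (ι → Submodule F V)) :
    thetaLG b dv M =
      {r | r ∈ GrProd F d dv ∧ (fun k => ofCoord b (subGr (dv k) (r k))) ∈ M} := by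
  ext r
  constructor
  · rintro ⟨A, ⟨u, hu, huA⟩, hA, hr⟩
    refine ⟨fun k => ⟨A k, hA k, hr k⟩, ?_⟩
    convert hu using 1
    funext k
    rw [subGr_eq_of_mem_plucker (hA k) (hr k), huA, colSpan_eq]
  · rintro ⟨hr, hM⟩
    choose A hA hrA using hr
    refine ⟨A, ⟨_, hM, fun k => ?_⟩, hA, hrA⟩
    rw [subGr_eq_of_mem_plucker (hA k) (hrA k), colSpan_eq]

theorem thetaGL_eq (b : Module.Basis (Fin d) F V) (dv : ι → ℕ) {Δ : Set (∀ k, PlIdx d (dv k) → F)} :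
    thetaGL b dv Δ =
      {w | ∃ r ∈ Δ, r ∈ GrProd F d dv ∧ w = fun k => ofCoord b (subGr (dv k) (r k))} := by
  ext w
  constructor
  · rintro ⟨A, ⟨hA, r, hr, hrA⟩, hw⟩
    refine ⟨r, hr, fun k => ⟨A k, hA k, hrA k⟩, ?_⟩
    funext k
    rw [subGr_eq_of_mem_plucker (hA k) (hrA k), hw, colSpan_eq]
  · rintro ⟨r, hr, hrG, rfl⟩
    choose A hA hrA using hrG
    refine ⟨A, ⟨hA, r, hr, hrA⟩, fun k => ?_⟩
    dsimp only
    rw [subGr_eq_of_mem_plucker (hA k) (hrA k), colSpan_eq]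

theorem colSpan_toMatrix_mul (b : Module.Basis (Fin d) F V) (g : V →ₗ[F] V)
    (A : Matrix (Fin d) (Fin d) F) :
    colSpan b (LinearMap.toMatrix b b g * A) = (colSpan b A).map g := by
  rw [colSpan, colSpan, Submodule.map_span, ← Set.range_comp]
  congr 2
  funext j
  have h : ∀ l, g (b l) = ∑ i, LinearMap.toMatrix b b g i l • b i := fun l => by
    simp [LinearMap.toMatrix_apply, b.sum_repr]
  simp only [Function.comp_apply, map_sum, map_smul, h, Matrix.mul_apply, Finset.sum_smul,
    Finset.smul_sum, smul_smul]
  rw [Finset.sum_comm]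
  simp only [mul_comm]

theorem biInvariant_thetaLG (b : Module.Basis (Fin d) F V) (dv : ι → ℕ)
    {M : Set (ι → Submodule F V)} (hM : LatInvariant M) : BiInvariant (thetaLG b dv M) := by
  rw [thetaLG_eq]
  constructor
  · rintro c hc r ⟨hr, hrM⟩
    refine ⟨fun k => smul_mem_Gr (hc k) (hr k), ?_⟩
    simpa only [Set.mem_ofPred_eq, subGr_smul (hc _)] using hrM
  · rintro T hT A hA r s hr hs ⟨-, hrM⟩
    have hTA : ∀ k, (T * A k).rank = dv k := fun k => by
      rw [Matrix.rank_mul_eq_right_of_isUnit_det _ _ ((Matrix.isUnit_iff_isUnit_det _).1 hT), hA]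
    refine ⟨fun k => ⟨_, hTA k, hs k⟩, ?_⟩
    let g := LinearEquiv.ofBijective (Matrix.toLin b b T) <| by
      obtain ⟨T, rfl⟩ := hT
      have h1 : Matrix.toLin b b T.val ∘ₗ Matrix.toLin b b T.inv = LinearMap.id := by
        rw [← Matrix.toLin_mul, T.val_inv, Matrix.toLin_one]
      have h2 : Matrix.toLin b b T.inv ∘ₗ Matrix.toLin b b T.val = LinearMap.id := by
        rw [← Matrix.toLin_mul, T.inv_val, Matrix.toLin_one]
      exact Function.bijective_iff_has_inverse.2
        ⟨Matrix.toLin b b T.inv, fun x => LinearMap.congr_fun h2 x, fun x => LinearMap.congr_fun h1 x⟩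
    convert hM g _ hrM using 1
    funext k
    rw [subGr_eq_of_mem_plucker (hTA k) (hs k), subGr_eq_of_mem_plucker (hA k) (hr k),
      ← colSpan_eq, ← colSpan_eq, ← colSpan_toMatrix_mul]
    congr 2
    exact (LinearMap.toMatrix_toLin b b T).symm

theorem latInvariant_thetaGL (b : Module.Basis (Fin d) F V) (dv : ι → ℕ)
    {Δ : Set (∀ k, PlIdx d (dv k) → F)} (hΔ : BiInvariant Δ) : LatInvariant (thetaGL b dv Δ) := by
  rintro g w hw
  rw [thetaGL_eq] at hw ⊢
  obtain ⟨r, hr, hrG, rfl⟩ := hw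
  choose A hA hrA using hrG
  set T := LinearMap.toMatrix b b (g : V →ₗ[F] V)
  have hT : IsUnit T := by
    refine ⟨⟨T, LinearMap.toMatrix b b (g.symm : V →ₗ[F] V), ?_, ?_⟩, rfl⟩
    · rw [← LinearMap.toMatrix_comp]; simp
    · rw [← LinearMap.toMatrix_comp]; simp
  have hTA : ∀ k, (T * A k).rank = dv k := fun k => by
    rw [Matrix.rank_mul_eq_right_of_isUnit_det _ _ ((Matrix.isUnit_iff_isUnit_det _).1 hT), hA]
  choose s hs using fun k => plucker_nonempty (hTA k)
  refine ⟨s, hΔ.2 T hT A hA r s hrA hs hr, fun k => ⟨_, hTA k, hs k⟩, ?_⟩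
  funext k
  dsimp only
  rw [subGr_eq_of_mem_plucker (hTA k) (hs k), subGr_eq_of_mem_plucker (hA k) (hrA k),
    ← colSpan_eq, ← colSpan_eq, ← colSpan_toMatrix_mul]

/-- The case `T = 1` of bi-invariance suffices: `r` and `s` are coordinate vectors of the same
matrices. -/
theorem BiInvariant.mem_of_subGr_eq {dv : ι → ℕ} {Δ : Set (∀ k, PlIdx d (dv k) → F)}
    (hΔ : BiInvariant Δ) {r s : ∀ k, PlIdx d (dv k) → F} (hr : r ∈ Δ) (hrG : r ∈ GrProd F d dv)
    (hs : s ∈ GrProd F d dv) (h : ∀ k, subGr (dv k) (s k) = subGr (dv k) (r k)) : s ∈ Δ := by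
  choose A hA hrA using hrG
  refine hΔ.2 1 isUnit_one A hA r s hrA (fun k => ?_) hr
  rw [one_mul, mem_plucker_iff (hA k), h, subGr_eq_of_mem_plucker (hA k) (hrA k)]
  exact ⟨hs k, rfl⟩

theorem thetaLG_thetaGL (b : Module.Basis (Fin d) F V) (dv : ι → ℕ)
    {Δ : Set (∀ k, PlIdx d (dv k) → F)} (hΔ : BiInvariant Δ) (hG : Δ ⊆ GrProd F d dv) :
    thetaLG b dv (thetaGL b dv Δ) = Δ := by
  rw [thetaLG_eq, thetaGL_eq]
  ext s
  constructor
  · rintro ⟨hs, r, hr, hrG, h⟩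
    exact hΔ.mem_of_subGr_eq hr hrG hs fun k => (ofCoord b).injective (congrFun h k)
  · exact fun hs => ⟨hG hs, s, hs, hG hs, rfl⟩

theorem thetaGL_thetaLG (b : Module.Basis (Fin d) F V) (dv : ι → ℕ) {M : Set (ι → Submodule F V)}
    (hM : M ⊆ dimSet F V dv) : thetaGL b dv (thetaLG b dv M) = M := by
  rw [thetaLG_eq, thetaGL_eq]
  ext w
  constructor
  · rintro ⟨r, ⟨-, hr⟩, -, rfl⟩
    exact hr
  · intro hw
    have h : ∀ k, ∃ r ∈ Gr F d (dv k), ofCoord b (subGr (dv k) r) = w k := fun k => by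
      have h1 : Module.finrank F ((ofCoord b).symm (w k)) = dv k := by
        rw [← finrank_ofCoord b, OrderIso.apply_symm_apply, hM hw k]
      obtain ⟨r, hr, h⟩ := exists_mem_Gr h1
      exact ⟨r, hr, by rw [h, OrderIso.apply_symm_apply]⟩
    choose r hr hrw using h
    have : (fun k => ofCoord b (subGr (dv k) (r k))) = w := funext hrw
    exact ⟨r, ⟨hr, by rwa [this]⟩, hr, this.symm⟩

theorem thetaGL_subset_dimSet (b : Module.Basis (Fin d) F V) (dv : ι → ℕ)
    (Δ : Set (∀ k, PlIdx d (dv k) → F)) : thetaGL b dv Δ ⊆ dimSet F V dv := by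
  rw [thetaGL_eq]
  rintro _ ⟨r, -, hr, rfl⟩ k
  rw [finrank_ofCoord, finrank_subGr (hr k)]

theorem bijOn_thetaLG (b : Module.Basis (Fin d) F V) (dv : ι → ℕ) :
    Set.BijOn (thetaLG b dv) {M | M ⊆ dimSet F V dv ∧ LatInvariant M}
      {Δ | Δ ⊆ GrProd F d dv ∧ BiInvariant Δ} := by
  refine ⟨?_, ?_, ?_⟩
  · rintro M ⟨-, hM⟩
    refine ⟨?_, biInvariant_thetaLG b dv hM⟩
    rw [thetaLG_eq]
    exact fun r hr => hr.1
  · rintro M ⟨hM, -⟩ M' ⟨hM', -⟩ h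
    rw [← thetaGL_thetaLG b dv hM, h, thetaGL_thetaLG b dv hM']
  · rintro Δ ⟨hΔ, hΔ'⟩
    exact ⟨thetaGL b dv Δ, ⟨thetaGL_subset_dimSet b dv Δ, latInvariant_thetaGL b dv hΔ'⟩,
      thetaLG_thetaGL b dv hΔ' hΔ⟩

end Transport

/-! ### Semantics of lattice formulas -/

section Realization

/-- Validity of a lattice formula with free and bound variables. -/
def LatRealize {L : Type*} [Lattice L] [BoundedOrder L] {α : Type*} {n : ℕ}
    (φ : latLang.BoundedFormula α n) (w : α → L) (xs : Fin n → L) : Prop :=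
  letI := latStructure L
  φ.Realize w xs

variable {L L' : Type*} [Lattice L] [BoundedOrder L] [Lattice L'] [BoundedOrder L'] {α : Type*}

theorem latHolds_iff {φ : latLang.Formula α} {w : α → L} (xs : Fin 0 → L) :
    LatHolds φ w ↔ LatRealize φ w xs := by
  rw [Subsingleton.elim xs default]
  exact Iff.rfl

/-- A lattice isomorphism as an isomorphism of `latLang`-structures. -/
def latEquiv (e : L ≃o L') :
    letI := latStructure L
    letI := latStructure L'
    L ≃[latLang] L' :=
  letI := latStructure L
  letI := latStructure L'
  { e.toEquiv with
    map_fun' := by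
      rintro n f x
      cases f
      · exact map_sup e _ _
      · exact map_inf e _ _
      · exact map_bot e
      · exact map_top e
    map_rel' := by
      rintro n r x
      exact r.elim }

theorem latHolds_orderIso (e : L ≃o L') (φ : latLang.Formula α) (w : α → L) :
    LatHolds φ (fun a => e (w a)) ↔ LatHolds φ w :=
  letI := latStructure L
  letI := latStructure L'
  StrongHomClass.realize_formula (latEquiv e) φ

theorem latRealize_ex {n : ℕ} {φ : latLang.BoundedFormula α (n + 1)} {w : α → L} {xs : Fin n → L} :
    LatRealize φ.ex w xs ↔ ∃ y : L, LatRealize φ w (Fin.snoc xs y) :=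
  letI := latStructure L
  BoundedFormula.realize_ex

theorem latRealize_all {n : ℕ} {φ : latLang.BoundedFormula α (n + 1)} {w : α → L}
    {xs : Fin n → L} :
    LatRealize φ.all w xs ↔ ∀ y : L, LatRealize φ w (Fin.snoc xs y) :=
  letI := latStructure L
  BoundedFormula.realize_all

theorem latRealize_equal {n : ℕ} {t s : latLang.Term (α ⊕ Fin n)} {w : α → L} {xs : Fin n → L} :
    LatRealize (t.bdEqual s) w xs ↔ latEval t (Sum.elim w xs) = latEval s (Sum.elim w xs) :=
  letI := latStructure L
  BoundedFormula.realize_bdEqual _ _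

end Realization

/-! ### Subspaces with polynomial generators, uniformly in the field -/

section Families

/-- Relations on all fields at once. -/
abbrev PredFam (σ : Type) : Type (u + 1) := ∀ (F : Type u) [Field F], (σ → F) → Prop

/-- Subspaces of `F ^ d` depending on parameters, for all fields `F` at once. -/
abbrev SubFam (σ : Type) (d : ℕ) : Type (u + 1) :=
  ∀ (F : Type u) [Field F], (σ → F) → Submodule F (Fin d → F)

open MvPolynomial

variable {σ M : Type} [AddCommMonoid M] (w : σ → M) {d : ℕ}

/-- Relations defined by Boolean combinations of weighted homogeneous equations. -/
inductive HomQF : PredFam.{u} σ → Prop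
  | eqn (p : MvPolynomial σ ℤ) (m : M) (hp : IsWeightedHomogeneous w p m) :
      HomQF fun _ _ r => aeval r p = 0
  | not {P : PredFam.{u} σ} (hP : HomQF P) : HomQF fun F _ r => ¬ P F r
  | and {P Q : PredFam.{u} σ} (hP : HomQF P) (hQ : HomQF Q) : HomQF fun F _ r => P F r ∧ Q F r

/-- Vectors of weighted homogeneous polynomials of the same degree. -/
def HomVec {κ : Type*} (x : κ → MvPolynomial σ ℤ) : Prop :=
  ∃ m, ∀ i, IsWeightedHomogeneous w (x i) m

/-- Families of subspaces which, up to quantifier free case distinctions, are spanned by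
weighted homogeneous vectors. -/
inductive HomSub : SubFam.{u} σ d → Prop
  | span {κ : Type} [Finite κ] (c : κ → Fin d → MvPolynomial σ ℤ) (hc : ∀ j, HomVec w (c j)) :
      HomSub fun F _ r => Submodule.span F (Set.range fun j i => aeval r (c j i))
  -- Case distinctions are needed because the generators of an orthogonal depend on the rank of the
  -- given ones.
  | cases {ι : Type} [Finite ι] (P : ι → PredFam.{u} σ) (U : ι → SubFam.{u} σ d)
      (W : SubFam.{u} σ d) (hP : ∀ i, HomQF w (P i)) (hU : ∀ i, HomSub (U i))
      (h : ∀ (F : Type u) [Field F] (r : σ → F), ∃ i, P i F r)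
      (h' : ∀ (F : Type u) [Field F] (r : σ → F) (i : ι), P i F r → W F r = U i F r) : HomSub W

variable {w}

namespace HomQF

theorem congr {P Q : PredFam.{u} σ} (hP : HomQF w P)
    (h : ∀ (F : Type u) [Field F] (r : σ → F), P F r ↔ Q F r) : HomQF w Q := by
  have : P = Q := by
    funext F _ r
    exact propext (h F r)
  rwa [← this]

theorem true : HomQF.{u} w fun _ _ _ => True :=
  (HomQF.eqn 0 0 (isWeightedHomogeneous_zero _ _ _)).congr (by simp)

theorem imp {P Q : PredFam.{u} σ} (hP : HomQF w P) (hQ : HomQF w Q) :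
    HomQF w fun F _ r => P F r → Q F r :=
  (hP.and hQ.not).not.congr fun F _ r => by tauto

theorem forall_finite {ι : Type} [Finite ι] {P : ι → PredFam.{u} σ} (hP : ∀ i, HomQF w (P i)) :
    HomQF w fun F _ r => ∀ i, P i F r := by
  classical
  have := Fintype.ofFinite ι
  suffices h : ∀ s : Finset ι, HomQF w fun F _ r => ∀ i ∈ s, P i F r from
    (h Finset.univ).congr fun F _ r => by simp
  intro s
  induction s using Finset.induction_on with
  | empty => exact HomQF.true.congr fun F _ r => by simp
  | insert i s _ ih => exact ((hP i).and ih).congr fun F _ r => by simp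

theorem exists_finite {ι : Type} [Finite ι] {P : ι → PredFam.{u} σ} (hP : ∀ i, HomQF w (P i)) :
    HomQF w fun F _ r => ∃ i, P i F r :=
  (forall_finite fun i => (hP i).not).not.congr fun F _ r => by simp

end HomQF

theorem HomSub.congr {U W : SubFam.{u} σ d} (hU : HomSub w U)
    (h : ∀ (F : Type u) [Field F] (r : σ → F), U F r = W F r) : HomSub w W := by
  have : U = W := by
    funext F _ r
    exact h F r
  rwa [← this]

/-- Each term of the determinant contains exactly one entry from each chosen column. The degree is
thus the sum of the column degrees, independently of the rows `I`. -/
theorem homVec_minors {κ : Type*} {k : ℕ} {c : κ → Fin d → MvPolynomial σ ℤ}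
    (hc : ∀ j, HomVec w (c j)) (J : Fin k → κ) : HomVec w (minors c J) := by
  choose m hm using hc
  refine ⟨∑ j, m (J j), fun I => ?_⟩
  rw [minors, Matrix.det_apply]
  refine IsWeightedHomogeneous.sum _ _ _ fun g _ => ?_
  have : IsWeightedHomogeneous w
      (∏ i, (Matrix.of fun i j => c (J j) (I i)) (g i) i : MvPolynomial σ ℤ) (∑ j, m (J j)) :=
    IsWeightedHomogeneous.prod _ _ _ fun j _ => hm (J j) (I (g j))
  exact (weightedHomogeneousSubmodule ℤ w (∑ j, m (J j))).smul_mem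
    ((Equiv.Perm.sign g : ℤˣ) : ℤ) this

theorem homVec_contraction {k : ℕ} {p : PlIdx d k → MvPolynomial σ ℤ} (hp : HomVec w p)
    (I : PlIdx d (k + 1)) : HomVec w (contraction p I) := by
  obtain ⟨m, hm⟩ := hp
  refine ⟨m, fun i => IsWeightedHomogeneous.sum _ _ _ fun l _ => ?_⟩
  split_ifs
  · have := (hm (l.succAboveOrderEmb.trans I)).C_mul ((-1) ^ (l : ℕ))
    simpa using this
  · exact isWeightedHomogeneous_zero _ _ _

section

variable {F : Type u} [Field F] (r : σ → F)

theorem aeval_minors {κ : Type*} {k : ℕ} (c : κ → Fin d → MvPolynomial σ ℤ) (J : Fin k → κ)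
    (I : PlIdx d k) :
    aeval r (minors c J I) = minors (fun j i => aeval r (c j i)) J I := by
  rw [minors, AlgHom.map_det]
  rfl

theorem aeval_contraction {k : ℕ} (p : PlIdx d k → MvPolynomial σ ℤ) (I : PlIdx d (k + 1))
    (i : Fin d) :
    aeval r (contraction p I i) = contraction (fun I => aeval r (p I)) I i := by
  simp only [contraction, map_sum]
  refine Finset.sum_congr rfl fun l _ => ?_
  split_ifs <;> simp

end

namespace HomSub

/-- The rank is specified by vanishing and nonvanishing of minors, which are homogeneous conditions.
For each rank, `perp_span_eq` supplies generators that are homogeneous polynomials in the given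
ones. -/
theorem perp {U : SubFam.{u} σ d} (hU : HomSub w U) : HomSub w fun F _ r => perp (U F r) := by
  induction hU with
  | @span κ _ c hc =>
    refine .cases (ι := Fin (d + 1))
      (fun k F _ r => (∃ (J : Fin k → κ), ∃ I, ¬ aeval r (minors c J I) = 0) ∧
        ∀ (J : Fin (k + 1) → κ), ∀ I, aeval r (minors c J I) = 0)
      (fun k F _ r => Submodule.span F (Set.range fun (x : (Fin k → κ) × PlIdx d (k + 1)) i =>
        aeval r (contraction (minors c x.1) x.2 i))) _ (fun k => ?_) (fun k => ?_) ?_ ?_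
    · have hm : ∀ (k : ℕ) (J : Fin k → κ) I,
          HomQF.{u} w fun _ _ r => aeval r (minors c J I) = 0 := fun k J I => by
        obtain ⟨m, hm⟩ := homVec_minors hc J
        exact .eqn _ m (hm I)
      exact (HomQF.exists_finite fun J => HomQF.exists_finite fun I => (hm _ J I).not).and
        (HomQF.forall_finite fun J => HomQF.forall_finite fun I => hm _ J I)
    · exact .span _ fun x => homVec_contraction (homVec_minors hc x.1) x.2
    · intro F _ r
      obtain ⟨k, ⟨J, h1⟩, h2⟩ := exists_rank_minors (fun j i => aeval r (c j i))
      refine ⟨k, ⟨J, ?_⟩, fun J I => ?_⟩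
      · by_contra! hc
        exact h1 (funext fun I => by rw [← aeval_minors, hc]; rfl)
      · rw [aeval_minors, h2]; rfl
    · rintro F _ r k ⟨⟨J, I, h1⟩, h2⟩
      rw [(perp_span_eq (k := k) (fun j i => aeval r (c j i)) ⟨J, fun h => h1 ?_⟩ fun J => ?_).1]
      · congr 2
        funext x i
        rw [aeval_contraction]
        simp only [aeval_minors]
      · rw [aeval_minors, h]; rfl
      · funext I
        rw [← aeval_minors, h2]; rfl
  | cases P U W hP _ h h' ih =>
    exact .cases P _ _ hP ih h fun F _ r i hi => by rw [h' F r i hi]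

theorem sup {U W : SubFam.{u} σ d} (hU : HomSub w U) (hW : HomSub w W) :
    HomSub w fun F _ r => U F r ⊔ W F r := by
  induction hU with
  | @span κ _ c hc =>
    induction hW with
    | @span κ' _ c' hc' =>
      refine (HomSub.span (Sum.elim c c') ?_).congr fun F _ r => ?_
      · rintro (j | j)
        · exact hc j
        · exact hc' j
      · rw [← Submodule.span_union, ← Set.Sum.elim_range]
        congr 2
        funext j i
        cases j <;> rfl
    | cases P U W hP _ h h' ih =>
      exact .cases P _ _ hP ih h fun F _ r i hi => by rw [h' F r i hi]
  | cases P U W hP _ h h' ih =>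
    exact .cases P _ _ hP ih h fun F _ r i hi => by rw [h' F r i hi]

/-- Orthogonality is tested on generators. Their dot products are homogeneous since the entries of
each generator share one degree. -/
theorem le_perp {U W : SubFam.{u} σ d} (hU : HomSub w U) (hW : HomSub w W) :
    HomQF w fun F _ r => U F r ≤ _root_.perp (W F r) := by
  induction hU with
  | @span κ _ c hc =>
    induction hW with
    | @span κ' _ c' hc' =>
      choose m hm using hc
      choose m' hm' using hc'
      refine (HomQF.forall_finite fun j => HomQF.forall_finite fun j' =>
        HomQF.eqn (∑ i, c' j' i * c j i) (m' j' + m j) ?_).congr fun F _ r => ?_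
      · exact IsWeightedHomogeneous.sum _ _ _ fun i _ => (hm' j' i).mul (hm j i)
      · rw [span_le_perp_span]
        simp only [map_sum, map_mul]
        rfl
    | cases P U W hP _ h h' ih =>
      refine (HomQF.exists_finite fun i => (hP i).and (ih i)).congr fun F _ r => ⟨?_, ?_⟩
      · rintro ⟨i, hi, h1⟩
        rwa [h' F r i hi]
      · intro h1
        obtain ⟨i, hi⟩ := h F r
        exact ⟨i, hi, by rwa [← h' F r i hi]⟩
  | cases P U W hP _ h h' ih =>
    refine (HomQF.exists_finite fun i => (hP i).and (ih i)).congr fun F _ r => ⟨?_, ?_⟩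
    · rintro ⟨i, hi, h1⟩
      rwa [h' F r i hi]
    · intro h1
      obtain ⟨i, hi⟩ := h F r
      exact ⟨i, hi, by rwa [← h' F r i hi]⟩

theorem le {U W : SubFam.{u} σ d} (hU : HomSub w U) (hW : HomSub w W) :
    HomQF w fun F _ r => U F r ≤ W F r :=
  (hU.le_perp hW.perp).congr fun F _ r => by rw [perp_perp]

theorem eq {U W : SubFam.{u} σ d} (hU : HomSub w U) (hW : HomSub w W) :
    HomQF w fun F _ r => U F r = W F r :=
  ((hU.le hW).and (hW.le hU)).congr fun _ _ _ => le_antisymm_iff.symm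

theorem inf {U W : SubFam.{u} σ d} (hU : HomSub w U) (hW : HomSub w W) :
    HomSub w fun F _ r => U F r ⊓ W F r :=
  (hU.perp.sup hW.perp).perp.congr fun _ _ _ => (inf_eq_perp _ _).symm

theorem bot : HomSub.{u} w fun F _ _ => (⊥ : Submodule F (Fin d → F)) :=
  (HomSub.span (κ := Empty) Empty.elim fun j => j.elim).congr fun _ _ _ => by
    rw [Set.range_eq_empty, Submodule.span_empty]

theorem top : HomSub.{u} w fun F _ _ => (⊤ : Submodule F (Fin d → F)) :=
  bot.perp.congr fun _ _ _ => top_le_iff.1 (le_perp_comm.1 bot_le)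

theorem latEval {β : Type*} {U : β → SubFam.{u} σ d} (hU : ∀ x, HomSub w (U x))
    (t : latLang.Term β) : HomSub w fun F _ r => latEval t fun x => U x F r := by
  induction t with
  | var x => exact hU x
  | func f ts ih =>
    cases f with
    | sup => exact (ih 0).sup (ih 1)
    | inf => exact (ih 0).inf (ih 1)
    | bot => exact bot
    | top => exact top

/-- Terms stay within `HomSub` and equality of two such families is in `HomQF`. Quantifier free
formulas hence need no quantifier over the field, and homogeneity is carried along. -/
theorem latRealize {β : Type*} {n : ℕ} {U : β → SubFam.{u} σ d} {X : Fin n → SubFam.{u} σ d}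
    (hU : ∀ x, HomSub w (U x)) (hX : ∀ x, HomSub w (X x)) {φ : latLang.BoundedFormula β n}
    (hφ : φ.IsQF) : HomQF w fun F _ r => LatRealize φ (fun x => U x F r) fun x => X x F r := by
  induction hφ with
  | falsum => exact HomQF.true.not.congr fun _ _ _ =>
      ⟨fun h => h trivial, fun h => h.elim⟩
  | of_isAtomic h =>
    cases h with
    | equal t s =>
      have hUX : ∀ x, HomSub w (Sum.elim U X x) := fun x => by cases x; exacts [hU _, hX _]
      refine ((latEval hUX t).eq (latEval hUX s)).congr fun F _ r => ?_
      rw [latRealize_equal]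
      have : (fun x => Sum.elim U X x F r) = Sum.elim (fun x => U x F r) fun x => X x F r := by
        funext x; cases x <;> rfl
      rw [this]
    | rel R => exact R.elim
  | imp _ _ ih ih' => exact ih.imp ih'

end HomSub

/-! ### Regrading after a change of variables -/

section Rename

variable {τ N : Type} [AddCommMonoid N] {w' : τ → N}

theorem IsWeightedHomogeneous.rename {f : σ → τ} {g : M →+ N} (h : ∀ x, w' (f x) = g (w x))
    {p : MvPolynomial σ ℤ} {m : M} (hp : IsWeightedHomogeneous w p m) :
    IsWeightedHomogeneous w' (rename f p) (g m) := by
  intro e he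
  obtain ⟨u, rfl, hu⟩ := coeff_rename_ne_zero f p e he
  rw [← hp hu, Finsupp.weight_apply, Finsupp.weight_apply, Finsupp.sum_mapDomain_index
    (h := fun i c => c • w' i) (fun _ => zero_smul _ _) (fun _ _ _ => add_smul _ _ _),
    map_finsuppSum]
  simp only [h, map_nsmul]

theorem HomQF.rename {f : σ → τ} {g : M →+ N} (h : ∀ x, w' (f x) = g (w x)) {P : PredFam.{u} σ}
    (hP : HomQF w P) : HomQF w' fun F _ r => P F fun x => r (f x) := by
  induction hP with
  | eqn p m hp =>
    exact (HomQF.eqn _ _ (IsWeightedHomogeneous.rename h hp)).congr fun F _ r => by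
      rw [aeval_rename]; rfl
  | not _ ih => exact ih.not
  | and _ _ ih ih' => exact ih.and ih'

theorem HomSub.rename {f : σ → τ} {g : M →+ N} (h : ∀ x, w' (f x) = g (w x)) {U : SubFam.{u} σ d}
    (hU : HomSub w U) : HomSub w' fun F _ r => U F fun x => r (f x) := by
  induction hU with
  | span c hc =>
    refine (HomSub.span (fun j i => MvPolynomial.rename f (c j i)) fun j => ?_).congr fun F _ r => ?_
    · obtain ⟨m, hm⟩ := hc j
      exact ⟨g m, fun i => IsWeightedHomogeneous.rename h (hm i)⟩
    · simp only [aeval_rename]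
      rfl
  | cases P U W hP _ h1 h2 ih =>
    exact .cases _ _ _ (fun i => (hP i).rename h) ih (fun F _ r => h1 F _)
      fun F _ r i hi => h2 F _ i hi

end Rename

end Families

/-! ### Closure properties of the prenex classes -/

section Prenex

variable {L : FirstOrder.Language.{0, 0}} {α β : Type}

theorem PrenexClass.relabel {c : Bool} {k m n : ℕ} {φ : L.BoundedFormula α m}
    (h : PrenexClass c k φ) (f : α → β ⊕ Fin n) : PrenexClass c k (φ.relabel f) := by
  induction h with
  | qf h => exact .qf (h.relabel f)
  | ex _ ih => rw [BoundedFormula.relabel_ex]; exact .ex ih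
  | all _ ih => rw [BoundedFormula.relabel_all]; exact .all ih
  | switch _ ih => exact .switch ih

theorem PrenexClass.exs {k n : ℕ} {φ : L.BoundedFormula α n} (h : PrenexClass true (k + 1) φ) :
    PrenexClass true (k + 1) φ.exs := by
  induction n with
  | zero => exact h
  | succ n ih => exact ih (.ex h)

theorem PrenexClass.alls {k n : ℕ} {φ : L.BoundedFormula α n} (h : PrenexClass false (k + 1) φ) :
    PrenexClass false (k + 1) φ.alls := by
  induction n with
  | zero => exact h
  | succ n ih => exact ih (.all h)

theorem PrenexClass.iExs {k : ℕ} [Finite β] {φ : L.Formula (α ⊕ β)}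
    (h : PrenexClass true (k + 1) φ) : PrenexClass true (k + 1) (φ.iExs β) :=
  (h.relabel _).exs

theorem PrenexClass.iAlls {k : ℕ} [Finite β] {φ : L.Formula (α ⊕ β)}
    (h : PrenexClass false (k + 1) φ) : PrenexClass false (k + 1) (φ.iAlls β) :=
  (h.relabel _).alls

theorem exists_prenexClass {n : ℕ} {φ : L.BoundedFormula α n} (h : φ.IsPrenex) (c : Bool) :
    ∃ k, PrenexClass c (k + 1) φ := by
  induction h generalizing c with
  | of_isQF h => exact ⟨0, .qf h⟩
  | all _ ih =>
    obtain ⟨k, hk⟩ := ih false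
    cases c
    · exact ⟨k, .all hk⟩
    · exact ⟨k + 1, .switch (.all hk)⟩
  | ex _ ih =>
    obtain ⟨k, hk⟩ := ih true
    cases c
    · exact ⟨k + 1, .switch (.ex hk)⟩
    · exact ⟨k, .ex hk⟩

end Prenex

/-! ### From lattice formulas to ring formulas: (A) -/

section RingFormulas

open MvPolynomial

variable {σ : Type}

/-- The value of a ring term. -/
def ringEval {F : Type*} [Field F] {α : Type*} (t : Language.ring.Term α) (r : α → F) : F :=
  letI := Ring.compatibleRingOfRing F
  t.realize r

theorem exists_ringTerm (p : MvPolynomial σ ℤ) :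
    ∃ t : Language.ring.Term σ, ∀ (F : Type u) [Field F] (r : σ → F), ringEval t r = aeval r p := by
  have hadd : ∀ p q : MvPolynomial σ ℤ,
      (∃ t : Language.ring.Term σ, ∀ (F : Type u) [Field F] (r : σ → F), ringEval t r = aeval r p) →
      (∃ t : Language.ring.Term σ, ∀ (F : Type u) [Field F] (r : σ → F), ringEval t r = aeval r q) →
      ∃ t : Language.ring.Term σ, ∀ (F : Type u) [Field F] (r : σ → F),
        ringEval t r = aeval r (p + q) := by
    rintro p q ⟨t, ht⟩ ⟨s, hs⟩
    refine ⟨t + s, fun F _ r => ?_⟩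
    let _ := Ring.compatibleRingOfRing F
    rw [map_add, ← ht, ← hs]
    exact Ring.realize_add t s r
  have hneg : ∀ p : MvPolynomial σ ℤ,
      (∃ t : Language.ring.Term σ, ∀ (F : Type u) [Field F] (r : σ → F), ringEval t r = aeval r p) →
      ∃ t : Language.ring.Term σ, ∀ (F : Type u) [Field F] (r : σ → F),
        ringEval t r = aeval r (-p) := by
    rintro p ⟨t, ht⟩
    refine ⟨-t, fun F _ r => ?_⟩
    let _ := Ring.compatibleRingOfRing F
    rw [map_neg, ← ht]
    exact Ring.realize_neg t r
  have hone : ∃ t : Language.ring.Term σ, ∀ (F : Type u) [Field F] (r : σ → F),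
      ringEval t r = aeval r (1 : MvPolynomial σ ℤ) := by
    refine ⟨1, fun F _ r => ?_⟩
    let _ := Ring.compatibleRingOfRing F
    rw [map_one]
    exact Ring.realize_one r
  induction p using MvPolynomial.induction_on with
  | C n =>
    induction n using Int.induction_on with
    | zero =>
      refine ⟨0, fun F _ r => ?_⟩
      let _ := Ring.compatibleRingOfRing F
      rw [C_0, map_zero]
      exact Ring.realize_zero r
    | succ n ih => rw [C_add, C_1]; exact hadd _ _ ih hone
    | pred n ih => rw [sub_eq_add_neg, C_add, C_neg (a := 1), C_1]; exact hadd _ _ ih (hneg _ hone)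
  | add p q hp hq => exact hadd p q hp hq
  | mul_X p i hp =>
    obtain ⟨t, ht⟩ := hp
    refine ⟨t * Term.var i, fun F _ r => ?_⟩
    let _ := Ring.compatibleRingOfRing F
    rw [map_mul, ← ht, aeval_X]
    exact Ring.realize_mul t _ r

theorem HomQF.exists_ringFormula {M : Type} [AddCommMonoid M] {w : σ → M} {P : PredFam.{u} σ}
    (hP : HomQF w P) : ∃ ψ : Language.ring.Formula σ, ψ.IsQF ∧
      ∀ (F : Type u) [Field F] (r : σ → F), RingHolds ψ r ↔ P F r := by
  induction hP with
  | eqn p m _ =>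
    obtain ⟨t, ht⟩ := exists_ringTerm.{u} p
    obtain ⟨s, hs⟩ := exists_ringTerm.{u} (0 : MvPolynomial σ ℤ)
    refine ⟨t.equal s, (BoundedFormula.IsAtomic.equal _ _).isQF, fun F _ r => ?_⟩
    let _ := Ring.compatibleRingOfRing F
    dsimp only
    rw [← ht, ← map_zero (aeval (R := ℤ) r), ← hs]
    exact Formula.realize_equal
  | not _ ih =>
    obtain ⟨ψ, hψ, h⟩ := ih
    exact ⟨ψ.not, hψ.not, fun F _ r => not_congr (h F r)⟩
  | and _ _ ih ih' =>
    obtain ⟨ψ, hψ, h⟩ := ih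
    obtain ⟨ψ', hψ', h'⟩ := ih'
    refine ⟨ψ ⊓ ψ', hψ.inf hψ', fun F _ r => ?_⟩
    let _ := Ring.compatibleRingOfRing F
    dsimp only
    rw [← h, ← h']
    exact Formula.realize_inf

theorem ringHolds_iExs {F : Type*} [Field F] {β : Type} [Finite β]
    {φ : Language.ring.Formula (σ ⊕ β)} {r : σ → F} :
    RingHolds (φ.iExs β) r ↔ ∃ x : β → F, RingHolds φ (Sum.elim r x) :=
  letI := Ring.compatibleRingOfRing F
  Formula.realize_iExs

theorem ringHolds_iAlls {F : Type*} [Field F] {β : Type} [Finite β]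
    {φ : Language.ring.Formula (σ ⊕ β)} {r : σ → F} :
    RingHolds (φ.iAlls β) r ↔ ∀ x : β → F, RingHolds φ (Sum.elim r x) :=
  letI := Ring.compatibleRingOfRing F
  Formula.realize_iAlls

variable {d : ℕ}

/-- The span of the columns of a matrix whose entries are parameters. -/
def colFam (f : Fin d × Fin d → σ) : SubFam.{u} σ d :=
  fun F _ r => Submodule.span F (Set.range fun j i => r (f (i, j)))

/-- With zero weights every polynomial is homogeneous of degree `0`, so the grading carries no
condition here. -/
theorem homSub_colFam (f : Fin d × Fin d → σ) : HomSub (0 : σ → ℕ) (colFam.{u} f) := by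
  refine (HomSub.span (fun j i => X (f (i, j))) fun j => ⟨0, fun i => ?_⟩).congr fun F _ r => ?_
  · exact isWeightedHomogeneous_X ℤ _ _
  · simp only [aeval_X]
    rfl

theorem exists_colFam_eq {F : Type u} [Field F] (r : σ → F) (y : Submodule F (Fin d → F)) :
    ∃ x : Fin d × Fin d → F, colFam Sum.inr F (Sum.elim r x) = y := by
  obtain ⟨A, hA⟩ := exists_matrix_col y
  exact ⟨fun x => A x.1 x.2, hA⟩

theorem latRealize_snoc_fam {β : Type} {n : ℕ} {φ : latLang.BoundedFormula β (n + 1)}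
    {U : β → SubFam.{u} σ d} {X : Fin n → SubFam.{u} σ d} {Y : SubFam.{u} σ d} {F : Type u} [Field F]
    {r : σ → F} :
    LatRealize φ (fun a => U a F r)
      (fun i => (Fin.snoc X Y : Fin (n + 1) → SubFam.{u} σ d) i F r) ↔
    LatRealize φ (fun a => U a F r) (Fin.snoc (fun i => X i F r) (Y F r)) := by
  have : (fun i => (Fin.snoc X Y : Fin (n + 1) → SubFam.{u} σ d) i F r) =
      Fin.snoc (fun i => X i F r) (Y F r) := by
    funext i
    induction i using Fin.lastCases <;> simp
  rw [this]

theorem homSub_snoc {M : Type} [AddCommMonoid M] {w : σ → M} {n : ℕ} {X : Fin n → SubFam.{u} σ d}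
    {Y : SubFam.{u} σ d} (hX : ∀ i, HomSub w (X i)) (hY : HomSub w Y) (i : Fin (n + 1)) :
    HomSub w ((Fin.snoc X Y : Fin (n + 1) → SubFam.{u} σ d) i) := by
  induction i using Fin.lastCases with
  | last => simpa using hY
  | cast i => simpa using hX i

/-- Every subspace is the column span of a matrix, so one lattice quantifier turns into `d * d`
field quantifiers of the same kind. The parameter type `σ` grows by the entries of that matrix. -/
theorem PrenexClass.exists_ringFormula {β : Type} {c : Bool} {k n : ℕ}
    {φ : latLang.BoundedFormula β n} (h : PrenexClass c k φ) (σ : Type) {U : β → SubFam.{u} σ d}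
    {X : Fin n → SubFam.{u} σ d} (hU : ∀ x, HomSub (0 : σ → ℕ) (U x))
    (hX : ∀ x, HomSub (0 : σ → ℕ) (X x)) :
    ∃ ψ : Language.ring.Formula σ, PrenexClass c k ψ ∧ ∀ (F : Type u) [Field F] (r : σ → F),
      RingHolds ψ r ↔ LatRealize φ (fun x => U x F r) fun x => X x F r := by
  have hinl : ∀ {σ : Type} {W : SubFam.{u} σ d}, HomSub (0 : σ → ℕ) W →
      HomSub (0 : σ ⊕ (Fin d × Fin d) → ℕ) fun F _ r => W F fun x => r (Sum.inl x) := fun hW =>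
    hW.rename (w := 0) (w' := 0) (f := Sum.inl) (g := AddMonoidHom.id ℕ) fun x => rfl
  induction h generalizing σ with
  | qf h =>
    obtain ⟨ψ, hψ, h'⟩ := (HomSub.latRealize hU hX h).exists_ringFormula
    exact ⟨ψ, .qf hψ, h'⟩
  | @ex _ n φ _ ih =>
    obtain ⟨ψ, hψ, h'⟩ := ih (σ ⊕ (Fin d × Fin d)) (fun x => hinl (hU x))
      (homSub_snoc (fun x => hinl (hX x)) (homSub_colFam Sum.inr))
    refine ⟨ψ.iExs _, hψ.iExs, fun F _ r => ?_⟩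
    rw [ringHolds_iExs, latRealize_ex]
    have h'' : ∀ x, RingHolds ψ (Sum.elim r x) ↔ LatRealize φ (fun a => U a F r)
        (Fin.snoc (fun i => X i F r) (colFam Sum.inr F (Sum.elim r x))) := fun x =>
      (h' F _).trans (latRealize_snoc_fam (U := fun x F _ r => U x F fun y => r (Sum.inl y))
        (X := fun x F _ r => X x F fun y => r (Sum.inl y)))
    simp only [h'']
    constructor
    · rintro ⟨x, hx⟩
      exact ⟨_, hx⟩
    · rintro ⟨y, hy⟩
      obtain ⟨x, rfl⟩ := exists_colFam_eq r y
      exact ⟨x, hy⟩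
  | @all _ n φ _ ih =>
    obtain ⟨ψ, hψ, h'⟩ := ih (σ ⊕ (Fin d × Fin d)) (fun x => hinl (hU x))
      (homSub_snoc (fun x => hinl (hX x)) (homSub_colFam Sum.inr))
    refine ⟨ψ.iAlls _, hψ.iAlls, fun F _ r => ?_⟩
    rw [ringHolds_iAlls, latRealize_all]
    have h'' : ∀ x, RingHolds ψ (Sum.elim r x) ↔ LatRealize φ (fun a => U a F r)
        (Fin.snoc (fun i => X i F r) (colFam Sum.inr F (Sum.elim r x))) := fun x =>
      (h' F _).trans (latRealize_snoc_fam (U := fun x F _ r => U x F fun y => r (Sum.inl y))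
        (X := fun x F _ r => X x F fun y => r (Sum.inl y)))
    simp only [h'']
    constructor
    · intro hx y
      obtain ⟨x, rfl⟩ := exists_colFam_eq r y
      exact hx x
    · exact fun hy x => hy _
  | switch _ ih =>
    obtain ⟨ψ, hψ, h'⟩ := ih σ hU hX
    exact ⟨ψ, .switch hψ, h'⟩

/-- Translation of lattice formulas into ring formulas. -/
theorem exists_ringFormula {β : Type} (φ : latLang.Formula β) {U : β → SubFam.{u} σ d}
    (hU : ∀ x, HomSub (0 : σ → ℕ) (U x)) :
    ∃ ψ : Language.ring.Formula σ, (φ.IsQF → ψ.IsQF) ∧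
      (PrenexClass true 1 φ → PrenexClass true 1 ψ) ∧
      ∀ (F : Type u) [Field F] (r : σ → F), RingHolds ψ r ↔ LatHolds φ fun x => U x F r := by
  -- One translation has to preserve both syntactic classes: quantifier free and `Σ_1` formulas are
  -- translated as they stand, and only the remaining ones pass through prenex normal form.
  by_cases h : φ.IsQF
  · obtain ⟨ψ, hψ, h'⟩ := (HomSub.latRealize hU (X := default) (fun x => x.elim0) h).exists_ringFormula
    exact ⟨ψ, fun _ => hψ, fun _ => .qf hψ, fun F _ r => (h' F r).trans (latHolds_iff _).symm⟩
  by_cases h1 : PrenexClass true 1 φ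
  · obtain ⟨ψ, hψ, h'⟩ := h1.exists_ringFormula σ hU (X := default) (fun x => x.elim0)
    exact ⟨ψ, fun h' => absurd h' h, fun _ => hψ, fun F _ r => (h' F r).trans (latHolds_iff _).symm⟩
  · obtain ⟨k, hk⟩ := exists_prenexClass φ.toPrenex_isPrenex true
    obtain ⟨ψ, hψ, h'⟩ := hk.exists_ringFormula σ hU (X := default) (fun x => x.elim0)
    refine ⟨ψ, fun h' => absurd h' h, fun h' => absurd h' h1, fun F _ r => ?_⟩
    let _ := latStructure (Submodule F (Fin d → F))
    exact ((h' F r).trans (BoundedFormula.realize_toPrenex φ)).trans (latHolds_iff _).symm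

theorem latHolds_ofCoord {F V : Type*} [Field F] [AddCommGroup V] [Module F V]
    (b : Module.Basis (Fin d) F V) {β : Type} (φ : latLang.Formula β)
    (U : β → Submodule F (Fin d → F)) :
    LatHolds φ (fun x => ofCoord b (U x)) ↔ LatHolds φ U :=
  latHolds_orderIso (ofCoord b) φ U

theorem exists_ringFormula_thetaLF (d n : ℕ) (φ : latLang.Formula (Fin n)) :
    ∃ ψ : Language.ring.Formula (Fin n × Fin d × Fin d), (φ.IsQF → ψ.IsQF) ∧
      ∀ (F : Type u) [Field F] (V : Type v) [AddCommGroup V] [Module F V]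
        (b : Module.Basis (Fin d) F V),
        thetaLF b {w | LatHolds φ w} = {A | RingHolds ψ (fun x => A x.1 x.2.1 x.2.2)} := by
  obtain ⟨ψ, h1, -, h2⟩ := exists_ringFormula.{u} φ
    (fun k => homSub_colFam (σ := Fin n × Fin d × Fin d) (fun x => (k, x)))
  refine ⟨ψ, h1, fun F _ V _ _ b => ?_⟩
  ext A
  rw [Set.mem_ofPred_eq, h2, ← latHolds_ofCoord b]
  have : (fun k => ofCoord b (colFam (fun x => (k, x)) F fun x : Fin n × Fin d × Fin d =>
      A x.1 x.2.1 x.2.2)) = fun k => colSpan b (A k) := by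
    funext k
    rw [colSpan_eq]
    rfl
  rw [this]
  constructor
  · rintro ⟨u, hu, h⟩
    rwa [← funext h]
  · exact fun h => ⟨_, h, fun _ => rfl⟩

end RingFormulas

/-! ### From lattice formulas to conditions on Plücker coordinates: (B)(i) -/

section PluckerFamilies

open MvPolynomial

variable {ι : Type} {d : ℕ} (dv : ι → ℕ)

/-- A subspace given by its Plücker coordinates. -/
def pluckerFam (k : ι) : SubFam.{u} (Σ k : ι, PlIdx d (dv k)) d :=
  fun _ _ r => subGr (dv k) fun I => r ⟨k, I⟩

/-- The contractions are linear in the coordinates of the one variable `k`, and the subspace is the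
orthogonal of their span. -/
theorem homSub_pluckerFam {M : Type} [AddCommMonoid M] (w : ι → M) (k : ι) :
    HomSub (fun x : Σ k : ι, PlIdx d (dv k) => w x.1) (pluckerFam.{u} dv k) := by
  have hX : HomVec (fun x : Σ k : ι, PlIdx d (dv k) => w x.1)
      fun I : PlIdx d (dv k) => (X ⟨k, I⟩ : MvPolynomial (Σ k : ι, PlIdx d (dv k)) ℤ) :=
    ⟨w k, fun I => isWeightedHomogeneous_X ℤ _ _⟩
  unfold pluckerFam subGr
  split_ifs
  · exact HomSub.bot
  · refine (HomSub.span _ fun I => homVec_contraction hX I).perp.congr fun F _ r => ?_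
    simp only [aeval_contraction, aeval_X]

variable {F : Type u} [Field F] {V : Type v} [AddCommGroup V] [Module F V]
  (b : Module.Basis (Fin d) F V)

theorem latInvariant_latHolds (φ : latLang.Formula ι) :
    LatInvariant {w : ι → Submodule F V | w ∈ dimSet F V dv ∧ LatHolds φ w} := by
  rintro g w ⟨h1, h2⟩
  refine ⟨fun k => ?_, ?_⟩
  · rw [← h1 k]
    exact LinearEquiv.finrank_map_eq g (w k)
  · exact (latHolds_orderIso (Submodule.orderIsoMapComap g) φ w).2 h2

theorem thetaLG_latHolds (φ : latLang.Formula ι) :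
    thetaLG b dv {w | LatHolds φ w} =
      {r | r ∈ GrProd F d dv ∧ LatHolds φ fun k => pluckerFam dv k F fun x => r x.1 x.2} := by
  rw [thetaLG_eq]
  ext r
  exact and_congr_right fun _ => latHolds_ofCoord b φ _

theorem thetaLG_dimSet_latHolds (φ : latLang.Formula ι) :
    thetaLG b dv {w | w ∈ dimSet F V dv ∧ LatHolds φ w} = thetaLG b dv {w | LatHolds φ w} := by
  rw [thetaLG_eq, thetaLG_eq]
  ext r
  refine and_congr_right fun h => ⟨fun h' => h'.2, fun h' => ⟨fun k => ?_, h'⟩⟩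
  rw [finrank_ofCoord, finrank_subGr (h k)]

theorem scalarInvariant_pluckerFam {c : ι → F} (hc : ∀ k, c k ≠ 0) (r : ∀ k, PlIdx d (dv k) → F)
    (k : ι) : (pluckerFam dv k F fun x => c x.1 * r x.1 x.2) = pluckerFam dv k F fun x => r x.1 x.2 :=
  subGr_smul (hc k) (r k)

theorem exists_ringFormula_thetaLG (φ : latLang.Formula ι) :
    ∃ ψ : Language.ring.Formula (Σ k : ι, PlIdx d (dv k)), (φ.IsQF → ψ.IsQF) ∧
      (PrenexClass true 1 φ → PrenexClass true 1 ψ) ∧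
      ∀ (F : Type u) [Field F] (V : Type v) [AddCommGroup V] [Module F V]
        (b : Module.Basis (Fin d) F V),
        BiInvariant (thetaLG b dv {w | w ∈ dimSet F V dv ∧ LatHolds φ w}) ∧
        ScalarInvariantFormula F dv ψ ∧
        thetaLG b dv {w | w ∈ dimSet F V dv ∧ LatHolds φ w} = ringDefined F dv ψ := by
  obtain ⟨ψ, h1, h2, h3⟩ := exists_ringFormula.{u} φ
    (fun k => homSub_pluckerFam (d := d) dv (fun _ => (0 : ℕ)) k)
  refine ⟨ψ, h1, h2, fun F _ V _ _ b =>
    ⟨biInvariant_thetaLG b dv (latInvariant_latHolds dv φ), fun r _ c hc => ?_, ?_⟩⟩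
  · rw [h3, h3]
    simp only [scalarInvariant_pluckerFam dv hc]
  · rw [thetaLG_dimSet_latHolds, thetaLG_latHolds]
    ext r
    exact and_congr_right fun _ => (h3 F _).symm

end PluckerFamilies

/-! ### Subspaces as joins of meets of lines and hyperplanes -/

section Hyperplanes

variable {F : Type*} [Field F] {d : ℕ}

theorem finrank_perp (U : Submodule F (Fin d → F)) :
    Module.finrank F (perp U) = d - Module.finrank F U := by
  have := LinearMap.BilinForm.finrank_orthogonal (dotProductBilin_nondegenerate (F := F) (d := d)) U
  rw [Module.finrank_fin_fun] at this
  exact this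

/-- For `v ≠ 0`, take the line of `v` and a hyperplane with normal vector orthogonal to `v`; such a
normal exists as `d ≥ 2`. For `v = 0`, take a unit vector `e` and the hyperplane orthogonal to it,
which avoids `e` as `e ⬝ᵥ e = 1`. -/
theorem exists_inf_hyperplane (hd : 2 ≤ d) (v : Fin d → F) :
    ∃ x ∈ Gr F d 1, ∃ h ∈ Gr F d (d - 1), subGr 1 x ⊓ subGr (d - 1) h = Submodule.span F {v} := by
  have hyp : ∀ z : Fin d → F, z ≠ 0 →
      Module.finrank F (perp (Submodule.span F {z})) = d - 1 := fun z hz => by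
    rw [finrank_perp, finrank_span_singleton hz]
  rcases eq_or_ne v 0 with rfl | hv
  · let e : Fin d → F := Pi.single ⟨0, by omega⟩ 1
    have he : e ≠ 0 := by simp [e]
    obtain ⟨x, hx, hx'⟩ := exists_mem_Gr (finrank_span_singleton (K := F) he)
    obtain ⟨h, hh, hh'⟩ := exists_mem_Gr (hyp e he)
    refine ⟨x, hx, h, hh, ?_⟩
    rw [hx', hh', Submodule.span_zero_singleton, ← disjoint_iff, disjoint_comm,
      Submodule.disjoint_span_singleton' he]
    intro h0
    have := mem_perp.1 h0 e (Submodule.mem_span_singleton_self e)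
    simp [e] at this
  · have h1 : 0 < Module.finrank F (perp (Submodule.span F {v})) := by rw [hyp v hv]; omega
    obtain ⟨⟨z, hz⟩, hz0⟩ := (Module.finrank_pos_iff_exists_ne_zero).1 h1
    have hz0' : z ≠ 0 := fun h => hz0 (Subtype.ext h)
    obtain ⟨x, hx, hx'⟩ := exists_mem_Gr (finrank_span_singleton (K := F) hv)
    obtain ⟨h, hh, hh'⟩ := exists_mem_Gr (hyp z hz0')
    refine ⟨x, hx, h, hh, ?_⟩
    rw [hx', hh', inf_eq_left, le_perp_comm, Submodule.span_singleton_le_iff_mem]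
    exact hz

/-- Joins of `j` subspaces each of which is the meet of a line and a hyperplane. -/
def lineJoins (F : Type*) [Field F] (d : ℕ) : ℕ → Set (Submodule F (Fin d → F))
  | 0 => {⊥}
  | j + 1 => {W | ∃ x ∈ Gr F d 1, ∃ h ∈ Gr F d (d - 1), ∃ Z ∈ lineJoins F d j,
      W = subGr 1 x ⊓ subGr (d - 1) h ⊔ Z}

/-- Applied to the columns of a matrix with column span `U`, zero columns included. Quantification
over all subspaces thereby becomes `2 * d` quantifications over the fixed sorts `1` and `d - 1`,
with no disjunction over dimensions. -/
theorem mem_lineJoins (hd : 2 ≤ d) (U : Submodule F (Fin d → F)) : U ∈ lineJoins F d d := by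
  suffices h : ∀ (j : ℕ) (u : Fin j → Fin d → F),
      Submodule.span F (Set.range u) ∈ lineJoins F d j by
    obtain ⟨A, rfl⟩ := exists_matrix_col U
    exact h d A.col
  intro j
  induction j with
  | zero =>
    intro u
    rw [Set.range_eq_empty, Submodule.span_empty]
    rfl
  | succ j ih =>
    intro u
    obtain ⟨x, hx, h, hh, h'⟩ := exists_inf_hyperplane hd (u 0)
    refine ⟨x, hx, h, hh, _, ih (Fin.tail u), ?_⟩
    rw [h', ← Submodule.span_union, Set.singleton_union, ← Fin.range_cons, Fin.cons_self_tail]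

end Hyperplanes

/-! ### Uniform treatment of the two quantifiers -/

section BoundedQuantifier

/-- The quantifier over a set: existential for `true`, universal for `false`. -/
def boundedQ (c : Bool) {X : Type*} (S : Set X) (p : X → Prop) : Prop :=
  match c with
  | true => ∃ x ∈ S, p x
  | false => ∀ x ∈ S, p x

theorem boundedQ_congr {c : Bool} {X : Type*} {S : Set X} {p q : X → Prop} (h : ∀ x, p x ↔ q x) :
    boundedQ c S p ↔ boundedQ c S q := by
  rw [funext fun x => propext (h x)]

theorem boundedQ_lineJoins_zero {F : Type*} [Field F] {d : ℕ} (c : Bool)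
    (p : Submodule F (Fin d → F) → Prop) : boundedQ c (lineJoins F d 0) p ↔ p ⊥ := by
  cases c <;> simp [boundedQ, lineJoins]

theorem boundedQ_lineJoins_succ {F : Type*} [Field F] {d : ℕ} (c : Bool) (j : ℕ)
    (p : Submodule F (Fin d → F) → Prop) : boundedQ c (lineJoins F d (j + 1)) p ↔
      boundedQ c (Gr F d 1) fun x => boundedQ c (Gr F d (d - 1)) fun h =>
        boundedQ c (lineJoins F d j) fun Z => p (subGr 1 x ⊓ subGr (d - 1) h ⊔ Z) := by
  cases c
  · constructor
    · exact fun H x hx h hh Z hZ => H _ ⟨x, hx, h, hh, Z, hZ, rfl⟩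
    · rintro H _ ⟨x, hx, h, hh, Z, hZ, rfl⟩
      exact H x hx h hh Z hZ
  · constructor
    · rintro ⟨_, ⟨x, hx, h, hh, Z, hZ, rfl⟩, H⟩
      exact ⟨x, hx, h, hh, Z, hZ, H⟩
    · rintro ⟨x, hx, h, hh, Z, hZ, H⟩
      exact ⟨_, ⟨x, hx, h, hh, Z, hZ, rfl⟩, H⟩

end BoundedQuantifier

/-! ### Homogeneous formulas over the Grassmannians: (C) -/

section GrassmannFormulas

open MvPolynomial

variable {d : ℕ} {α : Type} {s : α → ℕ}

/-- The multidegree of a Plücker coordinate of a variable. -/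
noncomputable def plWeight (d : ℕ) {α : Type} (s : α → ℕ) (x : Σ a : α, PlIdx d (s a)) : α →₀ ℕ :=
  Finsupp.single x.1 1

/-- Relations on Plücker coordinates defined by a homogeneous formula of a given prenex class. -/
def HasGrForm (c : Bool) (k : ℕ) (s : α → ℕ) (P : PredFam.{u} (Σ a : α, PlIdx d (s a))) : Prop :=
  ∃ ψ : GrForm d α s, ψ.IsHomogeneous ∧ GrForm.PrenexClass c k ψ ∧
    ∀ (F : Type u) [Field F] (r : ∀ a, PlIdx d (s a) → F), ψ.Holds F r ↔ P F fun x => r x.1 x.2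

theorem HomQF.exists_grForm {P : PredFam.{u} (Σ a : α, PlIdx d (s a))}
    (hP : HomQF (plWeight d s) P) :
    ∃ ψ : GrForm d α s, ψ.IsHomogeneous ∧ ψ.IsQF ∧
      ∀ (F : Type u) [Field F] (r : ∀ a, PlIdx d (s a) → F),
        ψ.Holds F r ↔ P F fun x => r x.1 x.2 := by
  classical
  induction hP with
  | eqn p m hp =>
    refine ⟨.eqn p, fun a => ⟨m a, ?_⟩, trivial, fun F _ r => Iff.rfl⟩
    -- The weights are multidegrees; evaluation at `a` gives the degree in the coordinates of `a`
    -- alone.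
    have := IsWeightedHomogeneous.rename (f := id) (g := Finsupp.applyAddHom a)
      (w' := fun x : Σ a : α, PlIdx d (s a) => plWeight d s x a) (fun _ => rfl) hp
    rw [rename_id_apply] at this
    convert this using 2
    · exact (Finsupp.single_apply ..).symm
    · rfl
  | not _ ih =>
    obtain ⟨ψ, h1, h2, h3⟩ := ih
    exact ⟨.not ψ, h1, h2, fun F _ r => not_congr (h3 F r)⟩
  | and _ _ ih ih' =>
    obtain ⟨ψ, h1, h2, h3⟩ := ih
    obtain ⟨ψ', h1', h2', h3'⟩ := ih'
    exact ⟨.and ψ ψ', ⟨h1, h1'⟩, ⟨h2, h2'⟩, fun F _ r => and_congr (h3 F r) (h3' F r)⟩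

theorem HasGrForm.quantify {c : Bool} {k m : ℕ} (hm : m ≤ d)
    {P : PredFam.{u} (Σ a, PlIdx d (extSort s m a))} (h : HasGrForm c (k + 1) (extSort s m) P) :
    HasGrForm c (k + 1) s fun F _ r => boundedQ c (Gr F d m) fun x =>
      P F fun y => extVal (fun a I => r ⟨a, I⟩) x y.1 y.2 := by
  obtain ⟨ψ, h1, h2, h3⟩ := h
  cases c
  · refine ⟨.all m hm ψ, h1, .all h2, fun F _ r => ?_⟩
    exact forall_congr' fun x => imp_congr_right fun _ => h3 F _
  · refine ⟨.ex m hm ψ, h1, .ex h2, fun F _ r => ?_⟩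
    exact exists_congr fun x => and_congr_right fun _ => h3 F _

theorem HasGrForm.congr {c : Bool} {k : ℕ} {P Q : PredFam.{u} (Σ a : α, PlIdx d (s a))}
    (h : HasGrForm c k s P)
    (h' : ∀ (F : Type u) [Field F] (r : ∀ a, PlIdx d (s a) → F),
      (P F fun x => r x.1 x.2) ↔ Q F fun x => r x.1 x.2) : HasGrForm c k s Q := by
  obtain ⟨ψ, h1, h2, h3⟩ := h
  exact ⟨ψ, h1, h2, fun F _ r => (h3 F r).trans (h' F r)⟩

/-- A family of subspaces as a family depending on an additional variable. -/
def extFam (m : ℕ) (U : SubFam.{u} (Σ a : α, PlIdx d (s a)) d) :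
    SubFam.{u} (Σ a, PlIdx d (extSort s m a)) d :=
  fun F _ r => U F fun x => r ⟨some x.1, x.2⟩

theorem homSub_extFam (m : ℕ) {U : SubFam.{u} (Σ a : α, PlIdx d (s a)) d}
    (hU : HomSub (plWeight d s) U) : HomSub (plWeight d (extSort s m)) (extFam m U) :=
  hU.rename (w' := plWeight d (extSort s m))
    (f := fun x : Σ a : α, PlIdx d (s a) => (⟨some x.1, x.2⟩ : Σ a, PlIdx d (extSort s m a)))
    (g := Finsupp.mapDomain.addMonoidHom some) fun _ =>
      (Finsupp.mapDomain_single (f := some)).symm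

theorem homSub_pluckerFam_plWeight (s : α → ℕ) (a : α) :
    HomSub (plWeight d s) (pluckerFam.{u} s a) :=
  homSub_pluckerFam s (fun a => Finsupp.single a 1) a

/-- Here `H` is the induction hypothesis for the formula under the quantifier, and `Y` accumulates
the joinands chosen so far. Each step prefixes two quantifiers of kind `c`, over lines and over
hyperplanes, so the block is only lengthened. -/
theorem HasGrForm.lineJoins (hd : 2 ≤ d) {β : Type} {c : Bool} {k n : ℕ}
    {φ : latLang.BoundedFormula β (n + 1)}
    (H : ∀ (α : Type) (s : α → ℕ) (U : β → SubFam.{u} (Σ a, PlIdx d (s a)) d)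
      (X : Fin (n + 1) → SubFam.{u} (Σ a, PlIdx d (s a)) d),
      (∀ x, HomSub (plWeight d s) (U x)) → (∀ x, HomSub (plWeight d s) (X x)) →
        HasGrForm c (k + 1) s fun F _ r => LatRealize φ (fun x => U x F r) fun x => X x F r)
    (j : ℕ) (α : Type) (s : α → ℕ) (U : β → SubFam.{u} (Σ a, PlIdx d (s a)) d)
    (X : Fin n → SubFam.{u} (Σ a, PlIdx d (s a)) d) (Y : SubFam.{u} (Σ a, PlIdx d (s a)) d)
    (hU : ∀ x, HomSub (plWeight d s) (U x)) (hX : ∀ x, HomSub (plWeight d s) (X x))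
    (hY : HomSub (plWeight d s) Y) :
    HasGrForm c (k + 1) s fun F _ r => boundedQ c (lineJoins F d j) fun Z =>
      LatRealize φ (fun x => U x F r) (Fin.snoc (fun x => X x F r) (Y F r ⊔ Z)) := by
  induction j generalizing α s U X Y with
  | zero =>
    refine (H α s U (Fin.snoc X Y) hU (homSub_snoc hX hY)).congr fun F _ r => ?_
    rw [boundedQ_lineJoins_zero, sup_bot_eq, latRealize_snoc_fam]
  | succ j ih =>
    have hext : ∀ {α : Type} {s : α → ℕ} (m : ℕ) {U : SubFam.{u} (Σ a : α, PlIdx d (s a)) d},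
      HomSub (plWeight d s) U → HomSub (plWeight d (extSort s m)) (extFam m U) := homSub_extFam
    refine ((ih _ (extSort (extSort s 1) (d - 1)) (fun x => extFam _ (extFam _ (U x)))
      (fun x => extFam _ (extFam _ (X x)))
      (fun F _ r => extFam _ (extFam _ Y) F r ⊔ (extFam _ (pluckerFam _ none) F r ⊓
        pluckerFam _ none F r)) (fun x => hext _ (hext _ (hU x))) (fun x => hext _ (hext _ (hX x)))
      ((hext _ (hext _ hY)).sup ((hext _ (homSub_pluckerFam_plWeight _ none)).inf
        (homSub_pluckerFam_plWeight _ none)))).quantify (by omega)).quantify (by omega)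
        |>.congr fun F _ r => ?_
    rw [boundedQ_lineJoins_succ]
    refine boundedQ_congr fun x => boundedQ_congr fun h => boundedQ_congr fun Z => ?_
    rw [← sup_assoc]
    exact Iff.rfl

theorem PrenexClass.hasGrForm (hd : 2 ≤ d) {β : Type} {c : Bool} {k n : ℕ}
    {φ : latLang.BoundedFormula β n} (h : PrenexClass c k φ) (α : Type) (s : α → ℕ)
    (U : β → SubFam.{u} (Σ a, PlIdx d (s a)) d) (X : Fin n → SubFam.{u} (Σ a, PlIdx d (s a)) d)
    (hU : ∀ x, HomSub (plWeight d s) (U x)) (hX : ∀ x, HomSub (plWeight d s) (X x)) :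
    HasGrForm c k s fun F _ r => LatRealize φ (fun x => U x F r) fun x => X x F r := by
  induction h generalizing α s with
  | qf h =>
    obtain ⟨ψ, h1, h2, h3⟩ := (HomSub.latRealize hU hX h).exists_grForm
    exact ⟨ψ, h1, .qf h2, h3⟩
  | ex _ ih =>
    refine (HasGrForm.lineJoins hd ih d α s U X (fun F _ _ => ⊥) hU hX HomSub.bot).congr
      fun F _ r => ?_
    rw [latRealize_ex]
    constructor
    · rintro ⟨Z, -, hZ⟩
      exact ⟨_, hZ⟩
    · rintro ⟨y, hy⟩
      exact ⟨y, mem_lineJoins hd y, by beta_reduce; rwa [bot_sup_eq]⟩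
  | all _ ih =>
    refine (HasGrForm.lineJoins hd ih d α s U X (fun F _ _ => ⊥) hU hX HomSub.bot).congr
      fun F _ r => ?_
    rw [latRealize_all]
    constructor
    · intro H y
      have := H y (mem_lineJoins hd y)
      beta_reduce at this
      rwa [bot_sup_eq] at this
    · exact fun H Z _ => H _
  | switch _ ih =>
    obtain ⟨ψ, h1, h2, h3⟩ := ih α s U X hU hX
    exact ⟨ψ, h1, .switch h2, h3⟩

/-- For `d ≤ 1` the method of lines and hyperplanes is not available, but the subspace lattice is a
fixed one with one or two elements. Once the dimensions are prescribed, the truth value of a formula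
is then the same for all fields, and `top` or `bot` defines the relation. -/
theorem exists_lattice_of_le_one (hd : d ≤ 1) :
    ∃ (L : Type) (_ : Lattice L) (_ : BoundedOrder L),
      ∀ (F : Type u) [Field F], Nonempty (Submodule F (Fin d → F) ≃o L) := by
  obtain rfl | rfl : d = 0 ∨ d = 1 := by omega
  · refine ⟨PUnit, inferInstance, inferInstance, fun F _ => ⟨⟨⟨fun _ => ⟨⟩, fun _ => ⊥, fun _ =>
      Subsingleton.elim _ _, fun _ => rfl⟩, ?_⟩⟩⟩
    intro U W
    simp [Subsingleton.elim U W]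
  · classical
    refine ⟨Bool, inferInstance, inferInstance, fun F _ => ?_⟩
    have : IsSimpleModule F (Fin 1 → F) := isSimpleModule_iff_finrank_eq_one.2 (by simp)
    exact ⟨IsSimpleOrder.orderIsoBool⟩

theorem PrenexClass.exists_grForm_thetaLG {β : Type} {φ : latLang.Formula β} {c : Bool} {k : ℕ}
    (h : PrenexClass c k φ) (dv : β → ℕ) (hdv : ∀ i, dv i ≤ d) :
    ∃ ψ : GrForm d β dv, ψ.IsHomogeneous ∧ GrForm.PrenexClass c k ψ ∧
      ∀ (F : Type u) [Field F],
        thetaLG (Pi.basisFun F (Fin d)) dv {w | LatHolds φ w} = ψ.defined F := by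
  simp only [thetaLG_latHolds]
  rcases le_or_gt 2 d with hd | hd
  · obtain ⟨ψ, h1, h2, h3⟩ := h.hasGrForm hd β dv (fun k => pluckerFam.{u} dv k) default
      (homSub_pluckerFam_plWeight dv) fun x => x.elim0
    refine ⟨ψ, h1, h2, fun F _ => ?_⟩
    ext r
    exact and_congr_right fun _ => (latHolds_iff _).trans (h3 F r).symm
  · obtain ⟨L, _, _, hL⟩ := exists_lattice_of_le_one.{u} (show d ≤ 1 by omega)
    have key : ∀ (F : Type u) [Field F] (r : ∀ k, PlIdx d (dv k) → F), r ∈ GrProd F d dv →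
        (LatHolds φ (fun k => pluckerFam dv k F fun x => r x.1 x.2) ↔
          LatHolds φ fun k => if dv k = 0 then (⊥ : L) else ⊤) := by
      intro F _ r hr
      obtain ⟨e⟩ := hL F
      rw [← latHolds_orderIso e]
      have : (fun k => e (pluckerFam dv k F fun x => r x.1 x.2)) =
          fun k => if dv k = 0 then (⊥ : L) else ⊤ := by
        funext k
        have h1 := finrank_subGr (hr k)
        split_ifs with h0
        · rw [← map_bot e]
          exact congrArg e (Submodule.finrank_eq_zero.1 (h1.trans h0))
        · have h2 : Module.finrank F (subGr (dv k) (r k)) = Module.finrank F (Fin d → F) := by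
            have := hdv k
            rw [h1, Module.finrank_fin_fun]
            omega
          rw [← map_top e, ← Submodule.eq_top_of_finrank_eq h2]
          rfl
      rw [this]
    by_cases hφ : LatHolds φ fun k => if dv k = 0 then (⊥ : L) else ⊤
    · refine ⟨.top, trivial, .qf trivial, fun F _ => ?_⟩
      ext r
      exact and_congr_right fun hr => by simpa [key F r hr, GrForm.Holds] using hφ
    · refine ⟨.bot, trivial, .qf trivial, fun F _ => ?_⟩
      ext r
      exact and_congr_right fun hr => by simpa [key F r hr, GrForm.Holds] using hφ

end GrassmannFormulas

/-! ### Geometry of frames and von Staudt's constructions -/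

section FrameGeometry

variable {F : Type*} [Field F] {V : Type*} [AddCommGroup V] [Module F V] {d : ℕ}

/-- The frame of a basis. -/
def basisFrame (b : Module.Basis (Fin d) F V) (i j : Fin d) : Submodule F V :=
  if i = j then Submodule.span F {b i} else Submodule.span F {b j - b i}

theorem basisFrame_self (b : Module.Basis (Fin d) F V) (i : Fin d) :
    basisFrame b i i = Submodule.span F {b i} := if_pos rfl

theorem basisFrame_of_ne (b : Module.Basis (Fin d) F V) {i j : Fin d} (h : i ≠ j) :
    basisFrame b i j = Submodule.span F {b j - b i} := if_neg h

theorem frameBasis_iff {a : Fin d → Fin d → Submodule F V} {b : Module.Basis (Fin d) F V} :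
    FrameBasis a b ↔ a = basisFrame b := by
  constructor
  · rintro ⟨h1, h2⟩
    funext i j
    by_cases h : i = j
    · subst h
      rw [h1, basisFrame_self]
    · rw [h2 i j h, basisFrame_of_ne b h]
  · rintro rfl
    exact ⟨basisFrame_self b, fun i j h => basisFrame_of_ne b h⟩

theorem coord_basis (b : Module.Basis (Fin d) F V) (i j : Fin d) :
    b.coord i (b j) = if j = i then 1 else 0 := by
  rw [Module.Basis.coord_apply, b.repr_self, Finsupp.single_apply]

/-- As `f y ≠ 0`, a combination of `x` and `y` killed by `f` is determined by its coefficient at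
`x`, and `p ≠ 0` makes it a multiple of `z`. The coordinate constructions below are instances of
this, with `f` chosen to eliminate an auxiliary basis vector. -/
theorem span_pair_inf_eq (f : V →ₗ[F] F) {W : Submodule F V} (hW : W ≤ LinearMap.ker f) {x y z : V}
    {p q : F} (hz : z = p • x + q • y) (hp : p ≠ 0) (hzW : z ∈ W) (hy : f y ≠ 0) :
    (Submodule.span F {x} ⊔ Submodule.span F {y}) ⊓ W = Submodule.span F {z} := by
  apply le_antisymm
  · rintro w ⟨hw, hwW⟩
    obtain ⟨w1, hw1, w2, hw2, rfl⟩ := Submodule.mem_sup.1 hw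
    obtain ⟨α, rfl⟩ := Submodule.mem_span_singleton.1 hw1
    obtain ⟨β, rfl⟩ := Submodule.mem_span_singleton.1 hw2
    have h1 : f (α • x + β • y) = 0 := hW hwW
    have h2 : f z = 0 := hW hzW
    rw [hz] at h2
    simp only [map_add, map_smul, smul_eq_mul] at h1 h2
    have h3 : β = α / p * q := by
      have : (β - α / p * q) * f y = 0 := by
        field_simp
        linear_combination p * h1 - α * h2
      rcases mul_eq_zero.1 this with h | h
      · exact sub_eq_zero.1 h
      · exact absurd h hy
    rw [Submodule.mem_span_singleton]
    refine ⟨α / p, ?_⟩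
    rw [hz, smul_add, smul_smul, smul_smul, div_mul_cancel₀ _ hp, h3]
  · rw [Submodule.span_singleton_le_iff_mem]
    refine ⟨?_, hzW⟩
    rw [hz]
    exact Submodule.add_mem_sup (Submodule.smul_mem _ _ (Submodule.mem_span_singleton_self x))
      (Submodule.smul_mem _ _ (Submodule.mem_span_singleton_self y))

theorem span_pair_le_ker (f : V →ₗ[F] F) {x y : V} (hx : f x = 0) (hy : f y = 0) :
    Submodule.span F {x} ⊔ Submodule.span F {y} ≤ LinearMap.ker f := by
  simp [sup_le_iff, Submodule.span_singleton_le_iff_mem, hx, hy]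

theorem smul_add_smul_mem_span_pair (x y : V) (p q : F) :
    p • x + q • y ∈ Submodule.span F {x} ⊔ Submodule.span F {y} :=
  Submodule.add_mem_sup (Submodule.smul_mem _ _ (Submodule.mem_span_singleton_self x))
    (Submodule.smul_mem _ _ (Submodule.mem_span_singleton_self y))

variable (b : Module.Basis (Fin d) F V) {i j k : Fin d}

theorem frameCoord_zero : frameCoord b i j 0 = basisFrame b j j := by
  rw [frameCoord, basisFrame_self, zero_smul, sub_zero]

theorem frameCoord_one (hij : i ≠ j) : frameCoord b i j 1 = basisFrame b i j := by
  rw [frameCoord, basisFrame_of_ne b hij, one_smul]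

/-- Elimination of `b j`: `(b k - s • b j) + s • (b j - r • b i) = b k - (s * r) • b i`. -/
theorem frameCoord_mul (hij : i ≠ j) (hjk : j ≠ k) (r s : F) :
    (frameCoord b j k s ⊔ frameCoord b i j r) ⊓ (basisFrame b k k ⊔ basisFrame b i i) =
      frameCoord b i k (s * r) := by
  rw [basisFrame_self, basisFrame_self]
  refine span_pair_inf_eq (b.coord j) (span_pair_le_ker _ ?_ ?_) (p := 1) (q := s) ?_ one_ne_zero ?_ ?_
  · simp [hjk.symm]
  · simp [hij]
  · rw [one_smul, smul_sub, smul_smul]; abel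
  · convert smul_add_smul_mem_span_pair (b k) (b i) (1 : F) (-(s * r)) using 1
    rw [one_smul, neg_smul, sub_eq_add_neg]
  · simp [hij]

/-- Elimination of `b i`: `(b j - r • b i) - r • (b k - b i) = b j - r • b k`. -/
theorem frameCoord_swap_left (hij : i ≠ j) (hik : i ≠ k) (r : F) :
    (frameCoord b i j r ⊔ basisFrame b i k) ⊓ (basisFrame b j j ⊔ basisFrame b k k) =
      frameCoord b k j r := by
  rw [basisFrame_self, basisFrame_self, basisFrame_of_ne b hik]
  refine span_pair_inf_eq (b.coord i) (span_pair_le_ker _ ?_ ?_) (p := 1) (q := -r) ?_ one_ne_zero ?_ ?_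
  · simp [hij.symm]
  · simp [hik.symm]
  · rw [one_smul, neg_smul, smul_sub]; abel
  · convert smul_add_smul_mem_span_pair (b j) (b k) (1 : F) (-r) using 1
    rw [one_smul, neg_smul, sub_eq_add_neg]
  · simp [hik.symm]

/-- An auxiliary point outside the plane of `b i` and `b j`, from which both addition and negation
are obtained by projection. -/
theorem frameCoord_shift (hij : i ≠ j) (hjk : j ≠ k) (hik : i ≠ k) (r : F) :
    (frameCoord b i j r ⊔ basisFrame b k k) ⊓ (basisFrame b k j ⊔ basisFrame b i i) =
      Submodule.span F {b j - r • b i - b k} := by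
  rw [basisFrame_self, basisFrame_self, basisFrame_of_ne b hjk.symm]
  refine span_pair_inf_eq (b.coord j + b.coord k) (span_pair_le_ker _ ?_ ?_) (p := 1) (q := -1) ?_
    one_ne_zero ?_ ?_
  · simp [hjk, hjk.symm]
  · simp [hij, hik]
  · rw [one_smul, neg_smul, one_smul]; abel
  · convert smul_add_smul_mem_span_pair (b j - b k) (b i) (1 : F) (-r) using 1
    rw [one_smul, neg_smul]; abel
  · simp [hjk.symm]

/-- Elimination of `b k`: `(b j - r • b i - b k) + (b k - s • b i) = b j - (r + s) • b i`. -/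
theorem frameCoord_add (hjk : j ≠ k) (hik : i ≠ k) (r s : F) :
    (Submodule.span F {b j - r • b i - b k} ⊔ frameCoord b i k s) ⊓
      (basisFrame b j j ⊔ basisFrame b i i) = frameCoord b i j (r + s) := by
  rw [basisFrame_self, basisFrame_self]
  refine span_pair_inf_eq (b.coord k) (span_pair_le_ker _ ?_ ?_) (p := 1) (q := 1) ?_
    one_ne_zero ?_ ?_
  · simp [hjk]
  · simp [hik]
  · rw [one_smul, one_smul, add_smul]; abel
  · convert smul_add_smul_mem_span_pair (b j) (b i) (1 : F) (-(r + s)) using 1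
    rw [one_smul, neg_smul, sub_eq_add_neg]
  · simp [hik]

/-- Elimination of `b j`: `b j - (b j - r • b i - b k) = b k + r • b i`. -/
theorem frameCoord_neg (hij : i ≠ j) (hjk : j ≠ k) (r : F) :
    (Submodule.span F {b j - r • b i - b k} ⊔ basisFrame b j j) ⊓
      (basisFrame b k k ⊔ basisFrame b i i) = frameCoord b i k (-r) := by
  rw [basisFrame_self, basisFrame_self, basisFrame_self]
  refine span_pair_inf_eq (b.coord j) (span_pair_le_ker _ ?_ ?_) (p := -1) (q := 1) ?_
    (by simp) ?_ ?_
  · simp [hjk.symm]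
  · simp [hij]
  · rw [neg_smul, one_smul, neg_smul, one_smul, sub_neg_eq_add]; abel
  · convert smul_add_smul_mem_span_pair (b k) (b i) (1 : F) r using 1
    rw [one_smul, neg_smul]; abel
  · simp

-- A lattice term that tests whether `r = 0`, with the truth values `basisFrame b j j` and `⊥`.
open Classical in
theorem frameCoord_inf (hij : i ≠ j) (r : F) :
    frameCoord b i j r ⊓ basisFrame b j j = if r = 0 then basisFrame b j j else ⊥ := by
  split_ifs with h
  · rw [h, frameCoord_zero, inf_idem]
  · rw [basisFrame_self, frameCoord, ← disjoint_iff, Submodule.disjoint_span_singleton'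
      (b.ne_zero j), Submodule.mem_span_singleton]
    rintro ⟨c, hc⟩
    have h1 := congrArg (b.coord i) hc
    have h2 := congrArg (b.coord j) hc
    simp [hij.symm, hij] at h1 h2
    simp [h2, h] at h1

-- The opposite test: for `r ≠ 0` the join is the whole plane of `b i` and `b j`, whereas for `r =
-- 0` it is just the line of `b j`.
open Classical in
theorem frameCoord_sup_inf (hij : i ≠ j) (r : F) :
    (frameCoord b i j r ⊔ basisFrame b j j) ⊓ basisFrame b i i =
      if r = 0 then ⊥ else basisFrame b i i := by
  split_ifs with h
  · rw [h, frameCoord_zero, sup_idem, basisFrame_self, basisFrame_self, ← disjoint_iff,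
      Submodule.disjoint_span_singleton' (b.ne_zero i), Submodule.mem_span_singleton]
    rintro ⟨c, hc⟩
    have h1 := congrArg (b.coord i) hc
    simp [hij.symm] at h1
  · rw [inf_eq_right, basisFrame_self, Submodule.span_singleton_le_iff_mem, frameCoord,
      basisFrame_self]
    convert smul_add_smul_mem_span_pair (b j - r • b i) (b j) (-r⁻¹) r⁻¹ using 1
    rw [neg_smul, smul_sub, smul_smul, inv_mul_cancel₀ h, one_smul]
    abel

-- For `r ≠ 0`, the vectors `b j - r • b i` and `b i - r⁻¹ • b j` are proportional, so inversion
-- only exchanges the indices. For `r = 0` the tests remove the line of `b j` and put in that of `b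
-- i`, which has coordinate `0 = 0⁻¹`.
open Classical in
theorem frameCoord_inv (r : F) :
    frameCoord b i j r ⊓ ((if r ≠ 0 then basisFrame b i i else ⊥) ⊔
      if r ≠ 0 then basisFrame b j j else ⊥) ⊔ (if r = 0 then basisFrame b i i else ⊥) =
      frameCoord b j i r⁻¹ := by
  by_cases h : r = 0
  · simp [h, frameCoord_zero]
  · have h1 : frameCoord b i j r ≤ basisFrame b i i ⊔ basisFrame b j j := by
      rw [frameCoord, basisFrame_self, basisFrame_self, Submodule.span_singleton_le_iff_mem]
      convert smul_add_smul_mem_span_pair (b i) (b j) (-r) 1 using 1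
      rw [neg_smul, one_smul]; abel
    simp only [h, ne_eq, not_false_eq_true, if_true, if_false, sup_bot_eq, inf_eq_left.2 h1]
    have : b i - r⁻¹ • b j = (-r⁻¹) • (b j - r • b i) := by
      rw [smul_sub, smul_smul, neg_mul, inv_mul_cancel₀ h, neg_smul, neg_smul, one_smul]; abel
    rw [frameCoord, frameCoord, this,
      Submodule.span_singleton_smul_eq (IsUnit.mk0 _ (neg_ne_zero.2 (inv_ne_zero h)))]

/-- The member for `l` is the hyperplane of all vectors whose `l`-th coordinate is `x l` times the
`p`-th one. Together these equations leave only multiples of `x`, because `x p = 1`. -/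
theorem iInf_frameCoord_sup (p : Fin d) {x : Fin d → F} (hx : x p = 1) :
    (⨅ l : {l // l ≠ p}, frameCoord b l p (-x l) ⊔
        ⨆ m : {m // m ≠ p ∧ m ≠ l}, basisFrame b m m) = Submodule.span F {∑ l, x l • b l} := by
  apply le_antisymm
  · intro y hy
    rw [Submodule.mem_span_singleton]
    refine ⟨b.coord p y, ?_⟩
    refine b.ext_elem fun l => ?_
    change b.coord l _ = b.coord l y
    have h1 : b.coord l (∑ l, x l • b l) = x l := by simp [coord_basis, -Module.Basis.coord_apply]
    rw [map_smul, h1, smul_eq_mul]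
    by_cases hl : l = p
    · rw [hl, hx, mul_one]
    · have h2 := (Submodule.mem_iInf _).1 hy ⟨l, hl⟩
      have h3 : frameCoord b l p (-x l) ⊔ ⨆ m : {m // m ≠ p ∧ m ≠ l}, basisFrame b m m ≤
          LinearMap.ker (b.coord l - x l • b.coord p) := by
        rw [sup_le_iff, iSup_le_iff]
        constructor
        · rw [frameCoord, Submodule.span_singleton_le_iff_mem]
          simp [coord_basis, hl, Ne.symm hl, -Module.Basis.coord_apply]
        · rintro ⟨m, hm1, hm2⟩
          rw [basisFrame_self, Submodule.span_singleton_le_iff_mem]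
          simp [coord_basis, hm1, hm2, -Module.Basis.coord_apply]
      have h4 := h3 h2
      rw [LinearMap.mem_ker, LinearMap.sub_apply, sub_eq_zero] at h4
      rw [h4, LinearMap.smul_apply, smul_eq_mul, mul_comm]
  · rw [Submodule.span_singleton_le_iff_mem, Submodule.mem_iInf]
    rintro ⟨l, hl⟩
    have hs : ∑ m, x m • b m = (b p - (-x l) • b l) +
        ∑ m ∈ (Finset.univ.erase p).erase l, x m • b m := by
      rw [← Finset.add_sum_erase _ _ (Finset.mem_univ p),
        ← Finset.add_sum_erase (Finset.univ.erase p) _ (Finset.mem_erase.2 ⟨hl, Finset.mem_univ l⟩),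
        hx, one_smul, neg_smul]
      abel
    rw [hs]
    refine Submodule.add_mem_sup (Submodule.mem_span_singleton_self _)
      (Submodule.sum_mem _ fun m hm => Submodule.smul_mem _ _ ?_)
    rw [Finset.mem_erase, Finset.mem_erase] at hm
    refine Submodule.mem_iSup_of_mem ⟨m, hm.2.1, hm.1⟩ ?_
    rw [basisFrame_self]
    exact Submodule.mem_span_singleton_self _

/-- A member `α • x + β • y` of `X` differs from `β • z` by a multiple of `x`, which disjointness
forces to vanish. -/
theorem eq_span_of_disjoint {X : Submodule F V} {x y z : V}
    (hX : X ≤ Submodule.span F {x} ⊔ Submodule.span F {y}) (hd : Disjoint X (Submodule.span F {x}))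
    {c : F} (hz : z = y - c • x) (hzX : z ∈ X) : X = Submodule.span F {z} := by
  refine le_antisymm (fun w hw => ?_) ((Submodule.span_singleton_le_iff_mem _ _).2 hzX)
  obtain ⟨w1, hw1, w2, hw2, rfl⟩ := Submodule.mem_sup.1 (hX hw)
  obtain ⟨α, rfl⟩ := Submodule.mem_span_singleton.1 hw1
  obtain ⟨β, rfl⟩ := Submodule.mem_span_singleton.1 hw2
  have h1 : α • x + β • y - β • z ∈ X := X.sub_mem hw (X.smul_mem _ hzX)
  have h2 : α • x + β • y - β • z = (α + β * c) • x := by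
    rw [hz, smul_sub, smul_smul, add_smul]; abel
  have h3 := Submodule.disjoint_def.1 hd _ h1
    (h2 ▸ Submodule.smul_mem _ _ (Submodule.mem_span_singleton_self x))
  rw [sub_eq_zero.1 h3]
  exact Submodule.smul_mem _ _ (Submodule.mem_span_singleton_self z)

/-- Conversely, if `X` is a complement of the line of `b i` in the plane, write `b j` as a member of
`X` plus `r • b i`; this `r` is the coordinate. The right side is expressible in the lattice, so it
can serve to bound quantifiers over field elements. -/
theorem exists_eq_frameCoord_iff (hij : i ≠ j) {X : Submodule F V} :
    (∃ r, X = frameCoord b i j r) ↔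
      X ⊔ basisFrame b i i = basisFrame b i i ⊔ basisFrame b j j ∧ Disjoint X (basisFrame b i i) := by
  rw [basisFrame_self, basisFrame_self]
  constructor
  · rintro ⟨r, rfl⟩
    rw [frameCoord]
    constructor
    · apply le_antisymm
      · rw [sup_le_iff]
        refine ⟨?_, le_sup_left⟩
        rw [Submodule.span_singleton_le_iff_mem]
        convert smul_add_smul_mem_span_pair (b i) (b j) (-r) 1 using 1
        rw [neg_smul, one_smul]; abel
      · rw [sup_le_iff]
        refine ⟨le_sup_right, ?_⟩
        rw [Submodule.span_singleton_le_iff_mem]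
        convert smul_add_smul_mem_span_pair (b j - r • b i) (b i) 1 r using 1
        rw [one_smul]; abel
    · rw [Submodule.disjoint_span_singleton' (b.ne_zero i), Submodule.mem_span_singleton]
      rintro ⟨c, hc⟩
      have h1 := congrArg (b.coord i) hc
      have h2 := congrArg (b.coord j) hc
      simp [hij.symm, hij] at h1 h2
      simp [h2] at h1
  · rintro ⟨h1, h2⟩
    have h3 : b j ∈ X ⊔ Submodule.span F {b i} := by
      rw [h1]
      exact Submodule.mem_sup_right (Submodule.mem_span_singleton_self _)
    obtain ⟨x, hx, y, hy, hxy⟩ := Submodule.mem_sup.1 h3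
    obtain ⟨r, rfl⟩ := Submodule.mem_span_singleton.1 hy
    have hx' : x = b j - r • b i := by rw [← hxy]; abel
    exact ⟨r, by rw [frameCoord, ← hx']
                 exact eq_span_of_disjoint (h1 ▸ le_sup_left) h2 hx' hx⟩

theorem iSupIndep_basisFrame : iSupIndep fun i => basisFrame b i i := by
  have := b.linearIndependent.iSupIndep_span_singleton
  convert this using 2 with i
  exact basisFrame_self b i

theorem iSup_basisFrame : ⨆ i, basisFrame b i i = ⊤ := by
  simp only [basisFrame_self]
  rw [← Submodule.span_range_eq_iSup, b.span_eq]

theorem isFrame_basisFrame : IsFrame (basisFrame b) where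
  indep := iSupIndep_basisFrame b
  sup_eq_top := iSup_basisFrame b
  symm i j h := by
    rw [basisFrame_of_ne b h, basisFrame_of_ne b h.symm, ← neg_sub, ← Set.neg_singleton,
      Submodule.span_neg]
  sup_eq i j h := by
    have := ((exists_eq_frameCoord_iff b h).1 ⟨1, rfl⟩).1
    rw [← this, frameCoord_one b h, sup_comm]
  disjoint i j h := by
    have := ((exists_eq_frameCoord_iff b h).1 ⟨1, rfl⟩).2
    rw [frameCoord_one b h] at this
    exact this.symm
  comp i j k hij hjk hik := by
    have := frameCoord_mul b hij hjk 1 1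
    rw [frameCoord_one b hij, frameCoord_one b hjk, mul_one, frameCoord_one b hik] at this
    rw [← this, inf_comm, sup_comm (basisFrame b k k), sup_comm (basisFrame b j k)]

end FrameGeometry

/-- A nonzero vector `v` of `a z z` fixes all scales: the axis `a z j` singles out the vector of `a
j j` corresponding to `v`. Independence and the dimension then make these vectors a basis, and the
composition law for frames fixes the remaining `a i j`. -/
theorem IsFrame.exists_basis {F : Type*} [Field F] {V : Type*} [AddCommGroup V] [Module F V] {d : ℕ}
    {a : Fin d → Fin d → Submodule F V} (ha : IsFrame a) (hd : 0 < d) (hV : Module.finrank F V = d) :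
    ∃ b : Module.Basis (Fin d) F V, a = basisFrame b := by
  let z : Fin d := ⟨0, hd⟩
  -- If `a z z` were zero, perspectivity would annihilate every `a j j`, contradicting `d > 0`.
  have hbot : a z z ≠ ⊥ := by
    intro hz
    have h1 : ∀ j, a j j = ⊥ := by
      intro j
      by_cases h : z = j
      · rw [← h, hz]
      · have h2 := ha.sup_eq z j h
        rw [hz, bot_sup_eq, bot_sup_eq, ha.symm z j h] at h2
        have h3 := ha.disjoint j z (Ne.symm h)
        rwa [← h2, disjoint_self] at h3
    have h2 := ha.sup_eq_top
    simp only [h1, iSup_bot] at h2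
    have h3 : Module.finrank F (⊤ : Submodule F V) = 0 := by rw [← h2, finrank_bot]
    rw [finrank_top, hV] at h3
    omega
  obtain ⟨v, hv, hv0⟩ := Submodule.exists_mem_ne_zero_of_ne_bot hbot
  -- Decomposing `v` in `a j j ⊔ a z j` yields its image `w` in `a j j`, with `w - v` in `a z j`.
  have hw : ∀ j, ∃ w ∈ a j j, w ≠ 0 ∧ (j = z → w = v) ∧ (z ≠ j → w - v ∈ a z j) := by
    intro j
    by_cases hj : j = z
    · subst hj
      exact ⟨v, hv, hv0, fun _ => rfl, fun h => absurd rfl h⟩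
    · have h1 : v ∈ a j j ⊔ a z j := by
        rw [ha.symm z j (Ne.symm hj), ← ha.sup_eq j z hj]
        exact Submodule.mem_sup_right hv
      obtain ⟨w, hw, y, hy, hwy⟩ := Submodule.mem_sup.1 h1
      refine ⟨w, hw, ?_, fun h => absurd h hj, fun _ => ?_⟩
      · rintro rfl
        rw [zero_add] at hwy
        exact hv0 (Submodule.disjoint_def.1 (ha.disjoint z j (Ne.symm hj)) v hv (hwy ▸ hy))
      · rw [← hwy, sub_add_cancel_left]
        exact (a z j).neg_mem hy
  choose w hwa hw0 hwz hwv using hw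
  have : Nonempty (Fin d) := ⟨z⟩
  let b := basisOfLinearIndependentOfCardEqFinrank (ha.indep.linearIndependent _ hwa hw0)
    (by rw [Fintype.card_fin, hV])
  have hb : ⇑b = w := coe_basisOfLinearIndependentOfCardEqFinrank _ _
  refine ⟨b, frameBasis_iff.1 ?_⟩
  have hself : ∀ i, a i i = Submodule.span F {w i} := by
    intro i
    refine le_antisymm (fun x hx => ?_) ((Submodule.span_singleton_le_iff_mem _ _).2 (hwa i))
    have hs := b.sum_repr x
    rw [← Finset.add_sum_erase _ _ (Finset.mem_univ i), hb] at hs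
    have h1 : x - b.repr x i • w i ∈ a i i := (a i i).sub_mem hx ((a i i).smul_mem _ (hwa i))
    have h2 : x - b.repr x i • w i ∈ ⨆ j, ⨆ (_ : j ≠ i), a j j := by
      nth_rw 1 [← hs]
      rw [add_sub_cancel_left]
      refine Submodule.sum_mem _ fun j hj => Submodule.smul_mem _ _ ?_
      exact Submodule.mem_iSup_of_mem j
        (Submodule.mem_iSup_of_mem (Finset.ne_of_mem_erase hj) (hwa j))
    have h3 := Submodule.disjoint_def.1 (ha.indep i) _ h1 h2
    rw [sub_eq_zero.1 h3]
    exact Submodule.smul_mem _ _ (Submodule.mem_span_singleton_self _)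
  refine ⟨fun i => by rw [hself, hb], fun i j hij => ?_⟩
  rw [hb]
  refine eq_span_of_disjoint (x := w i) (y := w j) (c := 1) ?_ ?_ (by rw [one_smul]) ?_
  · rw [← hself, ← hself, ha.sup_eq i j hij]
    exact le_sup_right
  · rw [← hself]
    exact (ha.disjoint i j hij).symm
  · by_cases hi : i = z
    · subst hi
      rw [hwz _ rfl]
      exact hwv j hij
    · have h1 : v - w i ∈ a i z := by
        rw [ha.symm i z hi, ← neg_sub]
        exact Submodule.neg_mem _ (hwv i (Ne.symm hi))
      by_cases hj : j = z
      · subst hj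
        rw [hwz _ rfl]
        exact h1
      -- Composition through `z`: `w j - w i = (v - w i) + (w j - v)`.
      · rw [ha.comp i z j hi (Ne.symm hj) hij]
        refine ⟨Submodule.sub_mem _ (Submodule.mem_sup_right (hwa j))
          (Submodule.mem_sup_left (hwa i)), ?_⟩
        rw [← sub_add_sub_cancel' v (w i) (w j)]
        exact Submodule.add_mem_sup h1 (hwv j (Ne.symm hj))

/-! ### Rational functions and quantifier free conditions, uniformly in the field -/

section RationalFunctions

/-- Functions on all fields at once. -/
abbrev FunFam (ν : Type) : Type (u + 1) := ∀ (F : Type u) [Field F], (ν → F) → F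

variable {ν : Type}

/-- Functions given by terms in the language of rings with inversion. -/
inductive IsRat : FunFam.{u} ν → Prop
  | var (x : ν) : IsRat fun _ _ r => r x
  | zero : IsRat fun _ _ _ => 0
  | one : IsRat fun _ _ _ => 1
  | add {f g : FunFam.{u} ν} (hf : IsRat f) (hg : IsRat g) : IsRat fun F _ r => f F r + g F r
  | mul {f g : FunFam.{u} ν} (hf : IsRat f) (hg : IsRat g) : IsRat fun F _ r => f F r * g F r
  | neg {f : FunFam.{u} ν} (hf : IsRat f) : IsRat fun F _ r => -f F r
  | inv {f : FunFam.{u} ν} (hf : IsRat f) : IsRat fun F _ r => (f F r)⁻¹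

/-- Relations which are Boolean combinations of equations between rational functions. -/
inductive IsRatQF : PredFam.{u} ν → Prop
  | eqn {f : FunFam.{u} ν} (hf : IsRat f) : IsRatQF fun F _ r => f F r = 0
  | not {P : PredFam.{u} ν} (hP : IsRatQF P) : IsRatQF fun F _ r => ¬ P F r
  | and {P Q : PredFam.{u} ν} (hP : IsRatQF P) (hQ : IsRatQF Q) : IsRatQF fun F _ r => P F r ∧ Q F r

theorem IsRat.congr {f g : FunFam.{u} ν} (hf : IsRat f)
    (h : ∀ (F : Type u) [Field F] (r : ν → F), f F r = g F r) : IsRat g := by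
  have : f = g := by
    funext F _ r
    exact h F r
  rwa [← this]

namespace IsRatQF

theorem congr {P Q : PredFam.{u} ν} (hP : IsRatQF P)
    (h : ∀ (F : Type u) [Field F] (r : ν → F), P F r ↔ Q F r) : IsRatQF Q := by
  have : P = Q := by
    funext F _ r
    exact propext (h F r)
  rwa [← this]

theorem true : IsRatQF.{u} fun _ _ (_ : ν → _) => True :=
  (IsRatQF.eqn .zero).congr fun _ _ _ => by simp

theorem or {P Q : PredFam.{u} ν} (hP : IsRatQF P) (hQ : IsRatQF Q) :
    IsRatQF fun F _ r => P F r ∨ Q F r :=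
  (hP.not.and hQ.not).not.congr fun F _ r => by tauto

theorem imp {P Q : PredFam.{u} ν} (hP : IsRatQF P) (hQ : IsRatQF Q) :
    IsRatQF fun F _ r => P F r → Q F r :=
  (hP.and hQ.not).not.congr fun F _ r => by tauto

theorem eq {f g : FunFam.{u} ν} (hf : IsRat f) (hg : IsRat g) :
    IsRatQF fun F _ r => f F r = g F r :=
  (IsRatQF.eqn (hf.add hg.neg)).congr fun F _ r => by rw [← sub_eq_add_neg, sub_eq_zero]

theorem forall_finite {ι : Type} [Finite ι] {P : ι → PredFam.{u} ν} (hP : ∀ i, IsRatQF (P i)) :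
    IsRatQF fun F _ r => ∀ i, P i F r := by
  classical
  have := Fintype.ofFinite ι
  suffices h : ∀ s : Finset ι, IsRatQF fun F _ r => ∀ i ∈ s, P i F r from
    (h Finset.univ).congr fun F _ r => by simp
  intro s
  induction s using Finset.induction_on with
  | empty => exact IsRatQF.true.congr fun F _ r => by simp
  | insert i s _ ih => exact ((hP i).and ih).congr fun F _ r => by simp

theorem exists_finite {ι : Type} [Finite ι] {P : ι → PredFam.{u} ν} (hP : ∀ i, IsRatQF (P i)) :
    IsRatQF fun F _ r => ∃ i, P i F r :=
  (forall_finite fun i => (hP i).not).not.congr fun F _ r => by simp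

end IsRatQF

theorem IsRat.subst {σ : Type} {f : FunFam.{u} σ} (hf : IsRat f) {U : σ → FunFam.{u} ν}
    (hU : ∀ x, IsRat (U x)) : IsRat fun F _ r => f F fun x => U x F r := by
  induction hf with
  | var x => exact hU x
  | zero => exact .zero
  | one => exact .one
  | add _ _ ih ih' => exact ih.add ih'
  | mul _ _ ih ih' => exact ih.mul ih'
  | neg _ ih => exact ih.neg
  | inv _ ih => exact ih.inv

theorem IsRatQF.subst {σ : Type} {P : PredFam.{u} σ} (hP : IsRatQF P) {U : σ → FunFam.{u} ν}
    (hU : ∀ x, IsRat (U x)) : IsRatQF fun F _ r => P F fun x => U x F r := by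
  induction hP with
  | eqn hf => exact .eqn (hf.subst hU)
  | not _ ih => exact ih.not
  | and _ _ ih ih' => exact ih.and ih'

theorem isRat_sum {ι : Type} (s : Finset ι) {f : ι → FunFam.{u} ν} (hf : ∀ i, IsRat (f i)) :
    IsRat fun F _ r => ∑ i ∈ s, f i F r := by
  classical
  induction s using Finset.induction_on with
  | empty => exact IsRat.zero.congr fun F _ r => by simp
  | insert i s hi ih => exact ((hf i).add ih).congr fun F _ r => by rw [Finset.sum_insert hi]

theorem isRat_prod {ι : Type} (s : Finset ι) {f : ι → FunFam.{u} ν} (hf : ∀ i, IsRat (f i)) :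
    IsRat fun F _ r => ∏ i ∈ s, f i F r := by
  classical
  induction s using Finset.induction_on with
  | empty => exact IsRat.one.congr fun F _ r => by simp
  | insert i s hi ih => exact ((hf i).mul ih).congr fun F _ r => by rw [Finset.prod_insert hi]

theorem isRat_intCast (n : ℤ) : IsRat.{u} fun F _ (_ : ν → F) => (n : F) := by
  induction n using Int.induction_on with
  | zero => exact IsRat.zero.congr fun F _ r => by simp
  | succ n ih => exact (ih.add .one).congr fun F _ r => by push_cast; rfl
  | pred n ih => exact (ih.add IsRat.one.neg).congr fun F _ r => by push_cast; ring

theorem isRat_aeval (p : MvPolynomial ν ℤ) :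
    IsRat.{u} fun F _ r => MvPolynomial.aeval (R := ℤ) (S₁ := F) r p := by
  induction p using MvPolynomial.induction_on with
  | C n => exact (isRat_intCast n).congr fun F _ r => by simp
  | add p q hp hq => exact (hp.add hq).congr fun F _ r => by rw [map_add]
  | mul_X p i hp => exact (hp.mul (.var i)).congr fun F _ r => by rw [map_mul, MvPolynomial.aeval_X]

theorem isRat_minors {d k : ℕ} {c : Fin k → Fin d → FunFam.{u} ν} (hc : ∀ j i, IsRat (c j i))
    (I : PlIdx d k) : IsRat fun F _ r => minors (fun j i => c j i F r) id I := by
  refine (isRat_sum Finset.univ fun g : Equiv.Perm (Fin k) =>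
    (isRat_intCast (Equiv.Perm.sign g : ℤ)).mul
      (isRat_prod Finset.univ fun j => hc j (I (g j)))).congr fun F _ r => ?_
  rw [minors, Matrix.det_apply']
  rfl

theorem isRat_ringEval {σ : Type*} (t : Language.ring.Term σ) {U : σ → FunFam.{u} ν}
    (hU : ∀ x, IsRat (U x)) : IsRat fun F _ r => ringEval t fun x => U x F r := by
  induction t with
  | var x => exact hU x
  | func f ts ih =>
    cases f with
    | add => exact (ih 0).add (ih 1)
    | mul => exact (ih 0).mul (ih 1)
    | neg => exact (ih 0).neg
    | zero => exact .zero
    | one => exact .one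

/-- Validity of a ring formula with free and bound variables. -/
def RingRealize {F : Type*} [Field F] {σ : Type*} {n : ℕ} (χ : Language.ring.BoundedFormula σ n)
    (r : σ → F) (xs : Fin n → F) : Prop :=
  letI := Ring.compatibleRingOfRing F
  χ.Realize r xs

theorem ringHolds_iff {F : Type*} [Field F] {σ : Type*} {χ : Language.ring.Formula σ} {r : σ → F}
    (xs : Fin 0 → F) : RingHolds χ r ↔ RingRealize χ r xs := by
  rw [Subsingleton.elim xs default]
  exact Iff.rfl

theorem isRatQF_equal {σ : Type*} {n : ℕ} {U : σ → FunFam.{u} ν} {X : Fin n → FunFam.{u} ν}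
    (hU : ∀ x, IsRat (U x)) (hX : ∀ x, IsRat (X x)) (t s : Language.ring.Term (σ ⊕ Fin n)) :
    IsRatQF fun F _ r => RingRealize (t.bdEqual s) (fun x => U x F r) fun x => X x F r := by
  have hUX : ∀ x, IsRat (Sum.elim U X x) := fun x => by cases x; exacts [hU _, hX _]
  refine (IsRatQF.eq (isRat_ringEval t hUX) (isRat_ringEval s hUX)).congr fun F _ r => ?_
  have : (fun x => Sum.elim U X x F r) = Sum.elim (fun x => U x F r) fun x => X x F r := by
    funext x; cases x <;> rfl
  rw [this]
  let _ := Ring.compatibleRingOfRing F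
  exact (BoundedFormula.realize_bdEqual t s).symm

theorem isRatQF_ringRealize {σ : Type*} {n : ℕ} {χ : Language.ring.BoundedFormula σ n}
    (hχ : χ.IsQF) {U : σ → FunFam.{u} ν} {X : Fin n → FunFam.{u} ν}
    (hU : ∀ x, IsRat (U x)) (hX : ∀ x, IsRat (X x)) :
    IsRatQF fun F _ r => RingRealize χ (fun x => U x F r) fun x => X x F r := by
  induction hχ with
  | falsum => exact IsRatQF.true.not.congr fun _ _ _ => ⟨fun h => h trivial, fun h => h.elim⟩
  | of_isAtomic h =>
    cases h with
    | equal t s => exact isRatQF_equal hU hX t s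
    | rel R => cases R
  | imp _ _ ih ih' => exact ih.imp ih'

/-- The value of a term in the language of rings with inversion. -/
def ringInvEval {F : Type*} [Field F] {σ : Type*} (t : ringInvLang.Term σ) (r : σ → F) : F :=
  letI := ringInvStructure F
  t.realize r

theorem isRat_ringInvEval (t : ringInvLang.Term ν) : IsRat.{u} fun F _ r => ringInvEval t r := by
  induction t with
  | var x => exact .var x
  | func f ts ih =>
    cases f with
    | add => exact (ih 0).add (ih 1)
    | mul => exact (ih 0).mul (ih 1)
    | neg => exact (ih 0).neg
    | inv => exact (ih 0).inv
    | zero => exact .zero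
    | one => exact .one

theorem isRatQF_ringInvHolds {φ : ringInvLang.Formula ν} (hφ : φ.IsQF) :
    IsRatQF.{u} fun F _ r => RingInvHolds φ r := by
  suffices h : ∀ (n : ℕ) (φ : ringInvLang.BoundedFormula ν n), φ.IsQF → n = 0 →
      IsRatQF.{u} fun F _ r => letI := ringInvStructure F; ∀ xs : Fin n → F, φ.Realize r xs from
    (h 0 φ hφ rfl).congr fun F _ r => ⟨fun h => h _, fun h xs => by
      rw [Subsingleton.elim xs default]; exact h⟩
  intro n φ hφ hn
  subst hn
  induction hφ with
  | falsum =>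
    exact IsRatQF.true.not.congr fun _ _ _ => ⟨fun h => absurd trivial h, fun h => (h default).elim⟩
  | of_isAtomic h =>
    cases h with
    | equal t s =>
      refine (IsRatQF.eq (isRat_ringInvEval (t.relabel (Sum.elim id Fin.elim0)))
        (isRat_ringInvEval (s.relabel (Sum.elim id Fin.elim0)))).congr fun F _ r => ?_
      let _ := ringInvStructure F
      have : ∀ xs : Fin 0 → F, Sum.elim r xs = r ∘ Sum.elim id Fin.elim0 := fun xs => by
        funext x
        rcases x with x | x
        · rfl
        · exact x.elim0
      simp only [ringInvEval, Term.realize_relabel, BoundedFormula.realize_bdEqual, this,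
        forall_const]
    | rel R => exact R.elim
  | imp _ _ ih ih' =>
    refine (ih.imp ih').congr fun F _ r => ⟨fun h xs h' => ?_, fun h h' xs => h xs (h' xs)⟩
    rw [Subsingleton.elim xs default] at h' ⊢
    exact h (fun xs => by rw [Subsingleton.elim xs default]; exact h') _

end RationalFunctions

/-! ### Lattice terms computing in the field of a frame -/

section LatticeTerms

variable {d : ℕ} {ν : Type}

/-- Subspaces depending on a basis and on parameters from the field, for all fields and vector
spaces at once. -/
abbrev LatFam (d : ℕ) (ν : Type) : Type (max u v + 1) :=
  ∀ (F : Type u) (V : Type v) [Field F] [AddCommGroup V] [Module F V],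
    Module.Basis (Fin d) F V → (ν → F) → Submodule F V

/-- The elements of the frame of a basis together with the elements of its field `R_21` which
have given coordinates. -/
def frameVal (hd : 3 ≤ d) {F V : Type*} [Field F] [AddCommGroup V] [Module F V]
    (b : Module.Basis (Fin d) F V) (r : ν → F) : (Fin d × Fin d) ⊕ ν → Submodule F V :=
  Sum.elim (fun x => basisFrame b x.1 x.2)
    fun k => frameCoord b ⟨1, by omega⟩ ⟨0, by omega⟩ (r k)

/-- Subspaces given by lattice terms in the elements of a frame and of its field. -/
def IsLatTerm (hd : 3 ≤ d) (E : LatFam.{u, v} d ν) : Prop :=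
  ∃ t : latLang.Term ((Fin d × Fin d) ⊕ ν),
    ∀ (F : Type u) (V : Type v) [Field F] [AddCommGroup V] [Module F V]
      (b : Module.Basis (Fin d) F V) (r : ν → F), latEval t (frameVal hd b r) = E F V b r

/-- The join of lattice terms. -/
def latSup {β : Type*} (t s : latLang.Term β) : latLang.Term β :=
  Term.func (LatFunc.sup : latLang.Functions 2) ![t, s]

/-- The meet of lattice terms. -/
def latInf {β : Type*} (t s : latLang.Term β) : latLang.Term β :=
  Term.func (LatFunc.inf : latLang.Functions 2) ![t, s]

/-- The lattice term `0`. -/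
def latBot {β : Type*} : latLang.Term β := Term.func (LatFunc.bot : latLang.Functions 0) ![]

/-- The lattice term `1`. -/
def latTop {β : Type*} : latLang.Term β := Term.func (LatFunc.top : latLang.Functions 0) ![]

section Eval

variable {L : Type*} [Lattice L] [BoundedOrder L] {β : Type*} (t s : latLang.Term β) (w : β → L)

theorem latEval_sup : latEval (latSup t s) w = latEval t w ⊔ latEval s w := rfl

theorem latEval_inf : latEval (latInf t s) w = latEval t w ⊓ latEval s w := rfl

theorem latEval_bot : latEval latBot w = ⊥ := rfl

theorem latEval_top : latEval latTop w = ⊤ := rfl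

theorem latEval_relabel {γ : Type*} (f : γ → β) (t : latLang.Term γ) :
    latEval (t.relabel f) w = latEval t fun x => w (f x) :=
  letI := latStructure L
  Term.realize_relabel

end Eval

namespace IsLatTerm

variable {hd : 3 ≤ d} {E E' : LatFam.{u, v} d ν}

theorem congr (hE : IsLatTerm hd E)
    (h : ∀ (F : Type u) (V : Type v) [Field F] [AddCommGroup V] [Module F V]
      (b : Module.Basis (Fin d) F V) (r : ν → F), E F V b r = E' F V b r) : IsLatTerm hd E' := by
  obtain ⟨t, ht⟩ := hE
  exact ⟨t, fun F V _ _ _ b r => (ht F V b r).trans (h F V b r)⟩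

theorem sup (hE : IsLatTerm hd E) (hE' : IsLatTerm hd E') :
    IsLatTerm hd fun F V _ _ _ b r => E F V b r ⊔ E' F V b r := by
  obtain ⟨t, ht⟩ := hE
  obtain ⟨t', ht'⟩ := hE'
  exact ⟨latSup t t', fun F V _ _ _ b r => by rw [latEval_sup, ht, ht']⟩

theorem inf (hE : IsLatTerm hd E) (hE' : IsLatTerm hd E') :
    IsLatTerm hd fun F V _ _ _ b r => E F V b r ⊓ E' F V b r := by
  obtain ⟨t, ht⟩ := hE
  obtain ⟨t', ht'⟩ := hE'
  exact ⟨latInf t t', fun F V _ _ _ b r => by rw [latEval_inf, ht, ht']⟩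

variable (hd)

theorem bot : IsLatTerm hd fun F V _ _ _ _ (_ : ν → F) => (⊥ : Submodule F V) :=
  ⟨latBot, fun _ _ _ _ _ _ _ => rfl⟩

theorem top : IsLatTerm hd fun F V _ _ _ _ (_ : ν → F) => (⊤ : Submodule F V) :=
  ⟨latTop, fun _ _ _ _ _ _ _ => rfl⟩

theorem frame (i j : Fin d) : IsLatTerm hd fun F _ _ _ _ b (_ : ν → F) => basisFrame b i j :=
  ⟨Term.var (Sum.inl (i, j)), fun _ _ _ _ _ _ _ => rfl⟩

variable {hd}

theorem iSup_finite {ι : Type} [Finite ι] {E : ι → LatFam.{u, v} d ν}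
    (hE : ∀ i, IsLatTerm hd (E i)) : IsLatTerm hd fun F V _ _ _ b r => ⨆ i, E i F V b r := by
  classical
  have := Fintype.ofFinite ι
  suffices h : ∀ s : Finset ι, IsLatTerm hd fun F V _ _ _ b r => ⨆ i ∈ s, E i F V b r from
    (h Finset.univ).congr fun F V _ _ _ b r => by simp
  intro s
  induction s using Finset.induction_on with
  | empty => exact (bot hd).congr fun F V _ _ _ b r => by simp
  | insert i s _ ih => exact ((hE i).sup ih).congr fun F V _ _ _ b r => by rw [Finset.iSup_insert]

theorem iInf_finite {ι : Type} [Finite ι] {E : ι → LatFam.{u, v} d ν}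
    (hE : ∀ i, IsLatTerm hd (E i)) : IsLatTerm hd fun F V _ _ _ b r => ⨅ i, E i F V b r := by
  classical
  have := Fintype.ofFinite ι
  suffices h : ∀ s : Finset ι, IsLatTerm hd fun F V _ _ _ b r => ⨅ i ∈ s, E i F V b r from
    (h Finset.univ).congr fun F V _ _ _ b r => by simp
  intro s
  induction s using Finset.induction_on with
  | empty => exact (top hd).congr fun F V _ _ _ b r => by simp
  | insert i s _ ih => exact ((hE i).inf ih).congr fun F V _ _ _ b r => by rw [Finset.iInf_insert]

end IsLatTerm

/-- The constructions of the field operations need an auxiliary index; this is where `d ≥ 3` enters.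
-/
theorem exists_ne_ne (hd : 3 ≤ d) (i j : Fin d) : ∃ k, k ≠ i ∧ k ≠ j := by
  have : ({i, j} : Finset (Fin d)).card < Fintype.card (Fin d) := by
    have := Finset.card_le_two (a := i) (b := j)
    rw [Fintype.card_fin]
    omega
  obtain ⟨k, -, hk⟩ := Finset.exists_mem_notMem_of_card_lt_card
    (s := {i, j}) (t := (Finset.univ : Finset (Fin d))) (by rwa [Finset.card_univ])
  exact ⟨k, by simpa using hk⟩

/-- Functions whose values are given by lattice terms in all the fields `R_ji` of a frame. -/
def IsCoordTerm (hd : 3 ≤ d) (f : FunFam.{u} ν) : Prop :=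
  ∀ i j, i ≠ j → IsLatTerm.{u, v} hd fun F _ _ _ _ b r => frameCoord b i j (f F r)

/-- The coordinate fields of different index pairs are related by perspectivities. The upper index
is changed by multiplication with `1`, the lower one by `frameCoord_swap_left`; a third index
connects any two pairs. -/
theorem isCoordTerm_of_exists {hd : 3 ≤ d} {f : FunFam.{u} ν} {i j : Fin d} (hij : i ≠ j)
    (h : IsLatTerm.{u, v} hd fun F _ _ _ _ b r => frameCoord b i j (f F r)) :
    IsCoordTerm.{u, v} hd f := by
  have right : ∀ i j k, i ≠ j → i ≠ k →
      IsLatTerm.{u, v} hd (fun F _ _ _ _ b r => frameCoord b i j (f F r)) →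
      IsLatTerm.{u, v} hd fun F _ _ _ _ b r => frameCoord b i k (f F r) := by
    intro i j k hij hik h
    by_cases hjk : j = k
    · rwa [← hjk]
    refine (((IsLatTerm.frame hd j k).sup h).inf
      ((IsLatTerm.frame hd k k).sup (IsLatTerm.frame hd i i))).congr fun F V _ _ _ b r => ?_
    have := frameCoord_mul b hij hjk (f F r) 1
    rwa [frameCoord_one b hjk, one_mul] at this
  have left : ∀ i j k, i ≠ j → k ≠ j →
      IsLatTerm.{u, v} hd (fun F _ _ _ _ b r => frameCoord b i j (f F r)) →
      IsLatTerm.{u, v} hd fun F _ _ _ _ b r => frameCoord b k j (f F r) := by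
    intro i j k hij hkj h
    by_cases hik : i = k
    · rwa [← hik]
    exact ((h.sup (IsLatTerm.frame hd i k)).inf
      ((IsLatTerm.frame hd j j).sup (IsLatTerm.frame hd k k))).congr fun F V _ _ _ b r =>
        frameCoord_swap_left b hij hik _
  intro i' j' hij'
  obtain ⟨k, hki, hki'⟩ := exists_ne_ne hd i i'
  exact right i' k j' hki'.symm hij' (left i k i' hki.symm hki'.symm (right i j k hij hki.symm h))

open Classical in
/-- Relations whose truth value is expressed by lattice terms. -/
def IsIndicator (hd : 3 ≤ d) (P : PredFam.{u} ν) : Prop :=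
  ∀ l, IsLatTerm.{u, v} hd fun F _ _ _ _ b r => if P F r then basisFrame b l l else ⊥

theorem IsCoordTerm.isIndicator_eq_zero {hd : 3 ≤ d} {f : FunFam.{u} ν}
    (hf : IsCoordTerm.{u, v} hd f) : IsIndicator.{u, v} hd fun F _ r => f F r = 0 := by
  intro l
  obtain ⟨i, hi, -⟩ := exists_ne_ne hd l l
  exact ((hf i l hi).inf (IsLatTerm.frame hd l l)).congr fun F V _ _ _ b r =>
    frameCoord_inf b hi (f F r)

theorem IsCoordTerm.isIndicator_ne_zero {hd : 3 ≤ d} {f : FunFam.{u} ν}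
    (hf : IsCoordTerm.{u, v} hd f) : IsIndicator.{u, v} hd fun F _ r => ¬ f F r = 0 := by
  classical
  intro l
  obtain ⟨j, hj, -⟩ := exists_ne_ne hd l l
  refine (((hf l j hj.symm).sup (IsLatTerm.frame hd j j)).inf (IsLatTerm.frame hd l l)).congr
    fun F V _ _ _ b r => ?_
  rw [frameCoord_sup_inf b hj.symm (f F r)]
  by_cases h : f F r = 0 <;> simp [h]

theorem IsRat.isCoordTerm (hd : 3 ≤ d) {f : FunFam.{u} ν} (hf : IsRat f) :
    IsCoordTerm.{u, v} hd f := by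
  classical
  induction hf with
  | var x =>
    exact isCoordTerm_of_exists (i := ⟨1, by omega⟩) (j := ⟨0, by omega⟩) (by simp)
      ⟨Term.var (Sum.inr x), fun _ _ _ _ _ _ _ => rfl⟩
  | zero =>
    intro i j _
    exact (IsLatTerm.frame hd j j).congr fun F V _ _ _ b r => (frameCoord_zero b).symm
  | one =>
    intro i j hij
    exact (IsLatTerm.frame hd i j).congr fun F V _ _ _ b r => (frameCoord_one b hij).symm
  | @add f g _ _ ihf ihg =>
    intro i j hij
    obtain ⟨k, hki, hkj⟩ := exists_ne_ne hd i j
    refine ((((((ihf i j hij).sup (IsLatTerm.frame hd k k)).inf ((IsLatTerm.frame hd k j).sup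
      (IsLatTerm.frame hd i i))).sup (ihg i k hki.symm)).inf
      ((IsLatTerm.frame hd j j).sup (IsLatTerm.frame hd i i)))).congr fun F V _ _ _ b r => ?_
    rw [frameCoord_shift b hij hkj.symm hki.symm, frameCoord_add b hkj.symm hki.symm]
  | @mul f g _ _ ihf ihg =>
    intro i k hik
    obtain ⟨j, hji, hjk⟩ := exists_ne_ne hd i k
    exact (((ihf j k hjk).sup (ihg i j hji.symm)).inf ((IsLatTerm.frame hd k k).sup
      (IsLatTerm.frame hd i i))).congr fun F V _ _ _ b r =>
        frameCoord_mul b hji.symm hjk (g F r) (f F r)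
  | neg _ ih =>
    intro i k hik
    obtain ⟨j, hji, hjk⟩ := exists_ne_ne hd i k
    refine ((((((ih i j hji.symm).sup (IsLatTerm.frame hd k k)).inf ((IsLatTerm.frame hd k j).sup
      (IsLatTerm.frame hd i i))).sup (IsLatTerm.frame hd j j)).inf
      ((IsLatTerm.frame hd k k).sup (IsLatTerm.frame hd i i)))).congr fun F V _ _ _ b r => ?_
    rw [frameCoord_shift b hji.symm hjk hik, frameCoord_neg b hji.symm hjk]
  | @inv f _ ih =>
    intro j i hji
    refine ((((ih i j hji.symm).inf ((ih.isIndicator_ne_zero i).sup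
      (ih.isIndicator_ne_zero j))).sup (ih.isIndicator_eq_zero i))).congr fun F V _ _ _ b r => ?_
    convert frameCoord_inv b _ using 3
    by_cases h : f F r = 0 <;> simp [h]

/-- Lattice terms offer no complementation, so indicators of `P` and of its negation are built
together: negation exchanges them, and conjunction uses a meet for the one and a join for the other.
-/
theorem IsRatQF.isIndicator (hd : 3 ≤ d) {P : PredFam.{u} ν} (hP : IsRatQF P) :
    IsIndicator.{u, v} hd P := by
  classical
  suffices h : IsIndicator.{u, v} hd P ∧ IsIndicator.{u, v} hd fun F _ r => ¬ P F r from h.1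
  induction hP with
  | eqn hf => exact ⟨(hf.isCoordTerm hd).isIndicator_eq_zero, (hf.isCoordTerm hd).isIndicator_ne_zero⟩
  | not _ ih => exact ⟨ih.2, by simpa only [not_not] using ih.1⟩
  | and _ _ ih ih' =>
    refine ⟨fun l => ((ih.1 l).inf (ih'.1 l)).congr fun F V _ _ _ b r => ?_,
      fun l => ((ih.2 l).sup (ih'.2 l)).congr fun F V _ _ _ b r => ?_⟩
    · split_ifs <;> simp_all
    · split_ifs <;> simp_all

-- Joining the indicators over all axes of the frame gives `⊤` or `⊥`, so that a quantifier free
-- condition becomes one equation `s = 1`.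
open Classical in
theorem IsRatQF.isLatTerm_top (hd : 3 ≤ d) {P : PredFam.{u} ν} (hP : IsRatQF P) :
    IsLatTerm.{u, v} hd fun F V _ _ _ b r => if P F r then (⊤ : Submodule F V) else ⊥ := by
  let E : Fin d → LatFam.{u, v} d ν := fun l F V _ _ _ b r =>
    if P F r then basisFrame b l l else ⊥
  have h : IsLatTerm hd fun F V _ _ _ b r => ⨆ l, E l F V b r :=
    IsLatTerm.iSup_finite fun l => hP.isIndicator hd l
  refine h.congr fun F V _ _ _ b r => ?_
  by_cases hr : P F r
  · simp only [E, if_pos hr, iSup_basisFrame]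
  · simp only [E, if_neg hr, iSup_bot]

open Classical in
/-- The line spanned by a vector one of whose coordinates is `1` is given by a lattice term. -/
theorem isLatTerm_span (hd : 3 ≤ d) {x : Fin d → FunFam.{u} ν} (hx : ∀ i, IsRat (x i)) :
    IsLatTerm.{u, v} hd fun F V _ _ _ b r => if ∃ p, x p F r = 1 then
      Submodule.span F {∑ i, x i F r • b i} else (⊥ : Submodule F V) := by
  -- The joinand for `p` is guarded by the test `x p = 1`, hence it is the line or `⊥`. All `p`
  -- passing the test give the same line.
  have h1 : ∀ p, IsLatTerm.{u, v} hd fun F V _ _ _ b r =>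
      (if x p F r = 1 then (⊤ : Submodule F V) else ⊥) ⊓
      ⨅ l : {l // l ≠ p}, frameCoord b l p (-x l F r) ⊔
        ⨆ m : {m // m ≠ p ∧ m ≠ l}, basisFrame b m m := fun p =>
    (IsRatQF.eq (hx p) .one).isLatTerm_top hd |>.inf (IsLatTerm.iInf_finite fun l =>
      ((hx l).neg.isCoordTerm hd l p l.2).sup (IsLatTerm.iSup_finite fun m => IsLatTerm.frame hd m m))
  refine (IsLatTerm.iSup_finite h1).congr fun F V _ _ _ b r => ?_
  have h2 : ∀ p, ((if x p F r = 1 then (⊤ : Submodule F V) else ⊥) ⊓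
      ⨅ l : {l // l ≠ p}, frameCoord b l p (-x l F r) ⊔
        ⨆ m : {m // m ≠ p ∧ m ≠ l}, basisFrame b m m) =
      if x p F r = 1 then Submodule.span F {∑ i, x i F r • b i} else ⊥ := by
    intro p
    split_ifs with h
    · rw [top_inf_eq]
      exact iInf_frameCoord_sup b p (x := fun i => x i F r) h
    · rw [bot_inf_eq]
  simp only [h2]
  split_ifs with h
  · obtain ⟨p, hp⟩ := h
    refine le_antisymm (iSup_le fun q => ?_) (le_iSup_of_le p (by rw [if_pos hp]))
    split_ifs
    · exact le_rfl
    · exact bot_le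
  · push Not at h
    simp [h]

end LatticeTerms

/-! ### Definitions by equations `t = 0` and `s = 1`: (E) -/

section EquationalDefinitions

variable {d : ℕ} {β : Type}

/-- Operations on subspaces given by lattice terms. -/
def IsTermOp (E : ∀ (F : Type u) (V : Type v) [Field F] [AddCommGroup V] [Module F V],
    (β → Submodule F V) → Submodule F V) : Prop :=
  ∃ t : latLang.Term β, ∀ (F : Type u) (V : Type v) [Field F] [AddCommGroup V] [Module F V]
    (w : β → Submodule F V), latEval t w = E F V w

namespace IsTermOp

variable {E E' : ∀ (F : Type u) (V : Type v) [Field F] [AddCommGroup V] [Module F V],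
    (β → Submodule F V) → Submodule F V}

theorem var (x : β) : IsTermOp.{u, v} fun _ _ _ _ _ w => w x :=
  ⟨Term.var x, fun _ _ _ _ _ _ => rfl⟩

theorem sup (hE : IsTermOp E) (hE' : IsTermOp E') :
    IsTermOp fun F V _ _ _ w => E F V w ⊔ E' F V w := by
  obtain ⟨t, ht⟩ := hE
  obtain ⟨t', ht'⟩ := hE'
  exact ⟨latSup t t', fun F V _ _ _ w => by rw [latEval_sup, ht, ht']⟩

theorem inf (hE : IsTermOp E) (hE' : IsTermOp E') :
    IsTermOp fun F V _ _ _ w => E F V w ⊓ E' F V w := by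
  obtain ⟨t, ht⟩ := hE
  obtain ⟨t', ht'⟩ := hE'
  exact ⟨latInf t t', fun F V _ _ _ w => by rw [latEval_inf, ht, ht']⟩

theorem iSup_finite {ι : Type} [Finite ι] {E : ι → ∀ (F : Type u) (V : Type v) [Field F]
    [AddCommGroup V] [Module F V], (β → Submodule F V) → Submodule F V}
    (hE : ∀ i, IsTermOp (E i)) : IsTermOp fun F V _ _ _ w => ⨆ i, E i F V w := by
  classical
  have := Fintype.ofFinite ι
  suffices h : ∀ s : Finset ι, IsTermOp fun F V _ _ _ w => ⨆ i ∈ s, E i F V w by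
    obtain ⟨t, ht⟩ := h Finset.univ
    exact ⟨t, fun F V _ _ _ w => by simp [ht]⟩
  intro s
  induction s using Finset.induction_on with
  | empty => exact ⟨latBot, fun F V _ _ _ w => by simp [latEval_bot]⟩
  | insert i s _ ih =>
    obtain ⟨t, ht⟩ := (hE i).sup ih
    exact ⟨t, fun F V _ _ _ w => by
      beta_reduce at ht ⊢
      rw [ht, Finset.iSup_insert]⟩

end IsTermOp

/-- Relations between subspaces defined by conjunctions of equations `t = 0` and `s = 1`. -/
def IsEqDef (P : ∀ (F : Type u) (V : Type v) [Field F] [AddCommGroup V] [Module F V],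
    (β → Submodule F V) → Prop) : Prop :=
  ∃ T S : List (latLang.Term β), ∀ (F : Type u) (V : Type v) [Field F] [AddCommGroup V]
    [Module F V] (w : β → Submodule F V), P F V w ↔ w ∈ eqSet (Submodule F V) T S

/-- Equality with an element having a known complement, expressed by equations. -/
theorem eq_iff_of_isCompl {L : Type*} [Lattice L] [BoundedOrder L] [IsModularLattice L] {x y c : L}
    (h : IsCompl y c) : x = y ↔ (x ⊔ y) ⊓ c = ⊥ ∧ x ⊔ c = ⊤ := by
  constructor
  · rintro rfl
    exact ⟨by rw [sup_idem, h.inf_eq_bot], h.sup_eq_top⟩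
  · rintro ⟨h1, h2⟩
    have hx : x = x ⊔ y := eq_of_le_of_inf_le_of_sup_le le_sup_left (z := c)
      (by rw [h1]; exact bot_le) (by rw [h2]; exact le_top)
    have hy : y = x ⊔ y := eq_of_le_of_inf_le_of_sup_le le_sup_right (z := c)
      (by rw [h1]; exact bot_le) (by rw [h.sup_eq_top]; exact le_top)
    rw [hx, ← hy]

namespace IsEqDef

variable {P Q : ∀ (F : Type u) (V : Type v) [Field F] [AddCommGroup V] [Module F V],
    (β → Submodule F V) → Prop}
  {E E' C : ∀ (F : Type u) (V : Type v) [Field F] [AddCommGroup V] [Module F V],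
    (β → Submodule F V) → Submodule F V}

theorem congr (hP : IsEqDef P) (h : ∀ (F : Type u) (V : Type v) [Field F] [AddCommGroup V]
    [Module F V] (w : β → Submodule F V), P F V w ↔ Q F V w) : IsEqDef Q := by
  obtain ⟨T, S, hTS⟩ := hP
  exact ⟨T, S, fun F V _ _ _ w => (h F V w).symm.trans (hTS F V w)⟩

theorem and (hP : IsEqDef P) (hQ : IsEqDef Q) :
    IsEqDef fun F V _ _ _ w => P F V w ∧ Q F V w := by
  obtain ⟨T, S, h⟩ := hP
  obtain ⟨T', S', h'⟩ := hQ
  refine ⟨T ++ T', S ++ S', fun F V _ _ _ w => ?_⟩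
  refine (and_congr (h F V w) (h' F V w)).trans ?_
  simp only [eqSet, Set.mem_ofPred_eq, List.forall_mem_append]
  tauto

theorem forall_finite {ι : Type} [Finite ι] {P : ι → ∀ (F : Type u) (V : Type v) [Field F]
    [AddCommGroup V] [Module F V], (β → Submodule F V) → Prop} (hP : ∀ i, IsEqDef (P i)) :
    IsEqDef fun F V _ _ _ w => ∀ i, P i F V w := by
  classical
  have := Fintype.ofFinite ι
  suffices h : ∀ s : Finset ι, IsEqDef fun F V _ _ _ w => ∀ i ∈ s, P i F V w from
    (h Finset.univ).congr fun F V _ _ _ w => by simp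
  intro s
  induction s using Finset.induction_on with
  | empty => exact ⟨[], [], fun F V _ _ _ w => by simp [eqSet]⟩
  | insert i s _ ih => exact ((hP i).and ih).congr fun F V _ _ _ w => by simp

theorem eq_bot (hE : IsTermOp E) : IsEqDef fun F V _ _ _ w => E F V w = ⊥ := by
  obtain ⟨t, ht⟩ := hE
  exact ⟨[t], [], fun F V _ _ _ w => by simp [eqSet, ht]⟩

theorem eq_top (hE : IsTermOp E) : IsEqDef fun F V _ _ _ w => E F V w = ⊤ := by
  obtain ⟨t, ht⟩ := hE
  exact ⟨[], [t], fun F V _ _ _ w => by simp [eqSet, ht]⟩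

/-- When the conditions imposed so far ensure that `E' i` has the complement `C i`, the equality `E
i = E' i` splits by `eq_iff_of_isCompl` into one equation with `0` and one with `1`. Definitions are
built up in layers in this way. -/
theorem and_forall_eq {ι : Type} [Finite ι] {E E' C : ι → ∀ (F : Type u) (V : Type v) [Field F]
    [AddCommGroup V] [Module F V], (β → Submodule F V) → Submodule F V}
    (hP : IsEqDef P) (hE : ∀ i, IsTermOp (E i)) (hE' : ∀ i, IsTermOp (E' i))
    (hC : ∀ i, IsTermOp (C i))
    (h : ∀ i (F : Type u) (V : Type v) [Field F] [AddCommGroup V] [Module F V]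
      (w : β → Submodule F V), P F V w → IsCompl (E' i F V w) (C i F V w)) :
    IsEqDef fun F V _ _ _ w => P F V w ∧ ∀ i, E i F V w = E' i F V w :=
  (hP.and (forall_finite fun i => (eq_bot (((hE i).sup (hE' i)).inf (hC i))).and
    (eq_top ((hE i).sup (hC i))))).congr fun F V _ _ _ w =>
      and_congr_right fun hw => forall_congr' fun i => (eq_iff_of_isCompl (h i F V w hw)).symm

end IsEqDef

section Complements

variable {L ι : Type*} [CompleteLattice L] [IsModularLattice L]
  [IsCompactlyGenerated L] {a : ι → L}

theorem isCompl_sup_iSup (h : iSupIndep a) (h' : ⨆ i, a i = ⊤) (i j : ι) :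
    IsCompl (a i ⊔ a j) (⨆ l : {l // l ≠ i ∧ l ≠ j}, a l) := by
  constructor
  · have h1 := h.disjoint_biSup_biSup (s := {i, j}) (t := {i, j}ᶜ) disjoint_compl_right
    have h2 : ⨆ l : {l // l ≠ i ∧ l ≠ j}, a l = ⨆ l ∈ ({i, j} : Set ι)ᶜ, a l := by
      rw [iSup_subtype]
      simp
    rwa [iSup_pair, ← h2] at h1
  · rw [codisjoint_iff, eq_top_iff, ← h']
    refine iSup_le fun l => ?_
    by_cases hi : l = i
    · subst hi; exact le_sup_of_le_left le_sup_left
    by_cases hj : l = j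
    · subst hj; exact le_sup_of_le_left le_sup_right
    exact le_sup_of_le_right (le_iSup (fun l : {l // l ≠ i ∧ l ≠ j} => a l) ⟨l, hi, hj⟩)

/-- Exchanging `y` for `z` keeps the sum with `x` direct; `x` may therefore be moved to the
complement. -/
theorem isCompl_sup_of_sup_eq {L : Type*} [Lattice L] [BoundedOrder L] [IsModularLattice L]
    {x y z c : L} (h : IsCompl (x ⊔ y) c) (hxz : Disjoint x z)
    (hz : x ⊔ z = x ⊔ y) : IsCompl z (x ⊔ c) := by
  rw [← hz] at h
  refine ⟨?_, ?_⟩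
  · exact Disjoint.disjoint_sup_right_of_disjoint_sup_left hxz.symm (by rw [sup_comm]; exact h.1)
  · rw [codisjoint_iff, ← sup_assoc, sup_comm z x, h.sup_eq_top]

end Complements

/-- Frames together with elements of the field `R_21` of the frame are defined by equations. -/
theorem isEqDef_frame (hd : 3 ≤ d) (ν : Type) [Finite ν] :
    IsEqDef.{u, v} fun _ _ _ _ _ (w : (Fin d × Fin d) ⊕ ν → _) =>
      IsFrame (fun i j => w (Sum.inl (i, j))) ∧
      ∀ k, w (Sum.inr k) ⊔ w (Sum.inl (⟨1, by omega⟩, ⟨1, by omega⟩)) =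
          w (Sum.inl (⟨1, by omega⟩, ⟨1, by omega⟩)) ⊔ w (Sum.inl (⟨0, by omega⟩, ⟨0, by omega⟩)) ∧
        Disjoint (w (Sum.inr k)) (w (Sum.inl (⟨1, by omega⟩, ⟨1, by omega⟩))) := by
  have ha : ∀ i j, IsTermOp.{u, v} fun _ _ _ _ _ (w : (Fin d × Fin d) ⊕ ν → _) =>
      w (Sum.inl (i, j)) := fun i j => .var _
  have hC : ∀ i j, IsTermOp.{u, v} fun _ _ _ _ _ (w : (Fin d × Fin d) ⊕ ν → _) =>
      ⨆ l : {l : Fin d // l ≠ i ∧ l ≠ j}, w (Sum.inl (l.1, l.1)) := fun i j =>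
    .iSup_finite fun l : {l : Fin d // l ≠ i ∧ l ≠ j} => ha l.1 l.1
  -- The base layer: independence, generation and disjointness already have the form `t = 0` or `s =
  -- 1`.
  have h0 : IsEqDef.{u, v} fun _ _ _ _ _ (w : (Fin d × Fin d) ⊕ ν → _) =>
      (iSupIndep fun i => w (Sum.inl (i, i))) ∧ (⨆ i, w (Sum.inl (i, i)) = ⊤) ∧
      (∀ x : {x : Fin d × Fin d // x.1 ≠ x.2},
        Disjoint (w (Sum.inl (x.1.1, x.1.1))) (w (Sum.inl (x.1.1, x.1.2)))) ∧
      ∀ k, Disjoint (w (Sum.inr k)) (w (Sum.inl (⟨1, by omega⟩, ⟨1, by omega⟩))) := by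
    refine IsEqDef.and ?_ (.and ?_ (.and ?_ ?_))
    · refine (IsEqDef.forall_finite fun i => .eq_bot ((ha i i).inf (.iSup_finite
        fun l : {l // l ≠ i} => ha l l))).congr fun F V _ _ _ w => ?_
      simp only [iSupIndep, disjoint_iff, iSup_subtype]
    · exact .eq_top (.iSup_finite fun l => ha l l)
    · exact (IsEqDef.forall_finite fun x : {x : Fin d × Fin d // x.1 ≠ x.2} =>
        .eq_bot ((ha x.1.1 x.1.1).inf (ha x.1.1 x.1.2))).congr fun F V _ _ _ w => by
          simp only [disjoint_iff]
    · exact (IsEqDef.forall_finite fun k => .eq_bot ((IsTermOp.var (Sum.inr k)).inf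
        (ha ⟨1, by omega⟩ ⟨1, by omega⟩))).congr fun F V _ _ _ w => by simp only [disjoint_iff]
  -- In each further layer, the earlier ones guarantee a complement of one side: of `a i i ⊔ a j j`
  -- by independence, then of `a i j` by the sum relations.
  have h1 := h0.and_forall_eq (ι := {x : Fin d × Fin d // x.1 ≠ x.2})
    (fun x => (ha x.1.1 x.1.1).sup (ha x.1.1 x.1.2))
    (fun x => (ha x.1.1 x.1.1).sup (ha x.1.2 x.1.2)) (fun x => hC x.1.1 x.1.2)
    fun x F V _ _ _ w hw => isCompl_sup_iSup hw.1 hw.2.1 x.1.1 x.1.2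
  have h2 := h1.and_forall_eq (ι := {x : Fin d × Fin d // x.1 ≠ x.2})
    (fun x => ha x.1.2 x.1.1) (fun x => ha x.1.1 x.1.2)
    (fun x => (ha x.1.1 x.1.1).sup (hC x.1.1 x.1.2))
    fun x F V _ _ _ w hw => isCompl_sup_of_sup_eq (isCompl_sup_iSup hw.1.1 hw.1.2.1 x.1.1 x.1.2)
      (hw.1.2.2.1 x) (hw.2 x)
  have h3 := h2.and_forall_eq
    (ι := {x : Fin d × Fin d × Fin d // x.1 ≠ x.2.1 ∧ x.2.1 ≠ x.2.2 ∧ x.1 ≠ x.2.2})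
    (fun x => ((ha x.1.1 x.1.1).sup (ha x.1.2.2 x.1.2.2)).inf
      ((ha x.1.1 x.1.2.1).sup (ha x.1.2.1 x.1.2.2)))
    (fun x => ha x.1.1 x.1.2.2) (fun x => (ha x.1.1 x.1.1).sup (hC x.1.1 x.1.2.2))
    fun x F V _ _ _ w hw =>
      isCompl_sup_of_sup_eq (isCompl_sup_iSup hw.1.1.1 hw.1.1.2.1 x.1.1 x.1.2.2)
        (hw.1.1.2.2.1 ⟨(x.1.1, x.1.2.2), x.2.2.2⟩) (hw.1.2 ⟨(x.1.1, x.1.2.2), x.2.2.2⟩)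
  have h4 := h3.and_forall_eq (ι := ν)
    (fun k => (IsTermOp.var (Sum.inr k)).sup (ha ⟨1, by omega⟩ ⟨1, by omega⟩))
    (fun k => (ha ⟨1, by omega⟩ ⟨1, by omega⟩).sup (ha ⟨0, by omega⟩ ⟨0, by omega⟩))
    (fun k => hC ⟨1, by omega⟩ ⟨0, by omega⟩)
    fun k F V _ _ _ w hw => isCompl_sup_iSup hw.1.1.1.1 hw.1.1.1.2.1 _ _
  refine h4.congr fun F V _ _ _ w => ⟨?_, ?_⟩
  · rintro ⟨⟨⟨⟨⟨hi, ht, hdj, hk⟩, hs⟩, hsy⟩, hc⟩, hk'⟩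
    exact ⟨⟨hi, ht, fun i j hij => (hsy ⟨(i, j), hij⟩).symm, fun i j hij => (hs ⟨(i, j), hij⟩).symm,
      fun i j hij => hdj ⟨(i, j), hij⟩, fun i j k hij hjk hik =>
        (hc ⟨(i, j, k), hij, hjk, hik⟩).symm⟩, fun k => ⟨hk' k, hk k⟩⟩
  · rintro ⟨h, h'⟩
    exact ⟨⟨⟨⟨⟨h.indep, h.sup_eq_top, fun x => h.disjoint _ _ x.2, fun k => (h' k).2⟩,
      fun x => (h.sup_eq _ _ x.2).symm⟩, fun x => (h.symm _ _ x.2).symm⟩,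
      fun x => (h.comp _ _ _ x.2.1 x.2.2.1 x.2.2.2).symm⟩, fun k => (h' k).1⟩

theorem frameRel_eq (hd : 3 ≤ d) {F V : Type*} [Field F] [AddCommGroup V] [Module F V] {ν : Type}
    (R : Set (ν → F)) :
    frameRel V hd R = {w | ∃ (b : Module.Basis (Fin d) F V) (r : ν → F), w = frameVal hd b r ∧
      r ∈ R} := by
  ext w
  constructor
  · rintro ⟨-, b, hb, r, hr, hw⟩
    rw [frameBasis_iff] at hb
    refine ⟨b, r, ?_, hr⟩
    funext x
    rcases x with ⟨i, j⟩ | k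
    · exact congrFun (congrFun hb i) j
    · exact hw k
  · rintro ⟨b, r, rfl, hr⟩
    exact ⟨isFrame_basisFrame b, b, frameBasis_iff.2 rfl, r, hr, fun k => rfl⟩

/-- Relations which are Boolean combinations of equations between rational functions are defined
by lattice equations with respect to frames. -/
theorem IsRatQF.exists_eqSet (hd : 3 ≤ d) {ν : Type} [Finite ν] {P : PredFam.{u} ν}
    (hP : IsRatQF P) :
    ∃ T S : List (latLang.Term ((Fin d × Fin d) ⊕ ν)), ∀ (F : Type u) (V : Type v) [Field F]
      [AddCommGroup V] [Module F V], Module.finrank F V = d →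
      {w | ∃ (b : Module.Basis (Fin d) F V) (r : ν → F), w = frameVal hd b r ∧ P F r} =
        eqSet (Submodule F V) T S := by
  classical
  obtain ⟨t, ht⟩ := hP.isLatTerm_top.{u, v} hd
  obtain ⟨T, S, hTS⟩ := (isEqDef_frame.{u, v} hd ν).and (.eq_top ⟨t, fun F V _ _ _ w => rfl⟩)
  refine ⟨T, S, fun F V _ _ _ hV => ?_⟩
  have : Nontrivial V := Module.nontrivial_of_finrank_pos (R := F) (by omega)
  ext w
  rw [← hTS, Set.mem_ofPred_eq]
  constructor
  · rintro ⟨b, r, rfl, hr⟩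
    have hne : (⟨1, by omega⟩ : Fin d) ≠ ⟨0, by omega⟩ := by simp
    refine ⟨⟨isFrame_basisFrame b, fun k => ?_⟩, (ht F V b r).trans (if_pos hr)⟩
    have := (exists_eq_frameCoord_iff b hne (X := frameCoord b ⟨1, by omega⟩ ⟨0, by omega⟩ (r k))).1
      ⟨r k, rfl⟩
    exact this
  · rintro ⟨⟨h1, h2⟩, h3⟩
    obtain ⟨b, hb⟩ := h1.exists_basis (by omega) hV
    have h4 : ∀ i j, w (Sum.inl (i, j)) = basisFrame b i j := fun i j =>
      congrFun (congrFun hb i) j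
    simp only [h4] at h2
    have hne : (⟨1, by omega⟩ : Fin d) ≠ ⟨0, by omega⟩ := by simp
    choose r hr using fun k => (exists_eq_frameCoord_iff b hne).2 (h2 k)
    have hw : w = frameVal hd b r := by
      funext x
      rcases x with ⟨i, j⟩ | k
      · exact h4 i j
      · exact hr k
    refine ⟨b, r, hw, ?_⟩
    by_contra h
    rw [hw] at h3
    exact bot_ne_top ((if_neg h).symm.trans ((ht F V b r).symm.trans h3))

/-- Quantifier free relations on the field have equational definitions in the lattice. -/
theorem exists_eqSet_frameRel (hd : 3 ≤ d) {n : ℕ} {φ : ringInvLang.Formula (Fin n)}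
    (hφ : φ.IsQF) : ∃ T S : List (latLang.Term ((Fin d × Fin d) ⊕ Fin n)),
      ∀ (F : Type u) [Field F] (V : Type v) [AddCommGroup V] [Module F V],
        Module.finrank F V = d →
          frameRel V hd {r : Fin n → F | RingInvHolds φ r} = eqSet (Submodule F V) T S := by
  obtain ⟨T, S, h⟩ := (isRatQF_ringInvHolds.{u} hφ).exists_eqSet.{u, v} hd
  exact ⟨T, S, fun F _ V _ _ hV => by rw [← h F V hV, frameRel_eq]; rfl⟩

end EquationalDefinitions

/-! ### Conjunctions of lattice equations as formulas -/

section Conjunctions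

variable {γ : Type*}

/-- The conjunction of a list of equations between lattice terms. -/
def latConj (E : List (latLang.Term γ × latLang.Term γ)) : latLang.Formula γ :=
  E.foldr (fun e φ => Term.equal e.1 e.2 ⊓ φ) ⊤

theorem isQF_latConj (E : List (latLang.Term γ × latLang.Term γ)) : (latConj E).IsQF := by
  induction E with
  | nil => exact BoundedFormula.IsQF.top
  | cons e E ih =>
    exact BoundedFormula.IsQF.inf (BoundedFormula.IsAtomic.equal _ _).isQF ih

theorem latHolds_latConj {L : Type*} [Lattice L] [BoundedOrder L]
    (E : List (latLang.Term γ × latLang.Term γ)) (w : γ → L) :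
    LatHolds (latConj E) w ↔ ∀ e ∈ E, latEval e.1 w = latEval e.2 w := by
  let _ := latStructure L
  induction E with
  | nil => simp [LatHolds, latConj, Formula.Realize]
  | cons e E ih =>
    have : LatHolds (latConj (e :: E)) w ↔ latEval e.1 w = latEval e.2 w ∧ LatHolds (latConj E) w :=
      BoundedFormula.realize_inf.trans (and_congr_left' Formula.realize_equal)
    rw [this, List.forall_mem_cons]
    exact and_congr_right' ih

/-- The equations `t = 0` and `s = 1`. -/
def eqPairs (T S : List (latLang.Term γ)) : List (latLang.Term γ × latLang.Term γ) :=
  T.map (fun t => (t, latBot)) ++ S.map fun s => (s, latTop)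

theorem forall_mem_eqPairs {L : Type*} [Lattice L] [BoundedOrder L] (T S : List (latLang.Term γ))
    (w : γ → L) : (∀ e ∈ eqPairs T S, latEval e.1 w = latEval e.2 w) ↔ w ∈ eqSet L T S := by
  simp only [eqPairs, List.forall_mem_append, List.forall_mem_map, latEval_bot, latEval_top]
  rfl

theorem latHolds_iExs {L : Type*} [Lattice L] [BoundedOrder L] {α β : Type} [Finite β]
    {φ : latLang.Formula (α ⊕ β)} {w : α → L} :
    LatHolds (φ.iExs β) w ↔ ∃ y : β → L, LatHolds φ (Sum.elim w y) :=
  letI := latStructure L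
  Formula.realize_iExs

theorem latHolds_iAlls {L : Type*} [Lattice L] [BoundedOrder L] {α β : Type} [Finite β]
    {φ : latLang.Formula (α ⊕ β)} {w : α → L} :
    LatHolds (φ.iAlls β) w ↔ ∀ y : β → L, LatHolds φ (Sum.elim w y) :=
  letI := latStructure L
  Formula.realize_iAlls

theorem latHolds_inf {L : Type*} [Lattice L] [BoundedOrder L] {α : Type*}
    {φ ψ : latLang.Formula α} {w : α → L} :
    LatHolds (φ ⊓ ψ) w ↔ LatHolds φ w ∧ LatHolds ψ w :=
  letI := latStructure L
  BoundedFormula.realize_inf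

theorem latHolds_relabel {L : Type*} [Lattice L] [BoundedOrder L] {α β : Type} {f : α → β}
    {φ : latLang.Formula α} {w : β → L} :
    LatHolds (φ.relabel f) w ↔ LatHolds φ fun x => w (f x) :=
  letI := latStructure L
  Formula.realize_relabel

end Conjunctions

/-! ### Ring formulas as lattice formulas over a frame -/

section FormulasOverFrames

variable {d : ℕ}

/-- Ring formulas translate into lattice formulas about the elements of the field of a frame. -/
theorem exists_latFormula (hd : 3 ≤ d) {σ : Type} {m : ℕ} (χ : Language.ring.BoundedFormula σ m)
    (ν : Type) {U : σ → FunFam.{u} ν} {X : Fin m → FunFam.{u} ν} (hU : ∀ x, IsRat (U x))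
    (hX : ∀ x, IsRat (X x)) :
    ∃ φ : latLang.Formula ((Fin d × Fin d) ⊕ ν), ∀ (F : Type u) (V : Type v) [Field F]
      [AddCommGroup V] [Module F V] (b : Module.Basis (Fin d) F V) (r : ν → F),
      LatHolds φ (frameVal hd b r) ↔ RingRealize χ (fun x => U x F r) fun x => X x F r := by
  classical
  induction χ generalizing ν with
  | falsum => exact ⟨⊥, fun F V _ _ _ b r => Iff.rfl⟩
  | equal t s =>
    obtain ⟨t', ht'⟩ := (isRatQF_equal hU hX t s).isLatTerm_top.{u, v} hd
    refine ⟨latConj [(t', latTop)], fun F V _ _ _ b r => ?_⟩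
    have : Nontrivial V := ⟨b ⟨0, by omega⟩, 0, by
      have : Nontrivial F := inferInstance
      exact b.ne_zero _⟩
    rw [latHolds_latConj, List.forall_mem_singleton, latEval_top, ht']
    beta_reduce
    split_ifs with h
    · exact iff_of_true rfl h
    · exact iff_of_false bot_ne_top h
  | rel R => cases R
  | imp _ _ ih ih' =>
    obtain ⟨φ, hφ⟩ := ih ν hU hX
    obtain ⟨ψ, hψ⟩ := ih' ν hU hX
    exact ⟨φ.imp ψ, fun F V _ _ _ b r => imp_congr (hφ F V b r) (hψ F V b r)⟩
  | @all m χ ih =>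
    let X' : Fin (m + 1) → FunFam.{u} (ν ⊕ Unit) :=
      Fin.snoc (α := fun _ => FunFam.{u} (ν ⊕ Unit)) (fun x F _ r => X x F fun y => r (Sum.inl y))
        fun F _ r => r (Sum.inr ())
    have hX' : ∀ x, IsRat (X' x) := by
      intro x
      refine Fin.lastCases ?_ (fun x => ?_) x
      · simp only [X', Fin.snoc_last]
        exact .var _
      · simp only [X', Fin.snoc_castSucc]
        exact (hX x).subst fun y => .var (Sum.inl y)
    obtain ⟨φ, hφ⟩ := ih (ν ⊕ Unit) (U := fun x F _ r => U x F fun y => r (Sum.inl y))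
      (fun x => (hU x).subst fun y => .var (Sum.inl y)) hX'
    let e : (Fin d × Fin d) ⊕ (ν ⊕ Unit) → ((Fin d × Fin d) ⊕ ν) ⊕ Unit :=
      (Equiv.sumAssoc _ _ _).symm
    let x : latLang.Term (((Fin d × Fin d) ⊕ ν) ⊕ Unit) := Term.var (Sum.inr ())
    let a : Fin d → latLang.Term (((Fin d × Fin d) ⊕ ν) ⊕ Unit) := fun i =>
      Term.var (Sum.inl (Sum.inl (i, i)))
    -- The guard confines the quantified subspace to complements of `a_1` in `a_1 + a_0`, that is,
    -- to the coordinates of field elements.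
    let g : latLang.Formula (((Fin d × Fin d) ⊕ ν) ⊕ Unit) := latConj
      [(latSup x (a ⟨1, by omega⟩), latSup (a ⟨1, by omega⟩) (a ⟨0, by omega⟩)),
        (latInf x (a ⟨1, by omega⟩), latBot)]
    have hne : (⟨1, by omega⟩ : Fin d) ≠ ⟨0, by omega⟩ := by simp
    refine ⟨(g.imp (φ.relabel e)).iAlls Unit, fun F V _ _ _ b r => ?_⟩
    have h1 : ∀ y : Unit → Submodule F V, LatHolds (g.imp (φ.relabel e))
        (Sum.elim (frameVal hd b r) y) ↔ ((∃ s, y () = frameCoord b ⟨1, by omega⟩ ⟨0, by omega⟩ s) →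
          LatHolds φ fun z => Sum.elim (frameVal hd b r) y (e z)) := by
      intro y
      have h2 : LatHolds g (Sum.elim (frameVal hd b r) y) ↔
          ∃ s, y () = frameCoord b ⟨1, by omega⟩ ⟨0, by omega⟩ s := by
        rw [latHolds_latConj, List.forall_mem_cons, List.forall_mem_singleton, latEval_sup,
          latEval_sup, latEval_inf, latEval_bot, exists_eq_frameCoord_iff b hne, disjoint_iff]
        rfl
      exact imp_congr h2 latHolds_relabel
    have h3 : ∀ (s : F) (y : Unit → Submodule F V),
        y () = frameCoord b ⟨1, by omega⟩ ⟨0, by omega⟩ s →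
        (fun z => Sum.elim (frameVal hd b r) y (e z)) =
          frameVal hd b (Sum.elim r fun _ : Unit => s) := by
      intro s y hy
      funext z
      rcases z with z | z | z
      · rfl
      · rfl
      · exact hy
    have h4 : ∀ s : F, (fun z => X' z F (Sum.elim r fun _ => s)) =
        Fin.snoc (fun z => X z F r) s := by
      intro s
      funext z
      refine Fin.lastCases ?_ (fun z => ?_) z
      · simp only [X', Fin.snoc_last, Sum.elim_inr]
      · simp only [X', Fin.snoc_castSucc, Sum.elim_inl]
    have h5 : RingRealize χ.all (fun z => U z F r) (fun z => X z F r) ↔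
        ∀ s, LatHolds φ (frameVal hd b (Sum.elim r fun _ : Unit => s)) := by
      refine forall_congr' fun s => ?_
      rw [hφ, h4]
      rfl
    rw [latHolds_iAlls, h5]
    constructor
    · intro h s
      have := (h1 fun _ => _).1 (h fun _ => frameCoord b ⟨1, by omega⟩ ⟨0, by omega⟩ s) ⟨s, rfl⟩
      rwa [h3 s _ rfl] at this
    · intro h y
      rw [h1]
      rintro ⟨s, hs⟩
      rw [h3 s y hs]
      exact h s

end FormulasOverFrames

/-! ### Subspaces given by normalized columns in an arbitrary basis -/

section NormalizedColumns

variable {d : ℕ} {ι : Type} (dv : ι → ℕ) {F : Type*} [Field F] {V : Type*} [AddCommGroup V]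
  [Module F V]

/-- All columns of a tuple of `d × dv k`-matrices have an entry `1`. -/
def IsNormalized (c : (Σ k : ι, Fin d × Fin (dv k)) → F) : Prop :=
  ∀ (k : ι) (j : Fin (dv k)), ∃ p, c ⟨k, p, j⟩ = 1

/-- The maximal minors of a tuple of `d × dv k`-matrices. -/
def entryMinors (c : (Σ k : ι, Fin d × Fin (dv k)) → F) : ∀ k, PlIdx d (dv k) → F :=
  -- The empty determinant would be `1`, while the only member of the Grassmannian for `k = 0` is
  -- `0`.
  fun k => if dv k = 0 then 0 else minors (fun j p => c ⟨k, p, j⟩) id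

/-- The spans of the columns of a tuple of `d × dv k`-matrices. -/
def entrySpan (b : Module.Basis (Fin d) F V) (c : (Σ k : ι, Fin d × Fin (dv k)) → F) :
    ι → Submodule F V :=
  fun k => ⨆ j, Submodule.span F {∑ p, c ⟨k, p, j⟩ • b p}

theorem entrySpan_eq (b : Module.Basis (Fin d) F V) (c : (Σ k : ι, Fin d × Fin (dv k)) → F) (k : ι) :
    entrySpan dv b c k =
      ofCoord b (Submodule.span F (Set.range fun (j : Fin (dv k)) p => c ⟨k, p, j⟩)) := by
  rw [ofCoord_apply, Submodule.map_span, ← Set.range_comp, Submodule.span_range_eq_iSup]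
  simp [entrySpan, Module.Basis.equivFun_symm_apply]

theorem entryMinors_mem_Gr {c : (Σ k : ι, Fin d × Fin (dv k)) → F} {k : ι}
    (h : Module.finrank F (Submodule.span F (Set.range fun (j : Fin (dv k)) p => c ⟨k, p, j⟩)) =
      dv k) :
    entryMinors dv c k ∈ Gr F d (dv k) ∧ subGr (dv k) (entryMinors dv c k) =
      Submodule.span F (Set.range fun (j : Fin (dv k)) p => c ⟨k, p, j⟩) := by
  have hLI : LinearIndependent F fun (j : Fin (dv k)) p => c ⟨k, p, j⟩ :=
    linearIndependent_iff_card_eq_finrank_span.2 (by rw [Fintype.card_fin]; exact h.symm)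
  by_cases hk : dv k = 0
  · have h1 : entryMinors dv c k = 0 := if_pos hk
    have h2 : ∀ m, m = 0 → (0 : PlIdx d m → F) ∈ Gr F d m := by
      rintro m rfl
      exact mem_Gr_zero_iff.2 rfl
    rw [h1, Submodule.finrank_eq_zero.1 (h.trans hk)]
    exact ⟨h2 _ hk, if_pos hk⟩
  · rw [entryMinors, if_neg hk]
    exact ⟨minors_mem_Gr hk hLI, subGr_minors hLI⟩

/-- Basis vectors are nonzero and can be divided by a nonzero entry. An entry `1` is what
`isLatTerm_span` needs to produce the line of a column by a lattice term. -/
theorem exists_normalized_span_range_eq {k : ℕ} {U : Submodule F (Fin d → F)}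
    (hU : Module.finrank F U = k) :
    ∃ B : Fin k → Fin d → F, (∀ j, ∃ p, B j p = 1) ∧ Submodule.span F (Set.range B) = U := by
  obtain ⟨B, hB⟩ := exists_span_range_eq hU
  have hLI : LinearIndependent F B :=
    linearIndependent_iff_card_eq_finrank_span.2 (by rw [Fintype.card_fin, Set.finrank, hB, hU])
  choose p hp using fun j => Function.ne_iff.1 (hLI.ne_zero j)
  refine ⟨fun j => (B j (p j))⁻¹ • B j, fun j => ⟨p j, inv_mul_cancel₀ (hp j)⟩, ?_⟩
  rw [← hB]
  refine le_antisymm (Submodule.span_le.2 ?_) (Submodule.span_le.2 ?_)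
  · rintro _ ⟨j, rfl⟩
    exact Submodule.smul_mem _ _ (Submodule.subset_span ⟨j, rfl⟩)
  · rintro _ ⟨j, rfl⟩
    have : B j = B j (p j) • (B j (p j))⁻¹ • B j := by rw [smul_smul, mul_inv_cancel₀ (hp j), one_smul]
    rw [this]
    exact Submodule.smul_mem _ _ (Submodule.subset_span ⟨j, rfl⟩)

/-- Description of the subspaces with coordinates in a bi-invariant set by normalized columns with
respect to an arbitrary basis. -/
theorem mem_thetaGL_iff (b : Module.Basis (Fin d) F V) {Q : (∀ k, PlIdx d (dv k) → F) → Prop}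
    {Δ : Set (∀ k, PlIdx d (dv k) → F)} (hΔ : BiInvariant Δ)
    (hQ : Δ = {r | r ∈ GrProd F d dv ∧ Q r}) {w : ι → Submodule F V} (hw : w ∈ dimSet F V dv) :
    w ∈ thetaGL b dv Δ ↔ ∃ (b' : Module.Basis (Fin d) F V) (c : (Σ k : ι, Fin d × Fin (dv k)) → F),
      IsNormalized dv c ∧ Q (entryMinors dv c) ∧ w = entrySpan dv b' c := by
  constructor
  · rw [thetaGL_eq]
    rintro ⟨r, hr, hrG, rfl⟩
    choose B hB1 hB2 using fun k => exists_normalized_span_range_eq (finrank_subGr (hrG k))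
    let c : (Σ k : ι, Fin d × Fin (dv k)) → F := fun x => B x.1 x.2.2 x.2.1
    have h1 : ∀ k, _ := fun k => entryMinors_mem_Gr dv (c := c) (k := k)
      ((congrArg (fun U : Submodule F (Fin d → F) => Module.finrank F U) (hB2 k)).trans
        (finrank_subGr (hrG k)))
    -- Bi-invariance allows passing from `r` to the minors of normalized columns spanning the same
    -- subspaces.
    have h2 : entryMinors dv c ∈ Δ :=
      hΔ.mem_of_subGr_eq hr hrG (fun k => (h1 k).1) fun k => (h1 k).2.trans (hB2 k)
    refine ⟨b, c, hB1, ?_, ?_⟩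
    · rw [hQ] at h2
      exact h2.2
    · funext k
      rw [entrySpan_eq]
      exact congrArg (ofCoord b) (hB2 k).symm
  · rintro ⟨b', c, -, hc, rfl⟩
    have h1 : ∀ k, _ := fun k => entryMinors_mem_Gr dv (c := c) (k := k) (by
      rw [← finrank_ofCoord b', ← entrySpan_eq]
      exact hw k)
    have h2 : entryMinors dv c ∈ Δ := by
      rw [hQ]
      exact ⟨fun k => (h1 k).1, hc⟩
    have h3 : (fun k => ofCoord b (subGr (dv k) (entryMinors dv c k))) ∈ thetaGL b dv Δ := by
      rw [thetaGL_eq]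
      exact ⟨_, h2, fun k => (h1 k).1, rfl⟩
    -- The automorphism taking `b` to `b'` moves the tuple described in terms of `b` to the one
    -- described in terms of `b'`.
    convert latInvariant_thetaGL b dv hΔ (b.equiv b' (Equiv.refl _)) _ h3 using 1
    funext k
    rw [entrySpan_eq, (h1 k).2, ofCoord_apply, ofCoord_apply, ← Submodule.map_comp]
    congr 1
    refine LinearMap.pi_ext' fun i => LinearMap.ext_ring ?_
    simp [Module.Basis.equivFun_symm_apply, Pi.single_apply]

end NormalizedColumns

/-! ### Existential formulas as projections of quantifier free relations -/

section Existential

/-- Existential ring formulas as projections of Boolean combinations of equations. -/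
theorem PrenexClass.exists_isRatQF {σ : Type} {c : Bool} {k n : ℕ}
    {χ : Language.ring.BoundedFormula σ n} (h : PrenexClass c k χ)
    (hk : (c = true ∧ k ≤ 1) ∨ k = 0) :
    ∃ (ζ : Type) (_ : Finite ζ) (P : PredFam.{u} ((σ ⊕ Fin n) ⊕ ζ)), IsRatQF P ∧
      ∀ (F : Type u) [Field F] (r : σ → F) (xs : Fin n → F),
        RingRealize χ r xs ↔ ∃ z : ζ → F, P F (Sum.elim (Sum.elim r xs) z) := by
  induction h with
  | qf h =>
    refine ⟨Empty, inferInstance, _, isRatQF_ringRealize h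
      (U := fun x F _ r => r (Sum.inl (Sum.inl x))) (X := fun x F _ r => r (Sum.inl (Sum.inr x)))
      (fun x => .var _) (fun x => .var _), fun F _ r xs => ?_⟩
    exact ⟨fun h => ⟨Empty.elim, h⟩, fun ⟨_, h⟩ => h⟩
  | @ex k n χ _ ih =>
    obtain ⟨ζ, _, P, hP, h⟩ := ih hk
    let e : (σ ⊕ Fin (n + 1)) ⊕ ζ → (σ ⊕ Fin n) ⊕ (Unit ⊕ ζ) :=
      Sum.elim (Sum.elim (fun x => Sum.inl (Sum.inl x))
        (Fin.snoc (α := fun _ => (σ ⊕ Fin n) ⊕ (Unit ⊕ ζ)) (fun i => Sum.inl (Sum.inr i))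
          (Sum.inr (Sum.inl ())))) fun z => Sum.inr (Sum.inr z)
    have he : ∀ {F : Type u} (r : σ → F) (xs : Fin n → F) (s : Unit → F) (z : ζ → F),
        (fun x => Sum.elim (Sum.elim r xs) (Sum.elim s z) (e x)) =
          Sum.elim (Sum.elim r (Fin.snoc (α := fun _ => F) xs (s ()))) z := by
      intro F r xs s z
      funext x
      rcases x with (x | x) | x
      · rfl
      · refine Fin.lastCases ?_ (fun x => ?_) x
        · simp [e]
        · simp [e]
      · rfl
    refine ⟨Unit ⊕ ζ, inferInstance, fun F _ r => P F fun x => r (e x),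
      hP.subst fun x => .var _, fun F _ r xs => ?_⟩
    have h1 : RingRealize χ.ex r xs ↔ ∃ s : F, RingRealize χ r (Fin.snoc xs s) :=
      letI := Ring.compatibleRingOfRing F
      BoundedFormula.realize_ex
    rw [h1]
    constructor
    · rintro ⟨s, hs⟩
      obtain ⟨z, hz⟩ := (h F r _).1 hs
      exact ⟨Sum.elim (fun _ => s) z, by
        beta_reduce
        rwa [he]⟩
    · rintro ⟨z, hz⟩
      rw [← Sum.elim_comp_inl_inr z, he] at hz
      exact ⟨_, (h F r _).2 ⟨_, hz⟩⟩
  | all => simp at hk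
  -- A switch inside `Σ_1` leads to index `0`, where only quantifier free formulas remain.
  | @switch c k n χ _ ih =>
    exact ih (Or.inr (by omega))

/-- Existential formulas over the Grassmannians as projections of Boolean combinations of
equations. -/
theorem GrForm.PrenexClass.exists_isRatQF {d : ℕ} {α : Type} {s : α → ℕ} {c : Bool} {k : ℕ}
    {ψ : GrForm d α s} (h : GrForm.PrenexClass c k ψ) (hk : (c = true ∧ k ≤ 1) ∨ k = 0) :
    ∃ (ζ : Type) (_ : Finite ζ) (P : PredFam.{u} ((Σ a : α, PlIdx d (s a)) ⊕ ζ)), IsRatQF P ∧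
      ∀ (F : Type u) [Field F] (r : ∀ a, PlIdx d (s a) → F),
        ψ.Holds F r ↔ ∃ z : ζ → F, P F (Sum.elim (fun x => r x.1 x.2) z) := by
  induction h with
  | @qf c k α s ψ h =>
    suffices h : ∃ P : PredFam.{u} (Σ a : α, PlIdx d (s a)), IsRatQF P ∧
        ∀ (F : Type u) [Field F] (r : ∀ a, PlIdx d (s a) → F),
          ψ.Holds F r ↔ P F fun x => r x.1 x.2 by
      obtain ⟨P, hP, h⟩ := h
      refine ⟨Empty, inferInstance, fun F _ r => P F fun x => r (Sum.inl x),
        hP.subst fun x => .var _, fun F _ r => ?_⟩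
      rw [h]
      exact ⟨fun h => ⟨Empty.elim, h⟩, fun ⟨_, h⟩ => h⟩
    clear hk
    induction ψ with
    | bot => exact ⟨_, IsRatQF.true.not, fun F _ r => ⟨False.elim, fun h => h trivial⟩⟩
    | top => exact ⟨_, IsRatQF.true, fun F _ r => Iff.rfl⟩
    | eqn p => exact ⟨_, .eqn (isRat_aeval p), fun F _ r => Iff.rfl⟩
    | not ψ ih =>
      obtain ⟨P, hP, h'⟩ := ih h
      exact ⟨_, hP.not, fun F _ r => not_congr (h' F r)⟩
    | and ψ ψ' ih ih' =>
      obtain ⟨P, hP, h1⟩ := ih h.1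
      obtain ⟨P', hP', h2⟩ := ih' h.2
      exact ⟨_, hP.and hP', fun F _ r => and_congr (h1 F r) (h2 F r)⟩
    | or ψ ψ' ih ih' =>
      obtain ⟨P, hP, h1⟩ := ih h.1
      obtain ⟨P', hP', h2⟩ := ih' h.2
      exact ⟨_, hP.or hP', fun F _ r => or_congr (h1 F r) (h2 F r)⟩
    | ex => exact h.elim
    | all => exact h.elim
  | @ex k α s m hm ψ _ ih =>
    obtain ⟨ζ, _, P, hP, h⟩ := ih hk
    -- In sort `0` the variable can only be the zero vector, which is substituted.
    by_cases hm0 : m = 0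
    · subst hm0
      let U : (Σ a, PlIdx d (extSort s 0 a)) ⊕ ζ → FunFam.{u} ((Σ a, PlIdx d (s a)) ⊕ ζ)
        | Sum.inl ⟨none, _⟩ => fun _ _ _ => 0
        | Sum.inl ⟨some a, I⟩ => fun _ _ r => r (Sum.inl ⟨a, I⟩)
        | Sum.inr z => fun _ _ r => r (Sum.inr z)
      refine ⟨ζ, inferInstance, fun F _ r => P F fun x => U x F r, hP.subst ?_, fun F _ r => ?_⟩
      · rintro (⟨_ | a, I⟩ | z)
        · exact .zero
        · exact .var _
        · exact .var _
      have hU : ∀ z : ζ → F, (fun x => U x F (Sum.elim (fun x => r x.1 x.2) z)) =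
          Sum.elim (fun x => extVal r (0 : PlIdx d 0 → F) x.1 x.2) z := by
        intro z
        funext x
        rcases x with ⟨_ | a, I⟩ | z <;> rfl
      simp only [GrForm.Holds, mem_Gr_zero_iff, exists_eq_left, hU]
      exact h F _
    -- The new variable is replaced by a scalar multiple of the minors of `m` vectors, as in
    -- `mem_Gr_iff`; the nonvanishing condition is added to `P`.
    · let U : (Σ a, PlIdx d (extSort s m a)) ⊕ ζ →
          FunFam.{u} ((Σ a, PlIdx d (s a)) ⊕ ((Unit ⊕ (Fin m × Fin d)) ⊕ ζ))
        | Sum.inl ⟨none, I⟩ => fun _ _ r => r (Sum.inr (Sum.inl (Sum.inl ()))) *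
            minors (fun j i => r (Sum.inr (Sum.inl (Sum.inr (j, i))))) id I
        | Sum.inl ⟨some a, I⟩ => fun _ _ r => r (Sum.inl ⟨a, I⟩)
        | Sum.inr z => fun _ _ r => r (Sum.inr (Sum.inr z))
      have hU1 : ∀ x, IsRat (U x) := by
        rintro (⟨_ | a, I⟩ | z)
        · exact .mul (.var _) (isRat_minors (c := fun j i F _ r =>
            r (Sum.inr (Sum.inl (Sum.inr (j, i))))) (fun j i => .var _) I)
        · exact .var _
        · exact .var _
      refine ⟨(Unit ⊕ (Fin m × Fin d)) ⊕ ζ, inferInstance, fun F _ r =>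
        (∃ I : PlIdx d m, ¬ U (Sum.inl ⟨none, I⟩) F r = 0) ∧ P F fun x => U x F r,
        (IsRatQF.exists_finite fun I : PlIdx d m => (IsRatQF.eqn (hU1 (Sum.inl ⟨none, I⟩))).not).and
          (hP.subst hU1), fun F _ r => ?_⟩
      have hU : ∀ (t : Unit → F) (B : Fin m × Fin d → F) (z : ζ → F),
          (fun x => U x F (Sum.elim (fun x => r x.1 x.2) (Sum.elim (Sum.elim t B) z))) =
          Sum.elim (fun x => extVal r (t () • minors (fun j i => B (j, i)) id) x.1 x.2) z := by
        intro t B z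
        funext x
        rcases x with ⟨_ | a, I⟩ | z <;> rfl
      have hU2 : ∀ (t : Unit → F) (B : Fin m × Fin d → F) (z : ζ → F),
          (∃ I : PlIdx d m, ¬ U (Sum.inl ⟨none, I⟩) F
            (Sum.elim (fun x => r x.1 x.2) (Sum.elim (Sum.elim t B) z)) = 0) ↔
          t () • minors (fun j i => B (j, i)) id ≠ (0 : PlIdx d m → F) := by
        intro t B z
        rw [Function.ne_iff]
        rfl
      constructor
      · rintro ⟨x, hx, hψ⟩
        obtain ⟨hx0, t, B, rfl⟩ := (mem_Gr_iff hm0).1 hx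
        obtain ⟨z, hz⟩ := (h F _).1 hψ
        refine ⟨Sum.elim (Sum.elim (fun _ => t) fun y => B y.1 y.2) z, (hU2 _ _ _).2 hx0, ?_⟩
        rw [hU]
        exact hz
      · rintro ⟨z, hz⟩
        rw [← Sum.elim_comp_inl_inr z, ← Sum.elim_comp_inl_inr (z ∘ Sum.inl), hU2, hU] at hz
        exact ⟨_, (mem_Gr_iff hm0).2 ⟨hz.1, _, _, rfl⟩, (h F _).2 ⟨_, hz.2⟩⟩
  | all => simp at hk
  | switch _ ih => exact ih (Or.inr (by omega))

end Existential

/-! ### From coordinates to lattice formulas: (B)(ii) -/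

section LatticeDescriptions

variable {d : ℕ} {ι : Type} (dv : ι → ℕ)

/-- The columns of normalized matrices subject to a Boolean combination of equations, together
with their spans, are described by lattice equations over frames. -/
theorem IsRatQF.exists_terms_entrySpan (hd : 3 ≤ d) [Finite ι] {ζ : Type} [Finite ζ]
    {P : PredFam.{u} ((Σ k, PlIdx d (dv k)) ⊕ ζ)} (hP : IsRatQF P) :
    ∃ (T S : List (latLang.Term ((Fin d × Fin d) ⊕ ((Σ k, Fin d × Fin (dv k)) ⊕ ζ))))
      (t : ι → latLang.Term ((Fin d × Fin d) ⊕ ((Σ k, Fin d × Fin (dv k)) ⊕ ζ))),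
      ∀ (F : Type u) (V : Type v) [Field F] [AddCommGroup V] [Module F V],
        Module.finrank F V = d →
        (∀ y, y ∈ eqSet (Submodule F V) T S ↔ ∃ (b : Module.Basis (Fin d) F V) (c : _) (z : ζ → F),
          y = frameVal hd b (Sum.elim c z) ∧ IsNormalized dv c ∧
            P F (Sum.elim (fun x => entryMinors dv c x.1 x.2) z)) ∧
        ∀ (b : Module.Basis (Fin d) F V) (c : _) (z : ζ → F), IsNormalized dv c → ∀ k,
          latEval (t k) (frameVal hd b (Sum.elim c z)) = entrySpan dv b c k := by
  classical
  let m : (Σ k, PlIdx d (dv k)) → FunFam.{u} ((Σ k, Fin d × Fin (dv k)) ⊕ ζ) := fun x F _ r =>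
    entryMinors dv (fun e => r (Sum.inl e)) x.1 x.2
  have hm : ∀ x, IsRat (m x) := by
    rintro ⟨k, I⟩
    by_cases hk : dv k = 0
    · exact IsRat.zero.congr fun F _ r => by simp [m, entryMinors, hk]
    · exact (isRat_minors (c := fun j p F _ r => r (Sum.inl ⟨k, p, j⟩)) (fun j p => .var _)
        I).congr fun F _ r => by simp [m, entryMinors, hk]
  let U : (Σ k, PlIdx d (dv k)) ⊕ ζ → FunFam.{u} ((Σ k, Fin d × Fin (dv k)) ⊕ ζ) :=
    Sum.elim m fun z F _ r => r (Sum.inr z)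
  have hU : ∀ x, IsRat (U x) := by
    rintro (x | x)
    · exact hm x
    · exact .var _
  -- Normalization is itself quantifier free, so frame, columns and parameters are captured by a
  -- single system of lattice equations.
  have hQ : IsRatQF.{u} fun F _ (r : (Σ k, Fin d × Fin (dv k)) ⊕ ζ → F) =>
      (∀ (k : ι) (j : Fin (dv k)), ∃ p, r (Sum.inl ⟨k, p, j⟩) = 1) ∧ P F fun x => U x F r :=
    (IsRatQF.forall_finite fun k => .forall_finite fun j => .exists_finite fun p =>
      .eq (.var _) .one).and (hP.subst hU)
  have hUe : ∀ {F : Type u} [Field F] (c : _ → F) (z : ζ → F), (fun x => U x F (Sum.elim c z)) =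
      Sum.elim (fun x => entryMinors dv c x.1 x.2) z := by
    intro F _ c z
    funext x
    rcases x with x | x <;> rfl
  obtain ⟨T, S, hTS⟩ := hQ.exists_eqSet.{u, v} hd
  have hW : ∀ k, ∃ t : latLang.Term ((Fin d × Fin d) ⊕ ((Σ k, Fin d × Fin (dv k)) ⊕ ζ)),
      ∀ (F : Type u) (V : Type v) [Field F] [AddCommGroup V] [Module F V]
        (b : Module.Basis (Fin d) F V) (r : _ → F), latEval t (frameVal hd b r) =
        ⨆ j, if ∃ p, r (Sum.inl ⟨k, p, j⟩) = 1 then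
          Submodule.span F {∑ p, r (Sum.inl ⟨k, p, j⟩) • b p} else ⊥ := fun k =>
    IsLatTerm.iSup_finite fun j => isLatTerm_span hd
      (x := fun p F _ (r : (Σ k, Fin d × Fin (dv k)) ⊕ ζ → F) => r (Sum.inl ⟨k, p, j⟩))
      fun p => .var _
  choose t ht using hW
  refine ⟨T, S, t, fun F V _ _ _ hV => ⟨fun y => ?_, fun b c z hc k => ?_⟩⟩
  · rw [← hTS F V hV]
    constructor
    · rintro ⟨b, r, rfl, hr1, hr2⟩
      obtain ⟨c, z, rfl⟩ : ∃ c z, r = Sum.elim c z := ⟨_, _, (Sum.elim_comp_inl_inr r).symm⟩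
      rw [hUe] at hr2
      exact ⟨b, c, z, rfl, hr1, hr2⟩
    · rintro ⟨b, c, z, rfl, hc, h⟩
      exact ⟨b, _, rfl, hc, by rwa [hUe]⟩
  · rw [ht]
    exact iSup_congr fun j => if_pos (hc k j)

/-- Bi-invariant sets given by existential conditions on the coordinates have existential
descriptions in the lattice. -/
theorem IsRatQF.exists_terms_thetaGL (hd : 3 ≤ d) [Finite ι] {ζ : Type} [Finite ζ]
    {P : PredFam.{u} ((Σ k, PlIdx d (dv k)) ⊕ ζ)} (hP : IsRatQF P) :
    ∃ (γ : Type) (_ : Finite γ) (T S : List (latLang.Term γ)) (t : ι → latLang.Term γ),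
      ∀ (F : Type u) (V : Type v) [Field F] [AddCommGroup V] [Module F V]
        (b : Module.Basis (Fin d) F V) (Δ : Set (∀ k, PlIdx d (dv k) → F)), BiInvariant Δ →
        Δ = {r | r ∈ GrProd F d dv ∧ ∃ z : ζ → F, P F (Sum.elim (fun x => r x.1 x.2) z)} →
        ∀ w ∈ dimSet F V dv, w ∈ thetaGL b dv Δ ↔
          ∃ y ∈ eqSet (Submodule F V) T S, ∀ k, w k = latEval (t k) y := by
  obtain ⟨T, S, t, h⟩ := hP.exists_terms_entrySpan.{u, v} dv hd
  refine ⟨_, inferInstance, T, S, t, fun F V _ _ _ b Δ hΔ hΔ' w hw => ?_⟩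
  obtain ⟨h1, h2⟩ := h F V (by rw [Module.finrank_eq_card_basis b, Fintype.card_fin])
  rw [mem_thetaGL_iff dv b hΔ hΔ' hw]
  constructor
  · rintro ⟨b', c, hc, ⟨z, hz⟩, rfl⟩
    exact ⟨_, (h1 _).2 ⟨b', c, z, rfl, hc, hz⟩, fun k => (h2 b' c z hc k).symm⟩
  · rintro ⟨y, hy, hw'⟩
    obtain ⟨b', c, z, rfl, hc, hz⟩ := (h1 _).1 hy
    exact ⟨b', c, hc, ⟨z, hz⟩, funext fun k => (hw' k).trans (h2 b' c z hc k)⟩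

/-- Translation of ring formulas defining bi-invariant sets into lattice formulas. -/
theorem exists_latFormula_thetaGL (hd : 3 ≤ d) [Finite ι]
    (χ : Language.ring.Formula (Σ k, PlIdx d (dv k))) :
    ∃ φ : latLang.Formula ι, (PrenexClass true 1 χ → PrenexClass true 1 φ) ∧
      ∀ (F : Type u) (V : Type v) [Field F] [AddCommGroup V] [Module F V]
        (b : Module.Basis (Fin d) F V) (Δ : Set (∀ k, PlIdx d (dv k) → F)), BiInvariant Δ →
        Δ = ringDefined F dv χ → thetaGL b dv Δ = {w | w ∈ dimSet F V dv ∧ LatHolds φ w} := by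
  have := Fintype.ofFinite ι
  suffices h : ∃ φ : latLang.Formula ι, (PrenexClass true 1 χ → PrenexClass true 1 φ) ∧
      ∀ (F : Type u) (V : Type v) [Field F] [AddCommGroup V] [Module F V]
        (b : Module.Basis (Fin d) F V) (Δ : Set (∀ k, PlIdx d (dv k) → F)), BiInvariant Δ →
        Δ = ringDefined F dv χ → ∀ w ∈ dimSet F V dv, w ∈ thetaGL b dv Δ ↔ LatHolds φ w by
    obtain ⟨φ, hφ, h⟩ := h
    refine ⟨φ, hφ, fun F V _ _ _ b Δ hΔ hΔ' => ?_⟩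
    ext w
    exact ⟨fun hw => have hw' := thetaGL_subset_dimSet b dv Δ hw
      ⟨hw', (h F V b Δ hΔ hΔ' w hw').1 hw⟩, fun hw => (h F V b Δ hΔ hΔ' w hw.1).2 hw.2⟩
  let eqs {γ : Type} (t : ι → latLang.Term γ) :
      List (latLang.Term (ι ⊕ γ) × latLang.Term (ι ⊕ γ)) :=
    Finset.univ.toList.map fun k => (Term.var (Sum.inl k), (t k).relabel Sum.inr)
  have heqs : ∀ {γ : Type} (t : ι → latLang.Term γ) {F : Type u} {V : Type v} [Field F]
      [AddCommGroup V] [Module F V] (w : ι → Submodule F V) (y : γ → Submodule F V),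
      (∀ e ∈ eqs t, latEval e.1 (Sum.elim w y) = latEval e.2 (Sum.elim w y)) ↔
        ∀ k, w k = latEval (t k) y := by
    intro γ t F V _ _ _ w y
    simp only [eqs, List.forall_mem_map, Finset.mem_toList, Finset.mem_univ, forall_const,
      latEval_relabel]
    rfl
  have hTS : ∀ {γ : Type} (T S : List (latLang.Term γ)) {F : Type u} {V : Type v} [Field F]
      [AddCommGroup V] [Module F V] (w : ι → Submodule F V) (y : γ → Submodule F V),
      LatHolds ((latConj (eqPairs T S)).relabel Sum.inr) (Sum.elim w y) ↔
        y ∈ eqSet (Submodule F V) T S := by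
    intro γ T S F V _ _ _ w y
    rw [latHolds_relabel, latHolds_latConj, forall_mem_eqPairs]
    rfl
  -- For `Σ_1` formulas the witnesses become additional field coordinates over the frame, leaving
  -- only equations under one existential block. Otherwise only the frame and the columns are
  -- guessed, and the formula is translated over that frame with its quantifiers.
  by_cases hχ : PrenexClass true 1 χ
  · obtain ⟨ζ, _, P, hP, h⟩ := hχ.exists_isRatQF.{u} (Or.inl ⟨rfl, le_rfl⟩)
    obtain ⟨γ, _, T, S, t, h'⟩ := (hP.subst (U := Sum.elim (Sum.elim (fun x F _ r => r (Sum.inl x))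
      fun x => x.elim0) fun z F _ r => r (Sum.inr z)) (by
        rintro ((x | x) | x)
        · exact .var _
        · exact x.elim0
        · exact .var _)).exists_terms_thetaGL.{u, v} dv hd (ζ := ζ)
    refine ⟨((latConj (eqPairs T S)).relabel Sum.inr ⊓ latConj (eqs t)).iExs γ, fun _ =>
      PrenexClass.iExs (.qf (.inf ?_ (isQF_latConj _))), fun F V _ _ _ b Δ hΔ hΔ' w hw => ?_⟩
    · exact (isQF_latConj _).relabel _
    · rw [h' F V b Δ hΔ ?_ w hw, latHolds_iExs]
      · refine exists_congr fun y => ?_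
        rw [← hTS T S w y, ← heqs t w y, ← latHolds_latConj]
        exact latHolds_inf.symm
      · rw [hΔ']
        ext r
        refine and_congr_right fun _ => ?_
        rw [ringHolds_iff default, h]
        refine exists_congr fun z => ?_
        refine iff_of_eq (congrArg (P F) ?_)
        funext x
        rcases x with (x | x) | x
        · rfl
        · exact x.elim0
        · rfl
  · obtain ⟨T, S, t, h⟩ := IsRatQF.true.exists_terms_entrySpan.{u, v} dv hd (ζ := Empty)
    obtain ⟨φ, hφ⟩ := exists_latFormula.{u, v} hd χ ((Σ k, Fin d × Fin (dv k)) ⊕ Empty)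
      (U := fun x F _ r => entryMinors dv (fun e => r (Sum.inl e)) x.1 x.2) (X := default) (by
        rintro ⟨k, I⟩
        by_cases hk : dv k = 0
        · exact IsRat.zero.congr fun F _ r => by simp [entryMinors, hk]
        · exact (isRat_minors (c := fun j p F _ r => r (Sum.inl ⟨k, p, j⟩)) (fun j p => .var _)
            I).congr fun F _ r => by simp [entryMinors, hk]) fun x => x.elim0
    refine ⟨((latConj (eqPairs T S)).relabel Sum.inr ⊓ (latConj (eqs t) ⊓
      φ.relabel Sum.inr)).iExs _, fun h => absurd h hχ, fun F V _ _ _ b Δ hΔ hΔ' w hw => ?_⟩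
    obtain ⟨h1, h2⟩ := h F V (by rw [Module.finrank_eq_card_basis b, Fintype.card_fin])
    rw [mem_thetaGL_iff dv b hΔ hΔ' hw, latHolds_iExs]
    have h3 : ∀ y, LatHolds ((latConj (eqPairs T S)).relabel Sum.inr ⊓ (latConj (eqs t) ⊓
        φ.relabel Sum.inr)) (Sum.elim w y) ↔ y ∈ eqSet (Submodule F V) T S ∧
          (∀ k, w k = latEval (t k) y) ∧ LatHolds φ y := by
      intro y
      rw [← hTS T S w y, ← heqs t w y, ← latHolds_latConj]
      exact latHolds_inf.trans (and_congr_right fun _ => latHolds_inf.trans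
        (and_congr_right fun _ => latHolds_relabel))
    simp only [h3]
    constructor
    · rintro ⟨b', c, hc, hχ, rfl⟩
      refine ⟨_, (h1 _).2 ⟨b', c, Empty.elim, rfl, hc, trivial⟩,
        fun k => (h2 b' c _ hc k).symm, ?_⟩
      rw [hφ]
      exact (ringHolds_iff _).1 hχ
    · rintro ⟨y, hy, hw', hy'⟩
      obtain ⟨b', c, z, rfl, hc, -⟩ := (h1 _).1 hy
      rw [hφ] at hy'
      exact ⟨b', c, hc, (ringHolds_iff _).2 hy', funext fun k => (hw' k).trans (h2 b' c z hc k)⟩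

end LatticeDescriptions

/-! ### Existential descriptions of point configurations: (D) -/

section Points

variable {d : ℕ}

/-- Homogeneous existential formulas on points correspond to existentially quantified conjunctions
of lattice equations. -/
theorem homogeneous_existential_iff (hd : 3 ≤ d) {n : ℕ} {F : Type u} [Field F]
    (S : Set (Fin n → PlIdx d 1 → F)) :
    (BiInvariant (dv := fun _ => 1) S ∧
      ∃ ψ : GrForm d (Fin n) (fun _ => 1), ψ.IsHomogeneous ∧ GrForm.PrenexClass true 1 ψ ∧
        S = ψ.defined F) ↔
    ∃ M : Set (Fin n → Submodule F (Fin d → F)),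
      (∃ (m : ℕ) (T T' : List (latLang.Term (Fin n ⊕ Fin m))),
        M = {w | w ∈ dimSet F (Fin d → F) (fun _ => 1) ∧
          ∃ y : Fin m → Submodule F (Fin d → F), Sum.elim w y ∈ eqSet _ T T'}) ∧
      S = thetaLG (Pi.basisFun F (Fin d)) (fun _ => 1) M := by
  constructor
  · rintro ⟨hS, ψ, -, hψ, hSψ⟩
    obtain ⟨ζ, _, P, hP, h⟩ := hψ.exists_isRatQF.{u} (Or.inl ⟨rfl, le_rfl⟩)
    obtain ⟨γ, _, T, S', t, h'⟩ := hP.exists_terms_thetaGL.{u, u} (fun _ => 1) hd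
    have hS' : S = {r | r ∈ GrProd F d (fun _ => 1) ∧
        ∃ z : ζ → F, P F (Sum.elim (fun x => r x.1 x.2) z)} := by
      rw [hSψ]
      ext r
      exact and_congr_right fun _ => h F r
    refine ⟨thetaGL (Pi.basisFun F (Fin d)) (fun _ => 1) S, ?_, (thetaLG_thetaGL _ _ hS
      (by rw [hSψ]; exact fun r hr => hr.1)).symm⟩
    have := Fintype.ofFinite γ
    -- The quantified variables comprise those in `γ` and, for each point, one intended as a
    -- complement.
    let e := Fintype.equivFin (γ ⊕ Fin n)
    let f : γ → Fin n ⊕ Fin (Fintype.card (γ ⊕ Fin n)) := fun g => Sum.inr (e (Sum.inl g))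
    have hv : ∀ k, IsTermOp.{u, u} fun F V _ _ _ w => latEval (t k) fun g => w (f g) := fun k =>
      ⟨(t k).relabel f, fun F V _ _ _ w => latEval_relabel w f (t k)⟩
    have hc : ∀ k, IsTermOp.{u, u} fun F V _ _ _ w =>
        w (Sum.inr (e (Sum.inr k)) : Fin n ⊕ Fin (Fintype.card (γ ⊕ Fin n))) := fun k => .var _
    have h0 : IsEqDef.{u, u} fun F V _ _ _ w => (fun g => w (f g)) ∈ eqSet (Submodule F V) T S' :=
      ⟨T.map (Term.relabel f), S'.map (Term.relabel f), fun F V _ _ _ w => by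
        simp only [eqSet, Set.mem_ofPred_eq, List.forall_mem_map, latEval_relabel]⟩
    -- The conditions `w k = t k` are not of the form `t = 0` or `s = 1`. Requiring the extra
    -- variables to be complements of the values of `t k` makes `IsEqDef.and_forall_eq` applicable.
    obtain ⟨T₁, T₂, hT⟩ := (h0.and (.forall_finite fun k =>
      (IsEqDef.eq_bot ((hv k).inf (hc k))).and (.eq_top ((hv k).sup (hc k))))).and_forall_eq
        (fun k : Fin n => .var (Sum.inl k)) hv hc fun k F V _ _ _ w hw =>
          ⟨disjoint_iff.2 (hw.2 k).1, codisjoint_iff.2 (hw.2 k).2⟩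
    refine ⟨_, T₁, T₂, ?_⟩
    ext w
    have key : w ∈ dimSet F (Fin d → F) (fun _ => 1) →
        (w ∈ thetaGL (Pi.basisFun F (Fin d)) (fun _ => 1) S ↔
          ∃ y : Fin _ → Submodule F (Fin d → F), Sum.elim w y ∈ eqSet _ T₁ T₂) := by
      intro hw
      rw [h' F _ _ S hS hS' w hw]
      simp only [← hT]
      constructor
      · rintro ⟨y, hy, hw'⟩
        choose c hc using fun k => exists_isCompl (w k)
        have hy' : (fun g => Sum.elim w (fun i => Sum.elim y c (e.symm i)) (f g)) = y := by
          funext g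
          simp [f]
        refine ⟨fun i => Sum.elim y c (e.symm i), ⟨?_, fun k => ?_⟩, fun k => ?_⟩
        · rwa [hy']
        · rw [hy', ← hw']
          simp [(hc k).inf_eq_bot, (hc k).sup_eq_top]
        · rw [hy']
          exact hw' k
      · rintro ⟨y, ⟨hy, -⟩, hw'⟩
        exact ⟨_, hy, hw'⟩
    exact ⟨fun hw => have hw' := thetaGL_subset_dimSet _ _ _ hw
      ⟨hw', (key hw').1 hw⟩, fun hw => (key hw.1).2 hw.2⟩
  · rintro ⟨M, ⟨m, T, T', hM⟩, hS⟩
    let φ : latLang.Formula (Fin n) := (latConj (eqPairs T T')).iExs (Fin m)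
    have hφ : PrenexClass true 1 φ := PrenexClass.iExs (.qf (isQF_latConj _))
    have hMφ : M = {w | w ∈ dimSet F (Fin d → F) (fun _ => 1) ∧ LatHolds φ w} := by
      rw [hM]
      ext w
      refine and_congr_right fun _ => ?_
      rw [latHolds_iExs]
      exact exists_congr fun y => by rw [latHolds_latConj, forall_mem_eqPairs]
    obtain ⟨ψ, h1, h2, h3⟩ := hφ.exists_grForm_thetaLG.{u} (d := d) (fun _ => 1) fun _ => by omega
    rw [hS, hMφ]
    exact ⟨biInvariant_thetaLG _ _ (latInvariant_latHolds _ φ), ψ, h1, h2, by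
      rw [thetaLG_dimSet_latHolds, h3]⟩

end Points

/-! ### Relations without simple coordinate descriptions: (F) -/

section NonDefinability

variable {d : ℕ} {ν : Type}

/-- Vectors spanning the elements of the canonical frame and elements of its field with given
coordinates. -/
def frameVec (hd : 3 ≤ d) {R : Type*} [CommRing R] (r : ν → R) : (Fin d × Fin d) ⊕ ν → Fin d → R :=
  Sum.elim (fun x => if x.1 = x.2 then Pi.single x.1 1 else Pi.single x.2 1 - Pi.single x.1 1)
    fun k => Pi.single ⟨0, by omega⟩ 1 - r k • Pi.single ⟨1, by omega⟩ 1

/-- The homogeneous coordinates of the points spanned by `frameVec`. -/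
def framePoint (hd : 3 ≤ d) {R : Type*} [CommRing R] (r : ν → R) :
    (Fin d × Fin d) ⊕ ν → PlIdx d 1 → R :=
  fun a I => frameVec hd r a (I 0)

theorem map_framePoint (hd : 3 ≤ d) {R S : Type*} [CommRing R] [CommRing S] (f : R →+* S)
    (r : ν → R) (a : (Fin d × Fin d) ⊕ ν) (I : PlIdx d 1) :
    f (framePoint hd r a I) = framePoint hd (fun k => f (r k)) a I := by
  rcases a with ⟨i, j⟩ | k
  · simp only [framePoint, frameVec, Sum.elim_inl]
    split_ifs <;> simp [Pi.single_apply, apply_ite f]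
  · simp [framePoint, frameVec, Pi.single_apply, apply_ite f]

variable {F : Type*} [Field F]

theorem span_frameVec (hd : 3 ≤ d) (r : ν → F) (a : (Fin d × Fin d) ⊕ ν) :
    Submodule.span F {frameVec hd r a} = frameVal hd (Pi.basisFun F (Fin d)) r a := by
  rcases a with ⟨i, j⟩ | k
  · by_cases h : i = j
    · subst h
      simp [frameVec, frameVal, basisFrame_self]
    · simp [frameVec, frameVal, basisFrame_of_ne _ h, h]
  · simp [frameVec, frameVal, frameCoord]

theorem frameVal_ne_bot (hd : 3 ≤ d) {V : Type*} [AddCommGroup V] [Module F V]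
    (b : Module.Basis (Fin d) F V) (r : ν → F) (a : (Fin d × Fin d) ⊕ ν) :
    frameVal hd b r a ≠ ⊥ := by
  have h : ∀ {i j : Fin d}, i ≠ j → ∀ s : F, Submodule.span F {b j - s • b i} ≠ ⊥ := by
    intro i j hij s hs
    have h1 := congrArg (b.coord j) (Submodule.span_singleton_eq_bot.1 hs)
    simp [hij] at h1
  rcases a with ⟨i, j⟩ | k
  · by_cases hij : i = j
    · subst hij
      rw [frameVal, Sum.elim_inl, basisFrame_self, Ne, Submodule.span_singleton_eq_bot]
      exact b.ne_zero i
    · rw [frameVal, Sum.elim_inl, basisFrame_of_ne _ hij]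
      simpa using h hij 1
  · exact h (by simp) _

theorem framePoint_mem_GrProd (hd : 3 ≤ d) (r : ν → F) :
    framePoint hd r ∈ GrProd F d (fun _ => 1) ∧ ∀ a, ofCoord (Pi.basisFun F (Fin d))
      (subGr 1 (framePoint hd r a)) = frameVal hd (Pi.basisFun F (Fin d)) r a := by
  have h1 : ∀ a, LinearIndependent F fun _ : Fin 1 => frameVec hd r a := fun a => by
    rw [linearIndependent_unique_iff]
    intro h
    have := frameVal_ne_bot hd (Pi.basisFun F (Fin d)) r a
    rw [← span_frameVec, h] at this
    simp at this
  have h2 : ∀ a, framePoint hd r a = minors (fun _ : Fin 1 => frameVec hd r a) id := fun a => by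
    funext I
    simp [framePoint, minors]
  constructor
  · intro a
    rw [h2]
    exact minors_mem_Gr one_ne_zero (h1 a)
  · intro a
    rw [h2, subGr_minors (h1 a), ← span_frameVec, ofCoord_apply, Set.range_const,
      Submodule.map_span, Set.image_singleton]
    congr 2

/-- By `frameCoord_inf` the vanishing of a coordinate is visible in the lattice, independently of
the corresponding basis. -/
theorem frameVal_eq_zero_iff (hd : 3 ≤ d) {V : Type*} [AddCommGroup V] [Module F V]
    {b b' : Module.Basis (Fin d) F V} {r r' : ν → F} (h : frameVal hd b r = frameVal hd b' r')
    (k : ν) : r k = 0 ↔ r' k = 0 := by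
  classical
  have hne : (⟨1, by omega⟩ : Fin d) ≠ ⟨0, by omega⟩ := by simp
  have h0 : basisFrame b ⟨0, by omega⟩ ⟨0, by omega⟩ = basisFrame b' ⟨0, by omega⟩ ⟨0, by omega⟩ :=
    congrFun h (Sum.inl (⟨0, by omega⟩, ⟨0, by omega⟩))
  have h1 : frameCoord b ⟨1, by omega⟩ ⟨0, by omega⟩ (r k) =
    frameCoord b' ⟨1, by omega⟩ ⟨0, by omega⟩ (r' k) := congrFun h (Sum.inr k)
  have h2 := frameCoord_inf b hne (r k)
  rw [h1, h0, frameCoord_inf b' hne] at h2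
  have h3 : basisFrame b' ⟨0, by omega⟩ ⟨0, by omega⟩ ≠ ⊥ :=
    frameVal_ne_bot hd b' r' (Sum.inl (⟨0, by omega⟩, ⟨0, by omega⟩))
  split_ifs at h2 with h4 h5 h5
  · exact iff_of_true h5 h4
  · exact absurd h2 h3
  · exact absurd h2.symm h3
  · exact iff_of_false h5 h4

/-- For relations depending only on which arguments vanish, formulas defining the relation of the
frames can be evaluated at the points of the canonical frame. -/
theorem holds_framePoint_iff (hd : 3 ≤ d) {R : Set (ν → F)}
    (hR : ∀ r r' : ν → F, (∀ k, r k = 0 ↔ r' k = 0) → r' ∈ R → r ∈ R)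
    {ψ : GrForm d ((Fin d × Fin d) ⊕ ν) fun _ => 1}
    (h : thetaLG (Pi.basisFun F (Fin d)) (fun _ => 1) (frameRel (Fin d → F) hd R) = ψ.defined F)
    (r : ν → F) : ψ.Holds F (framePoint hd r) ↔ r ∈ R := by
  obtain ⟨h1, h2⟩ := framePoint_mem_GrProd hd r
  have h3 : ψ.Holds F (framePoint hd r) ↔ framePoint hd r ∈ ψ.defined F :=
    ⟨fun h => ⟨h1, h⟩, fun h => h.2⟩
  rw [h3, ← h, thetaLG_eq, frameRel_eq]
  have h4 : (fun a => ofCoord (Pi.basisFun F (Fin d)) (subGr 1 (framePoint hd r a))) =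
    frameVal hd (Pi.basisFun F (Fin d)) r := funext h2
  constructor
  · rintro ⟨-, b, r', hr', hr'R⟩
    exact hR r r' (frameVal_eq_zero_iff hd (h4.symm.trans hr')) hr'R
  · exact fun hr => ⟨h1, _, r, h4, hr⟩

open Polynomial in
/-- Along a curve of points with polynomial coordinates, an equation is satisfied always or only
finitely often. -/
theorem finite_or_forall_aeval_framePoint (hd : 3 ≤ d) (g : ν → F[X])
    (p : MvPolynomial (Σ _ : (Fin d × Fin d) ⊕ ν, PlIdx d 1) ℤ) :
    {s : F | MvPolynomial.aeval (fun x : Σ _ : (Fin d × Fin d) ⊕ ν, PlIdx d 1 =>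
      framePoint hd (fun k => (g k).eval s) x.1 x.2) p = 0}.Finite ∨
    ∀ s : F, MvPolynomial.aeval (fun x : Σ _ : (Fin d × Fin d) ⊕ ν, PlIdx d 1 =>
      framePoint hd (fun k => (g k).eval s) x.1 x.2) p = 0 := by
  let q : F[X] := MvPolynomial.aeval (fun x : Σ _ : (Fin d × Fin d) ⊕ ν, PlIdx d 1 =>
    framePoint hd g x.1 x.2) p
  have hq : ∀ s : F, MvPolynomial.aeval (fun x : Σ _ : (Fin d × Fin d) ⊕ ν, PlIdx d 1 =>
      framePoint hd (fun k => (g k).eval s) x.1 x.2) p = q.eval s := by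
    intro s
    have h1 := MvPolynomial.comp_aeval_apply (f := fun x : Σ _ : (Fin d × Fin d) ⊕ ν, PlIdx d 1 =>
      framePoint hd g x.1 x.2) (evalRingHom s).toIntAlgHom p
    refine Eq.trans ?_ h1.symm
    congr 2
    funext x
    exact (map_framePoint hd (evalRingHom s) g x.1 x.2).symm
  simp only [hq]
  by_cases h : q = 0
  · exact Or.inr fun s => by rw [h, eval_zero]
  · exact Or.inl (finite_setOfPred_isRoot h)

/-- The alternative "finitely often or always" passes to conjunctions and disjunctions, though not
to negations. -/
theorem GrForm.finite_or_forall_holds_framePoint (hd : 3 ≤ d) (g : ν → Polynomial F)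
    {ψ : GrForm d ((Fin d × Fin d) ⊕ ν) fun _ => 1} (h : ψ.IsQF) (h' : ψ.IsPositive) :
    {s : F | ψ.Holds F (framePoint hd fun k => (g k).eval s)}.Finite ∨
      ∀ s : F, ψ.Holds F (framePoint hd fun k => (g k).eval s) := by
  suffices key : ∀ (α : Type) (dv : α → ℕ) (ψ : GrForm d α dv) (X : F → ∀ a, PlIdx d (dv a) → F),
      (∀ p : MvPolynomial (Σ a, PlIdx d (dv a)) ℤ,
        {s | MvPolynomial.aeval (fun x => X s x.1 x.2) p = 0}.Finite ∨
          ∀ s, MvPolynomial.aeval (fun x => X s x.1 x.2) p = 0) → ψ.IsQF → ψ.IsPositive →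
      {s | ψ.Holds F (X s)}.Finite ∨ ∀ s, ψ.Holds F (X s) from
    key _ _ ψ (fun s => framePoint hd fun k => (g k).eval s)
      (finite_or_forall_aeval_framePoint hd g) h h'
  clear h h' ψ
  intro α dv ψ X hX h h'
  induction ψ with
  | bot => exact Or.inl (by simp [Holds])
  | top => exact Or.inr fun s => trivial
  | eqn p => exact hX p
  | not => exact h'.elim
  | and ψ ψ' ih ih' =>
    rcases ih X hX h.1 h'.1 with h1 | h1
    · exact Or.inl (h1.subset fun s hs => hs.1)
    rcases ih' X hX h.2 h'.2 with h2 | h2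
    · exact Or.inl (h2.subset fun s hs => hs.2)
    · exact Or.inr fun s => ⟨h1 s, h2 s⟩
  | or ψ ψ' ih ih' =>
    rcases ih X hX h.1 h'.1 with h1 | h1
    · rcases ih' X hX h.2 h'.2 with h2 | h2
      · exact Or.inl (h1.union h2)
      · exact Or.inr fun s => Or.inr (h2 s)
    · exact Or.inr fun s => Or.inl (h1 s)
  | ex => exact h.elim
  | all => exact h.elim

/-- Invertibility of a coordinate has no positive quantifier free description. -/
theorem not_exists_isPositive [Infinite F] (hd : 3 ≤ d) :
    ¬ ∃ ψ : GrForm d ((Fin d × Fin d) ⊕ Fin 1) (fun _ => 1), ψ.IsQF ∧ ψ.IsPositive ∧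
      thetaLG (Pi.basisFun F (Fin d)) (fun _ => 1)
        (frameRel (Fin d → F) hd {r : Fin 1 → F | r 0 ≠ 0}) = ψ.defined F := by
  rintro ⟨ψ, h1, h2, h3⟩
  have h4 := holds_framePoint_iff hd (fun r r' h hr' => (not_congr (h 0)).2 hr') h3
  have h5 : ∀ s : F, ψ.Holds F (framePoint hd fun _ => (Polynomial.X : Polynomial F).eval s) ↔
      s ≠ 0 := fun s => by
    rw [h4, Polynomial.eval_X]
    exact Iff.rfl
  -- Along the curve with coordinate `s`, the formula would hold exactly for `s ≠ 0`: infinitely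
  -- often, but not always.
  rcases GrForm.finite_or_forall_holds_framePoint hd
    (fun _ => (Polynomial.X : Polynomial F)) h1 h2 with h | h
  · exact (Set.finite_singleton (0 : F)).infinite_compl (h.subset fun s hs => (h5 s).2 hs)
  · exact (h5 0).1 (h 0) rfl

/-- Each literal holds at `(s, 0)` for all but finitely many `s`, hence so does the conjunction. But
these points violate the relation for `s ≠ 0`. -/
theorem GrForm.IsConjLiterals.finite_not_holds [Infinite F] (hd : 3 ≤ d)
    {ψ : GrForm d ((Fin d × Fin d) ⊕ Fin 2) fun _ => 1} (hψ : ψ.IsConjLiterals)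
    (h : ∀ r : Fin 2 → F, r 0 = 0 ∨ r 1 ≠ 0 → ψ.Holds F (framePoint hd r)) :
    {s : F | ¬ ψ.Holds F (framePoint hd ![s, 0])}.Finite := by
  have eval0 : ∀ s : F, (fun k => ((![Polynomial.X, 0] : Fin 2 → Polynomial F) k).eval s) =
      ![s, 0] := fun s => by
    funext k
    fin_cases k <;> simp
  have eval1 : ∀ t s : F, (fun k => ((![Polynomial.C t, Polynomial.X] : Fin 2 → Polynomial F)
      k).eval s) = ![t, s] := fun t s => by
    funext k
    fin_cases k <;> simp
  induction hψ with
  | @lit ψ hψ =>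
    cases ψ with
    | bot => exact (h 0 (Or.inl rfl)).elim
    | top => simp [Holds]
    | eqn p =>
      -- For fixed `t`, the equation holds at `(t, s)` for the infinitely many `s ≠ 0`, hence also
      -- at `s = 0`.
      have h1 : ∀ t : F, (GrForm.eqn p).Holds F (framePoint hd ![t, 0]) := by
        intro t
        rcases finite_or_forall_aeval_framePoint hd ![Polynomial.C t, Polynomial.X] p with h2 | h2
        · simp only [eval1] at h2
          refine ((Set.finite_singleton (0 : F)).infinite_compl (h2.subset fun s hs => ?_)).elim
          exact h ![t, s] (Or.inr hs)
        · have := h2 0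
          rwa [eval1] at this
      convert Set.finite_empty
      ext s
      simp [h1 s]
    | not ψ =>
      cases ψ with
      | eqn p =>
        -- The negated equation holds at `(0, 0)`, so its polynomial is not identically zero along
        -- `(s, 0)`.
        rcases finite_or_forall_aeval_framePoint hd (![Polynomial.X, 0] : Fin 2 → Polynomial F) p with h2 | h2
        · simp only [eval0] at h2
          exact h2.subset fun s hs => not_not.1 hs
        · have := h2 0
          rw [eval0] at this
          exact (h ![0, 0] (Or.inl rfl) this).elim
      | _ => exact hψ.elim
    | _ => exact hψ.elim
  | and _ _ ih ih' =>
    refine ((ih fun r hr => (h r hr).1).union (ih' fun r hr => (h r hr).2)).subset fun s hs => ?_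
    exact not_and_or.1 hs

/-- The relation `x₁ = 0 ∨ x₂ ≠ 0` has no description by a conjunction of equations and negated
equations. -/
theorem not_exists_isConjLiterals [Infinite F] (hd : 3 ≤ d) :
    ¬ ∃ ψ : GrForm d ((Fin d × Fin d) ⊕ Fin 2) (fun _ => 1), ψ.IsConjLiterals ∧
      thetaLG (Pi.basisFun F (Fin d)) (fun _ => 1)
        (frameRel (Fin d → F) hd {r : Fin 2 → F | r 0 = 0 ∨ r 1 ≠ 0}) = ψ.defined F := by
  rintro ⟨ψ, h1, h2⟩
  have h3 := holds_framePoint_iff hd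
    (fun r r' h hr' => hr'.imp (h 0).2 fun h' => (not_congr (h 1)).2 h') h2
  have h4 := h1.finite_not_holds hd fun r hr => (h3 r).2 hr
  refine (Set.finite_singleton (0 : F)).infinite_compl (h4.subset fun s hs h5 => ?_)
  have h6 := (h3 _).1 h5
  simp at h6
  exact hs h6

end NonDefinability

/-! ### Assembly of (A) to (F) -/

theorem corollary23 :
    -- (A) quantifier free translation from the lattice to matrices
    (∀ d : ℕ, ∃ τ : ∀ n : ℕ, latLang.Formula (Fin n) → Language.ring.Formula (Fin n × Fin d × Fin d),
      ∀ (n : ℕ) (φ : latLang.Formula (Fin n)),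
        (φ.IsQF → (τ n φ).IsQF) ∧
        ∀ (F : Type u) [Field F] (V : Type v) [AddCommGroup V] [Module F V]
          (b : Module.Basis (Fin d) F V),
          thetaLF b {w | LatHolds φ w} = {A | RingHolds (τ n φ) (fun x => A x.1 x.2.1 x.2.2)}) ∧
    -- (B) subspaces versus Grassmann-Plücker coordinates
    (∀ (d : ℕ), 3 ≤ d → ∀ (n : ℕ) (dv : Fin n → ℕ), (∀ k, dv k ≤ d) →
      (∀ (F : Type u) [Field F] (V : Type v) [AddCommGroup V] [Module F V]
        (b : Module.Basis (Fin d) F V),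
        Set.BijOn (thetaLG b dv) {M | M ⊆ dimSet F V dv ∧ LatInvariant M}
          {Δ | Δ ⊆ GrProd F d dv ∧ BiInvariant Δ}) ∧
      (∃ τ : latLang.Formula (Fin n) → Language.ring.Formula (Σ k : Fin n, PlIdx d (dv k)),
        ∀ φ : latLang.Formula (Fin n),
          (φ.IsQF → (τ φ).IsQF) ∧
          (PrenexClass true 1 φ → PrenexClass true 1 (τ φ)) ∧
          ∀ (F : Type u) [Field F] (V : Type v) [AddCommGroup V] [Module F V]
            (b : Module.Basis (Fin d) F V),
            BiInvariant (thetaLG b dv {w | w ∈ dimSet F V dv ∧ LatHolds φ w}) ∧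
            ScalarInvariantFormula F dv (τ φ) ∧
            thetaLG b dv {w | w ∈ dimSet F V dv ∧ LatHolds φ w} = ringDefined F dv (τ φ)) ∧
      (∃ τ : Language.ring.Formula (Σ k : Fin n, PlIdx d (dv k)) → latLang.Formula (Fin n),
        ∀ χ : Language.ring.Formula (Σ k : Fin n, PlIdx d (dv k)),
          (PrenexClass true 1 χ → PrenexClass true 1 (τ χ)) ∧
          ∀ (F : Type u) [Field F] (V : Type v) [AddCommGroup V] [Module F V]
            (b : Module.Basis (Fin d) F V) (Δ : Set (∀ k, PlIdx d (dv k) → F)),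
            BiInvariant Δ → Δ = ringDefined F dv χ →
              thetaGL b dv Δ = {w | w ∈ dimSet F V dv ∧ LatHolds (τ χ) w})) ∧
    -- (C) homogeneous descriptions, for a fixed dimension vector and for all of them together
    (∀ (d n : ℕ) (φ : latLang.Formula (Fin n)) (c : Bool) (k : ℕ), 1 ≤ k → PrenexClass c k φ →
      (∀ dv : Fin n → ℕ, (∀ i, dv i ≤ d) →
        ∃ ψ : GrForm d (Fin n) dv, ψ.IsHomogeneous ∧ GrForm.PrenexClass c k ψ ∧
          ∀ (F : Type u) [Field F],
            thetaLG (Pi.basisFun F (Fin d)) dv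
              {w | w ∈ dimSet F (Fin d → F) dv ∧ LatHolds φ w} = ψ.defined F) ∧
      (∃ ψ : ∀ dv : Fin n → Fin (d + 1), GrForm d (Fin n) (fun i => dv i),
        (∀ dv, (ψ dv).IsHomogeneous ∧ GrForm.PrenexClass c k (ψ dv)) ∧
        ∀ (F : Type u) [Field F],
          {x : Σ dv : Fin n → Fin (d + 1), ∀ i, PlIdx d (dv i) → F |
            x.2 ∈ thetaLG (Pi.basisFun F (Fin d)) (fun i => (x.1 i : ℕ)) {w | LatHolds φ w}} =
          {x | x.2 ∈ (ψ x.1).defined F})) ∧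
    -- (D) homogeneous existential formulas versus existential lattice formulas
    (∀ (d : ℕ), 3 ≤ d → ∀ (n : ℕ) (F : Type u) [Field F] (S : Set (Fin n → PlIdx d 1 → F)),
      (BiInvariant (dv := fun _ => 1) S ∧
        ∃ ψ : GrForm d (Fin n) (fun _ => 1), ψ.IsHomogeneous ∧ GrForm.PrenexClass true 1 ψ ∧
          S = ψ.defined F) ↔
      ∃ M : Set (Fin n → Submodule F (Fin d → F)),
        (∃ (m : ℕ) (T T' : List (latLang.Term (Fin n ⊕ Fin m))),
          M = {w | w ∈ dimSet F (Fin d → F) (fun _ => 1) ∧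
            ∃ y : Fin m → Submodule F (Fin d → F), Sum.elim w y ∈ eqSet _ T T'}) ∧
        S = thetaLG (Pi.basisFun F (Fin d)) (fun _ => 1) M) ∧
    -- (E) lattice definitions of quantifier free field relations w.r.t. frames
    (∀ (d : ℕ) (hd : 3 ≤ d) (n : ℕ) (φ : ringInvLang.Formula (Fin n)), φ.IsQF →
      ∃ T S : List (latLang.Term ((Fin d × Fin d) ⊕ Fin n)),
        ∀ (F : Type u) [Field F] (V : Type v) [AddCommGroup V] [Module F V],
          Module.finrank F V = d →
            frameRel V hd {r : Fin n → F | RingInvHolds φ r} = eqSet (Submodule F V) T S) ∧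
    -- (F) relations without certain simple descriptions in Plücker coordinates
    (∀ (d : ℕ) (hd : 3 ≤ d) (F : Subfield ℂ),
      ((¬ ∃ ψ : GrForm d ((Fin d × Fin d) ⊕ Fin 1) (fun _ => 1), ψ.IsQF ∧ ψ.IsPositive ∧
          thetaLG (Pi.basisFun F (Fin d)) (fun _ => 1)
            (frameRel (Fin d → F) hd {r : Fin 1 → F | r 0 ≠ 0}) = ψ.defined F) ∧
        ∃ T S : List (latLang.Term ((Fin d × Fin d) ⊕ Fin 1)),
          frameRel (Fin d → F) hd {r : Fin 1 → F | r 0 ≠ 0} =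
            eqSet (Submodule F (Fin d → F)) T S) ∧
      ((¬ ∃ ψ : GrForm d ((Fin d × Fin d) ⊕ Fin 2) (fun _ => 1), ψ.IsConjLiterals ∧
          thetaLG (Pi.basisFun F (Fin d)) (fun _ => 1)
            (frameRel (Fin d → F) hd {r : Fin 2 → F | r 0 = 0 ∨ r 1 ≠ 0}) = ψ.defined F) ∧
        ∃ T S : List (latLang.Term ((Fin d × Fin d) ⊕ Fin 2)),
          frameRel (Fin d → F) hd {r : Fin 2 → F | r 0 = 0 ∨ r 1 ≠ 0} =
            eqSet (Submodule F (Fin d → F)) T S)) := by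
  refine ⟨fun d => ?_, fun d hd n dv _ => ⟨fun F _ V _ _ b => bijOn_thetaLG b dv, ?_, ?_⟩,
    fun d n φ c k _ h => ⟨fun dv hdv => ?_, ?_⟩,
    fun d hd n F _ S => homogeneous_existential_iff hd S,
    fun d hd n φ hφ => exists_eqSet_frameRel hd hφ,
    fun d hd F => ⟨⟨not_exists_isPositive hd, ?_⟩, not_exists_isConjLiterals hd, ?_⟩⟩
  · choose τ hτ using exists_ringFormula_thetaLF.{u, v} d
    exact ⟨τ, hτ⟩
  · choose τ hτ using exists_ringFormula_thetaLG.{u, v} dv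
    exact ⟨τ, hτ⟩
  · choose τ hτ using exists_latFormula_thetaGL.{u, v} dv hd
    exact ⟨τ, fun χ => ⟨(hτ χ).1, fun F _ V _ _ => (hτ χ).2 F V⟩⟩
  · obtain ⟨ψ, h1, h2, h3⟩ := h.exists_grForm_thetaLG.{u} dv hdv
    exact ⟨ψ, h1, h2, fun F _ => by rw [thetaLG_dimSet_latHolds, h3]⟩
  · choose ψ h1 h2 h3 using fun dv : Fin n → Fin (d + 1) =>
      h.exists_grForm_thetaLG.{u} (fun i => (dv i : ℕ)) fun i => Nat.lt_succ_iff.1 (dv i).2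
    refine ⟨ψ, fun dv => ⟨h1 dv, h2 dv⟩, fun F _ => ?_⟩
    ext x
    exact Set.ext_iff.1 (h3 x.1 F) x.2
  · obtain ⟨T, S, h⟩ := (IsRatQF.eqn (IsRat.var (0 : Fin 1))).not.exists_eqSet.{0, 0} hd
    exact ⟨T, S, by rw [← h F (Fin d → F) (by simp), frameRel_eq]; rfl⟩
  · obtain ⟨T, S, h⟩ := ((IsRatQF.eqn (IsRat.var (0 : Fin 2))).or
      (IsRatQF.eqn (IsRat.var 1)).not).exists_eqSet.{0, 0} hd
    exact ⟨T, S, by rw [← h F (Fin d → F) (by simp), frameRel_eq]; rfl⟩
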